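/- Let $\mathbf{R}$ be a real closed field and $\mathbf{C}$ an algebraic closure of $\mathbf{R}$. Let $d>0$ and let $Z\subset\mathbf{C}^n$ be a $d$-equidimensional algebraic set defined over $\mathbf{R}$, that is, the set of common zeros in $\mathbf{C}^n$ of finitely many polynomials with coefficients in $\mathbf{R}$, all of whose irreducible components have dimension $d$. A point $y\in Z$ is regular if the Jacobian matrix at $y$ of a finite set of generators of the ideal $\mathbf{I}(Z)\subset\mathbf{C}[x_1,\dots,x_n]$ of $Z$ has rank $n-d$; $\operatorname{sing}(Z)$ is the set of the points of $Z$ that are not regular. Let $\phi\in\mathbf{R}[x_1,\dots,x_n]$, viewed also as a polynomial map $\phi\colon\mathbf{C}^n\to\mathbf{C}$. Let $W^\circ(\phi,Z)$ be the set of critical points of $\phi$ on $Z$, i.e. of the regular points $y$ of $Z$ such that $d_y\phi(T_yZ)\subsetneq\mathbf{C}$, where $T_yZ$ is the tangent space to $Z$ at $y$, and let $K(\phi,Z)=W^\circ(\phi,Z)\cup\operatorname{sing}(Z)$ be the set of singular points of $\phi$ on $Z$. Proposition. Let $u\in\mathbf{R}$ and let $B$ be a bounded semi-algebraically connected component of the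 semi-algebraic set $$\{y\in Z\cap\mathbf{R}^n \mid \phi(y)<u\}.$$ Then $B\cap K(\phi,Z)\neq\emptyset$. Here a semi-algebraic set is semi-algebraically connected if any two of its points are joined by a continuous semi-algebraic path $[0,1]\subset\mathbf{R}\to\mathbf{R}^n$ inside it, and a semi-algebraically connected component of a semi-algebraic set $S$ is a nonempty semi-algebraically connected semi-algebraic subset of $S$ that is both open and closed in $S$ (for the Euclidean topology of $\mathbf{R}^n$). -/

import Mathlib

noncomputable section

namespace RealAlg

/-! ### Algebraic sets in affine space -/

section Algebraic

variable {K : Type*} [Field K] {n : ℕ}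

/-- `X ⊆ Kⁿ` is an algebraic set defined over `k`: the solution set in `Kⁿ` of a finite system of
polynomial equations with coefficients in `k`. -/
def IsAlgebraicSet (k : Type*) [Field k] [Algebra k K] (X : Set (Fin n → K)) : Prop :=
  ∃ s : Set (MvPolynomial (Fin n) k), s.Finite ∧
    X = {z | ∀ f ∈ s, MvPolynomial.aeval z f = 0}

/-- A nonempty algebraic set that is not the union of two algebraic proper subsets. -/
def IsIrreducibleAlgebraicSet (X : Set (Fin n → K)) : Prop :=
  IsAlgebraicSet K X ∧ X.Nonempty ∧
    ∀ X₁ X₂ : Set (Fin n → K), IsAlgebraicSet K X₁ → IsAlgebraicSet K X₂ →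
      X = X₁ ∪ X₂ → X = X₁ ∨ X = X₂

/-- The irreducible components of `Z`: its maximal irreducible algebraic subsets. -/
def IsIrreducibleComponent (X Z : Set (Fin n → K)) : Prop :=
  Maximal (fun Y : Set (Fin n → K) => IsIrreducibleAlgebraicSet Y ∧ Y ⊆ Z) X

/-- The dimension of an algebraic set: the Krull dimension of its coordinate ring
(it is `⊥` for the empty set). -/
def algDim (X : Set (Fin n → K)) : WithBot ℕ∞ :=
  ringKrullDim (MvPolynomial (Fin n) K ⧸ MvPolynomial.vanishingIdeal K X)

/-- `Z` is `d`-equidimensional: every irreducible component of `Z` has dimension `d`. -/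
def IsEquidimensional (d : ℕ) (Z : Set (Fin n → K)) : Prop :=
  ∀ X : Set (Fin n → K), IsIrreducibleComponent X Z → algDim X = (d : WithBot ℕ∞)

/-- The Jacobian matrix of a family of polynomials at the point `y`. -/
def jacobianAt {p : ℕ} (g : Fin p → MvPolynomial (Fin n) K) (y : Fin n → K) :
    Matrix (Fin p) (Fin n) K :=
  Matrix.of fun i j => MvPolynomial.eval y (MvPolynomial.pderiv j (g i))

/-- The regular points of a `d`-equidimensional algebraic set `Z ⊆ Kⁿ`: the points of `Z` at which
the Jacobian matrix of a finite set of generators of the ideal of `Z` has rank `n - d`. -/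
def regularLocus (d : ℕ) (Z : Set (Fin n → K)) : Set (Fin n → K) :=
  {y | y ∈ Z ∧ ∃ (p : ℕ) (g : Fin p → MvPolynomial (Fin n) K),
    Ideal.span (Set.range g) = MvPolynomial.vanishingIdeal K Z ∧
      (jacobianAt g y).rank + d = n}

/-- The singular locus of `Z`: the points of `Z` that are not regular. -/
def singularLocus (d : ℕ) (Z : Set (Fin n → K)) : Set (Fin n → K) :=
  Z \ regularLocus d Z

/-- The differential at `y` of the polynomial map `Kⁿ → K` given by `f`. -/
def differentialAt (f : MvPolynomial (Fin n) K) (y : Fin n → K) : (Fin n → K) →ₗ[K] K :=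
  ∑ j, MvPolynomial.eval y (MvPolynomial.pderiv j f) • LinearMap.proj j

/-- The (Zariski) tangent space to `Z` at `y`: the common kernel of the differentials at `y` of the
polynomials in the ideal of `Z`. -/
def tangentSpaceAt (Z : Set (Fin n → K)) (y : Fin n → K) : Submodule K (Fin n → K) :=
  ⨅ f ∈ MvPolynomial.vanishingIdeal K Z, LinearMap.ker (differentialAt f y)

/-- The critical points on the `d`-equidimensional set `Z` of the polynomial map `φ : Kⁿ → K`:
the regular points `y` of `Z` at which the differential of `φ` maps the tangent space of `Z` to a
proper subspace of `K`. -/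
def criticalPoints (d : ℕ) (φ : MvPolynomial (Fin n) K) (Z : Set (Fin n → K)) :
    Set (Fin n → K) :=
  {y | y ∈ regularLocus d Z ∧ (tangentSpaceAt Z y).map (differentialAt φ y) < ⊤}

/-- The singular points of `φ` on `Z`: the critical points of `φ` on `Z` and the singular points
of `Z`. -/
def singularPoints (d : ℕ) (φ : MvPolynomial (Fin n) K) (Z : Set (Fin n → K)) :
    Set (Fin n → K) :=
  criticalPoints d φ Z ∪ singularLocus d Z

end Algebraic

/-! ### Semi-algebraic geometry over an ordered field -/

section SemiAlgebraic

variable {R : Type*} [Field R] [LinearOrder R] {n : ℕ}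

/-- The semi-algebraic subsets of `Rⁿ`: the smallest family of sets that contains the solution sets
of polynomial equations and strict inequalities and is closed under finite unions, finite
intersections and complements. -/
inductive IsSemialgebraic : {n : ℕ} → Set (Fin n → R) → Prop
  | eq_zero {n : ℕ} (f : MvPolynomial (Fin n) R) :
      IsSemialgebraic {x : Fin n → R | MvPolynomial.eval x f = 0}
  | pos {n : ℕ} (f : MvPolynomial (Fin n) R) :
      IsSemialgebraic {x : Fin n → R | 0 < MvPolynomial.eval x f}
  | compl {n : ℕ} {S : Set (Fin n → R)} : IsSemialgebraic S → IsSemialgebraic Sᶜ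
  | union {n : ℕ} {S T : Set (Fin n → R)} :
      IsSemialgebraic S → IsSemialgebraic T → IsSemialgebraic (S ∪ T)
  | inter {n : ℕ} {S T : Set (Fin n → R)} :
      IsSemialgebraic S → IsSemialgebraic T → IsSemialgebraic (S ∩ T)

/-- `γ`, restricted to `[0, 1] ⊆ R`, is a semi-algebraic path in `S`: a continuous map
`[0, 1] → S` whose graph is a semi-algebraic subset of `R × Rⁿ = Rⁿ⁺¹`. -/
structure IsSemialgebraicPath [TopologicalSpace R] (S : Set (Fin n → R)) (γ : R → Fin n → R) :
    Prop where
  continuousOn : ContinuousOn γ (Set.Icc 0 1)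
  mapsTo : Set.MapsTo γ (Set.Icc 0 1) S
  semialgebraic_graph :
    IsSemialgebraic {x : Fin (n + 1) → R | x 0 ∈ Set.Icc 0 1 ∧ Fin.tail x = γ (x 0)}

/-- Any two points of `S` are connected by a semi-algebraic path in `S`. -/
def IsSemialgConnected [TopologicalSpace R] (S : Set (Fin n → R)) : Prop :=
  ∀ y ∈ S, ∀ y' ∈ S, ∃ γ : R → Fin n → R, IsSemialgebraicPath S γ ∧ γ 0 = y ∧ γ 1 = y'

/-- `B` is a semi-algebraically connected component of `S`: a nonempty, semi-algebraically connected
semi-algebraic subset of `S` that is both open and closed in `S`. -/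
structure IsSemialgConnectedComponent [TopologicalSpace R] (B S : Set (Fin n → R)) : Prop where
  nonempty : B.Nonempty
  subset : B ⊆ S
  semialgebraic : IsSemialgebraic B
  connected : IsSemialgConnected B
  isClopen : IsClopen ((↑) ⁻¹' B : Set S)

/-- `B ⊆ Rⁿ` is bounded: it is contained in some ball, in the sense of the Euclidean norm
`x ↦ (∑ xᵢ²)^(1/2)`. -/
def IsBoundedSet (B : Set (Fin n → R)) : Prop :=
  ∃ r : R, ∀ x ∈ B, ∑ i, x i ^ 2 ≤ r

/-- The inclusion `Rⁿ ⊆ Cⁿ`. -/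
def realPoint (C : Type*) [Field C] [Algebra R C] (x : Fin n → R) : Fin n → C :=
  fun i => algebraMap R C (x i)

/-- The set `Z ∩ Rⁿ ∩ {φ < u}`. -/
def realSublevel {C : Type*} [Field C] [Algebra R C] (Z : Set (Fin n → C))
    (φ : MvPolynomial (Fin n) R) (u : R) : Set (Fin n → R) :=
  {x | realPoint C x ∈ Z ∧ MvPolynomial.eval x φ < u}

end SemiAlgebraic

end RealAlg

end

/-! Fix `b ∈ B` and let `K` be the part of `B` where `φ ≤ φ(b)`. As `φ(b) < u`, points of `K` cannot
escape through the open condition `φ < u`, so `K` is closed; it is also bounded and semi-algebraic,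
hence `φ` has a minimum `x` on it. Since `B` is open in the sublevel set, `x` is a local minimum of
`φ` on the real points of `Z`. At a point outside the singular points of `φ`, however, `φ` and `n -
d` real equations of `Z` belong to a system of local coordinates, and lowering the coordinate `φ`
alone stays in `Z`: a contradiction (`exists_eval_lt_of_notMem_singularPoints`).

Over an arbitrary real closed field the analytic tools need algebraic proofs. The minimum comes from
`exists_forall_le`: semi-algebraic sets are stable under projection (`IsSemialgebraic.exists_cons`,
by induction on the degree of a polynomial whose root is eliminated), semi-algebraic subsets of the
line have suprema (`IsSemialgebraic.exists_isLUB`), and a supremum argument replaces compactness in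
showing that projections along bounded coordinates preserve closedness. All this rests on the
intermediate value theorem for polynomials, which follows from `C = R(i)` (`exists_re_im`). The
inverse function theorem is replaced by `exists_eval_eq_of_det_ne_zero`, proved by minimising a
squared distance over a ball.

It remains to see that the `n - d` equations `G_I` cut out `Z` near `x`
(`IsEquidimensional.exists_mul_mem_span`). Let `P` be the prime of a component through `x`. Primes
between `(G_I)` and `P` have dimension at most `d`, by a computation with differentials, so they
equal `P`. Thus every `F` vanishing on `Z` satisfies `H * F ^ k ∈ (G_I)` with `H ∉ P`. Modulo powers
of the ideal of `x`, the `G_i` behave like coordinates, for which order of vanishing is additive;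
this removes `H` and the exponent `k`, and Krull's intersection theorem gives `a * F ∈ (G_I)` with
`a(x) = 1`. Complex conjugation supplies real equations and real parts. -/

namespace RealAlg

open Polynomial Module

/-! ### The algebraic closure of a real closed field is `R(i)`. -/

section FundamentalTheorem

/-- Over a real closed field, a finite extension of odd degree is trivial. -/
theorem finrank_eq_one_of_odd {R L : Type*} [Field R] [IsRealClosed R] [CharZero R] [Field L]
    [Algebra R L] [FiniteDimensional R L] (h : Odd (finrank R L)) : finrank R L = 1 := by
  obtain ⟨α, hα⟩ := Field.exists_primitive_element R L
  have hint : IsIntegral R α := Algebra.IsIntegral.isIntegral α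
  have hdeg : (minpoly R α).natDegree = finrank R L := by
    rw [← IntermediateField.adjoin.finrank hint, hα]
    exact IntermediateField.finrank_top'
  rw [← hdeg] at h
  obtain ⟨x, hx⟩ := IsRealClosed.exists_isRoot_of_odd_natDegree h
  rw [← hdeg]
  exact Polynomial.natDegree_eq_of_degree_eq_some
    (Polynomial.degree_eq_one_of_irreducible_of_root (minpoly.irreducible hint) hx)

/-- The fixed field of a Sylow 2-subgroup has odd degree over `R`, so it is `R` and the whole Galois
group is a 2-group. -/
theorem exists_finrank_eq_two_pow {R L : Type*} [Field R] [IsRealClosed R] [CharZero R] [Field L]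
    [Algebra R L] [FiniteDimensional R L] [IsGalois R L] : ∃ k, finrank R L = 2 ^ k := by
  have : Fact (Nat.Prime 2) := ⟨Nat.prime_two⟩
  let P : Sylow 2 Gal(L/R) := default
  have hodd : Odd (finrank R (IntermediateField.fixedField (P : Subgroup Gal(L/R)))) := by
    have h1 := P.not_dvd_index
    have h2 := (P : Subgroup Gal(L/R)).card_mul_index
    rw [IsGalois.card_aut_eq_finrank, ← IntermediateField.finrank_fixedField_eq_card,
      ← finrank_mul_finrank R (IntermediateField.fixedField (P : Subgroup Gal(L/R))) L,
      mul_comm] at h2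
    rw [← Nat.eq_of_mul_eq_mul_right finrank_pos h2]
    rwa [← Nat.not_even_iff_odd, even_iff_two_dvd]
  have h1 := finrank_eq_one_of_odd hodd
  obtain ⟨k, hk⟩ := P.isPGroup'.exists_card_eq
  refine ⟨k, ?_⟩
  rw [← finrank_mul_finrank R (IntermediateField.fixedField (P : Subgroup Gal(L/R))) L, h1, one_mul,
    IntermediateField.finrank_fixedField_eq_card]
  exact hk

/-- The quadratic formula gives the minimal polynomial of a generator a root in `K`. -/
theorem finrank_ne_two_of_isSquare {K L : Type*} [Field K] [CharZero K] [Field L] [Algebra K L]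
    (hK : ∀ x : K, IsSquare x) : finrank K L ≠ 2 := by
  intro h
  have : FiniteDimensional K L := FiniteDimensional.of_finrank_pos (by omega)
  obtain ⟨α, hα⟩ := Field.exists_primitive_element K L
  have hint : IsIntegral K α := Algebra.IsIntegral.isIntegral α
  have hdeg : (minpoly K α).natDegree = 2 := by
    rw [← IntermediateField.adjoin.finrank hint, hα, ← h]
    exact IntermediateField.finrank_top'
  obtain ⟨s, hs⟩ := hK (discrim 1 ((minpoly K α).coeff 1) ((minpoly K α).coeff 0))
  have hlead : (minpoly K α).coeff 2 = 1 := by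
    rw [← hdeg]; exact minpoly.monic hint
  have hroot : (minpoly K α).IsRoot ((-((minpoly K α).coeff 1) + s) / (2 * 1)) := by
    rw [Polynomial.IsRoot, Polynomial.eval_eq_sum_range, hdeg]
    have := (quadratic_eq_zero_iff (one_ne_zero) hs
      ((-((minpoly K α).coeff 1) + s) / (2 * 1))).2 (Or.inl rfl)
    simp only [Finset.sum_range_succ, Finset.sum_range_zero, hlead]
    linear_combination this
  have : (minpoly K α).natDegree = 1 := Polynomial.natDegree_eq_of_degree_eq_some
    (Polynomial.degree_eq_one_of_irreducible_of_root (minpoly.irreducible hint) hroot)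
  omega

/-- A nontrivial 2-group has a subgroup of index two, whose fixed field would be a quadratic
extension of `K`. -/
theorem finrank_eq_one_of_isSquare {K L : Type*} [Field K] [CharZero K] [Field L] [Algebra K L]
    [FiniteDimensional K L] [IsGalois K L]
    (hK : ∀ x : K, IsSquare x) {k : ℕ} (hk : finrank K L = 2 ^ k) : finrank K L = 1 := by
  have : Fact (Nat.Prime 2) := ⟨Nat.prime_two⟩
  rcases k with _ | k
  · simpa using hk
  exfalso
  obtain ⟨H, hH⟩ := Sylow.exists_subgroup_card_pow_prime (G := Gal(L/K)) 2 (n := k)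
    (by rw [IsGalois.card_aut_eq_finrank, hk]; exact pow_dvd_pow _ (Nat.le_succ k))
  have h2 := finrank_mul_finrank K (IntermediateField.fixedField H) L
  rw [IntermediateField.finrank_fixedField_eq_card, hH, hk, pow_succ, mul_comm] at h2
  exact finrank_ne_two_of_isSquare hK (Nat.eq_of_mul_eq_mul_left (by positivity) h2)

variable {R C : Type*} [Field R] [LinearOrder R] [IsStrictOrderedRing R] [IsRealClosed R]
  [Field C] [Algebra R C]

theorem exists_sq_eq_of_nonneg {x : R} (hx : 0 ≤ x) : ∃ y, 0 ≤ y ∧ y ^ 2 = x := by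
  obtain ⟨r, hr⟩ := IsRealClosed.exists_eq_pow_of_nonneg hx two_ne_zero
  exact ⟨|r|, abs_nonneg r, by rw [sq_abs, hr]⟩

/-- Half-angle formulas for the square root of `a + bi`: with `m` its modulus, `c² = (m + a)/2` and
`d² = (m - a)/2`, the sign of `d` being adjusted to that of `b`. -/
theorem exists_complex_sq (a b : R) : ∃ c d : R, c ^ 2 - d ^ 2 = a ∧ 2 * c * d = b := by
  obtain ⟨m, hm0, hm⟩ := exists_sq_eq_of_nonneg (add_nonneg (sq_nonneg a) (sq_nonneg b))
  obtain ⟨h2, h3⟩ := abs_le_of_sq_le_sq' (a := a) (by nlinarith [sq_nonneg b]) hm0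
  obtain ⟨c, hc0, hc⟩ := exists_sq_eq_of_nonneg (x := (m + a) / 2) (by linarith)
  obtain ⟨d, hd0, hd⟩ := exists_sq_eq_of_nonneg (x := (m - a) / 2) (by linarith)
  have h4 : (2 * c * d) ^ 2 = b ^ 2 := by
    have : (2 * c * d) ^ 2 = 4 * c ^ 2 * d ^ 2 := by ring
    rw [this, hc, hd]; linear_combination hm
  rcases sq_eq_sq_iff_eq_or_eq_neg.1 h4 with h | h
  · exact ⟨c, d, by rw [hc, hd]; ring, h⟩
  · exact ⟨c, -d, by rw [neg_sq, hc, hd]; ring, by linear_combination -h⟩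

theorem exists_re_im_of_mem_adjoin {R C : Type*} [Field R] [Field C] [Algebra R C] {i : C} (hi : i ^ 2 = -1) {z : C}
    (hz : z ∈ IntermediateField.adjoin R {i}) :
    ∃ a b : R, z = algebraMap R C a + algebraMap R C b * i := by
  have hint : IsIntegral R i :=
    ⟨X ^ 2 + 1, by monicity!, by simp [hi]⟩
  rw [← IntermediateField.mem_toSubalgebra,
    IntermediateField.adjoin_simple_toSubalgebra_of_isAlgebraic hint.isAlgebraic] at hz
  induction hz using Algebra.adjoin_induction with
  | mem x hx => exact ⟨0, 1, by simpa using hx⟩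
  | algebraMap r => exact ⟨r, 0, by simp⟩
  | add x y _ _ hx hy =>
    obtain ⟨a, b, rfl⟩ := hx
    obtain ⟨c, d, rfl⟩ := hy
    exact ⟨a + c, b + d, by simp only [map_add]; ring⟩
  | mul x y _ _ hx hy =>
    obtain ⟨a, b, rfl⟩ := hx
    obtain ⟨c, d, rfl⟩ := hy
    refine ⟨a * c - b * d, a * d + b * c, ?_⟩
    simp only [map_add, map_sub, map_mul]
    linear_combination (algebraMap R C b) * (algebraMap R C d) * hi

/-- The fundamental theorem of algebra over a real closed field. -/
theorem exists_re_im [IsAlgClosure R C] {i : C} (hi : i ^ 2 = -1) (z : C) :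
    ∃ a b : R, z = algebraMap R C a + algebraMap R C b * i := by
  have := IsAlgClosure.isAlgClosed R (K := C)
  have : Algebra.IsAlgebraic R C := IsAlgClosure.isAlgebraic
  have : CharZero C := charZero_of_injective_algebraMap (algebraMap R C).injective
  have : Normal R C := IsAlgClosure.normal R C
  apply exists_re_im_of_mem_adjoin hi
  let K := IntermediateField.adjoin R {i}
  let F₀ := IntermediateField.adjoin R {i, z}
  have : FiniteDimensional R F₀ := IntermediateField.finiteDimensional_adjoin
    fun x _ => Algebra.IsIntegral.isIntegral x
  let L := IntermediateField.normalClosure R F₀ C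
  have hF : F₀ ≤ L := F₀.le_normalClosure
  have hiL : i ∈ L := hF (IntermediateField.subset_adjoin _ _ (by simp))
  have hzL : z ∈ L := hF (IntermediateField.subset_adjoin _ _ (by simp))
  have : FiniteDimensional R L := normalClosure.is_finiteDimensional R F₀ C
  have : IsGalois R L := { to_isSeparable := inferInstance, to_normal := inferInstance }
  obtain ⟨k, hk⟩ := exists_finrank_eq_two_pow (R := R) (L := L)
  let j : L := ⟨i, hiL⟩
  have hj : j ^ 2 = -1 := Subtype.ext hi
  let M := IntermediateField.adjoin R {j}
  -- Since `M = R(i)` has all square roots and `[L : M]` is a power of two, `L = M`.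
  have hsq : ∀ x : M, IsSquare x := by
    rintro ⟨x, hx⟩
    obtain ⟨a, b, rfl⟩ := exists_re_im_of_mem_adjoin hj hx
    obtain ⟨c, d, h1, h2⟩ := exists_complex_sq a b
    have hjM : j ∈ M := IntermediateField.mem_adjoin_simple_self R j
    refine ⟨⟨algebraMap R L c + algebraMap R L d * j,
      add_mem (M.algebraMap_mem c) (mul_mem (M.algebraMap_mem d) hjM)⟩, Subtype.ext ?_⟩
    simp only [MulMemClass.mk_mul_mk]
    rw [← h1, ← h2]
    simp only [map_sub, map_mul, map_pow, map_ofNat]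
    linear_combination -(algebraMap R L d) ^ 2 * hj
  have hdvd : finrank M L ∣ 2 ^ k := by
    rw [← hk, ← finrank_mul_finrank R M L]; exact dvd_mul_left _ _
  obtain ⟨k', -, hk'⟩ := (Nat.dvd_prime_pow Nat.prime_two).1 hdvd
  have h1 : finrank M L = 1 := finrank_eq_one_of_isSquare hsq hk'
  have hM : M = ⊤ := by
    rwa [← IntermediateField.finrank_eq_one_iff_eq_top]
  have hzM : (⟨z, hzL⟩ : L) ∈ M := hM ▸ IntermediateField.mem_top
  obtain ⟨a, b, hab⟩ := exists_re_im_of_mem_adjoin hj hzM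
  have hab' : z = algebraMap R C a + algebraMap R C b * i := congrArg Subtype.val hab
  rw [hab']
  exact add_mem (K.algebraMap_mem a) (mul_mem (K.algebraMap_mem b)
    (IntermediateField.mem_adjoin_simple_self R i))

end FundamentalTheorem

/-! ### Intermediate values, Rolle's theorem and behaviour at infinity for polynomials in one
variable. -/

section UnivariatePolynomials

variable {R : Type*} [Field R] [LinearOrder R] [IsStrictOrderedRing R]

theorem eval_mul_eval_pos_of_irreducible [IsRealClosed R] {q : R[X]} (hq : Irreducible q) {a b : R}
    (hab : a ≤ b) (h : ∀ t ∈ Set.Icc a b, q.eval t ≠ 0) : 0 < q.eval a * q.eval b := by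
  by_cases h1 : q.natDegree = 1
  · obtain ⟨c, hc, e, rfl⟩ := Polynomial.natDegree_eq_one.1 h1
    simp only [eval_add, eval_mul, eval_C, eval_X] at h ⊢
    by_contra hneg
    have hr : c * (-e / c) + e = 0 := by field_simp; ring
    have hprod : c ^ 2 * ((a - -e / c) * (b - -e / c)) ≤ 0 := by
      refine le_of_eq_of_le ?_ (not_lt.1 hneg)
      field_simp
      ring
    have hc2 : 0 < c ^ 2 := by positivity
    have h2 : (a - -e / c) * (b - -e / c) ≤ 0 := by
      by_contra h3
      exact absurd hprod (not_le.2 (mul_pos hc2 (not_le.1 h3)))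
    rcases mul_nonpos_iff.1 h2 with h3 | h3
    · have : a = b := by linarith
      exact h (-e / c) ⟨by linarith, by linarith⟩ hr
    · exact h (-e / c) ⟨by linarith, by linarith⟩ hr
  have hroot : ∀ t, q.eval t ≠ 0 := fun t ht => h1
    (Polynomial.natDegree_eq_of_degree_eq_some
      (Polynomial.degree_eq_one_of_irreducible_of_root hq ht))
  let C' := AlgebraicClosure R
  obtain ⟨z, hz⟩ := IsAlgClosed.exists_aeval_eq_zero C' q (Polynomial.degree_pos_of_irreducible hq).ne'
  obtain ⟨i, hi⟩ := IsAlgClosed.exists_pow_nat_eq (-1 : C') two_pos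
  obtain ⟨s, t, rfl⟩ := exists_re_im (R := R) hi z
  have ht : t ≠ 0 := by
    rintro rfl
    rw [map_zero, zero_mul, add_zero, Polynomial.aeval_algebraMap_apply] at hz
    refine hroot s ?_
    rw [← Polynomial.coe_aeval_eq_eval]
    exact (algebraMap R C').injective (by rw [hz, map_zero])
  -- With a nonreal root `s + ti`, `q` is a constant multiple of this sum of squares, which is
  -- positive everywhere.
  obtain ⟨r, hr⟩ : q ∣ (X - C s) ^ 2 + C (t ^ 2) := by
    refine (hq.dvd_iff_aeval_eq_zero hz).1 ?_
    simp only [map_add, map_pow, map_sub, aeval_X, aeval_C]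
    linear_combination (algebraMap R C' t) ^ 2 * hi
  have hdeg : ((X - C s) ^ 2 + C (t ^ 2) : R[X]).natDegree = 2 := by
    rw [Polynomial.natDegree_add_C, Polynomial.natDegree_pow, Polynomial.natDegree_X_sub_C]
  have hr0 : r ≠ 0 := by
    rintro rfl
    rw [mul_zero] at hr
    rw [hr] at hdeg
    simp at hdeg
  rw [hr, Polynomial.natDegree_mul hq.ne_zero hr0] at hdeg
  have hpos := hq.natDegree_pos
  obtain ⟨e, rfl⟩ := Polynomial.natDegree_eq_zero.1 (by omega : r.natDegree = 0)
  have hval : ∀ x, q.eval x * e = (x - s) ^ 2 + t ^ 2 := fun x => by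
    have := congrArg (Polynomial.eval x) hr
    simp only [eval_add, eval_pow, eval_sub, eval_X, eval_C, eval_mul] at this
    exact this.symm
  have h3 : 0 < (q.eval a * e) * (q.eval b * e) := by
    rw [hval, hval]; positivity
  have h4 : (q.eval a * e) * (q.eval b * e) = (q.eval a * q.eval b) * e ^ 2 := by ring
  rw [h4] at h3
  exact pos_of_mul_pos_left h3 (sq_nonneg e)

/-- A polynomial without roots in an interval has constant sign there. -/
theorem eval_mul_eval_pos [IsRealClosed R] (p : R[X]) {a b : R} (hab : a ≤ b)
    (h : ∀ t ∈ Set.Icc a b, p.eval t ≠ 0) : 0 < p.eval a * p.eval b := by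
  induction p using WfDvdMonoid.induction_on_irreducible with
  | zero => exact absurd eval_zero (h a ⟨le_rfl, hab⟩)
  | unit u hu =>
    obtain ⟨c, hc, rfl⟩ := Polynomial.isUnit_iff.1 hu
    have := h a ⟨le_rfl, hab⟩
    simp only [eval_C] at this ⊢
    exact mul_self_pos.2 this
  | mul p q _ hq ih =>
    have h1 := ih fun t ht h0 => h t ht (by rw [eval_mul, h0, mul_zero])
    have h2 := eval_mul_eval_pos_of_irreducible hq hab
      fun t ht h0 => h t ht (by rw [eval_mul, h0, zero_mul])
    rw [eval_mul, eval_mul, mul_mul_mul_comm]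
    exact mul_pos h2 h1

/-- The intermediate value theorem for polynomials over a real closed field. -/
theorem exists_root_of_eval_mul_neg [IsRealClosed R] (p : R[X]) {a b : R} (hab : a ≤ b)
    (h : p.eval a * p.eval b < 0) : ∃ c ∈ Set.Ioo a b, p.eval c = 0 := by
  by_contra! hcon
  refine h.not_gt (eval_mul_eval_pos p hab fun t ht h0 => ?_)
  rcases ht.1.eq_or_lt with rfl | h1
  · rw [h0, zero_mul] at h; exact h.false
  rcases ht.2.eq_or_lt with rfl | h2
  · rw [h0, mul_zero] at h; exact h.false
  exact hcon t ⟨h1, h2⟩ h0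

/-- Factor `p = (X - a)^(m+1) (X - b)^(k+1) r`, with `r` of constant sign on `[a, b]`. Then `p' = (X
- a)^m (X - b)^k s`, where `s(a)` and `s(b)` have opposite signs. -/
theorem exists_derivative_root_of_forall_ne [IsRealClosed R] {p : R[X]} (hp : p ≠ 0) {a b : R}
    (hab : a < b) (ha : p.eval a = 0) (hb : p.eval b = 0)
    (h : ∀ t ∈ Set.Ioo a b, p.eval t ≠ 0) : ∃ c ∈ Set.Ioo a b, p.derivative.eval c = 0 := by
  obtain ⟨p₁, hp₁, hdvd₁⟩ := Polynomial.exists_eq_pow_rootMultiplicity_mul_and_not_dvd p hp a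
  obtain ⟨m, hm⟩ := Nat.exists_eq_succ_of_ne_zero
    ((Polynomial.rootMultiplicity_pos hp).2 ha).ne'
  have hb₁ : p₁.eval b = 0 := by
    rw [hp₁, eval_mul, eval_pow, eval_sub, eval_X, eval_C] at hb
    exact (mul_eq_zero.1 hb).resolve_left (pow_ne_zero _ (sub_pos.2 hab).ne')
  have hp₁0 : p₁ ≠ 0 := by rintro rfl; simp at hdvd₁
  obtain ⟨r, hr, hdvd⟩ := Polynomial.exists_eq_pow_rootMultiplicity_mul_and_not_dvd p₁ hp₁0 b
  obtain ⟨k, hk⟩ := Nat.exists_eq_succ_of_ne_zero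
    ((Polynomial.rootMultiplicity_pos hp₁0).2 hb₁).ne'
  rw [hm] at hp₁
  rw [hk] at hr
  have hrb : r.eval b ≠ 0 := fun h0 => hdvd (Polynomial.dvd_iff_isRoot.2 h0)
  have hra : r.eval a ≠ 0 := fun h0 => hdvd₁ (Polynomial.dvd_iff_isRoot.2 (by
    rw [IsRoot, hr, eval_mul, h0, mul_zero]))
  have hrpos : 0 < r.eval a * r.eval b := by
    refine eval_mul_eval_pos r hab.le fun t ht h0 => ?_
    rcases ht.1.eq_or_lt with rfl | h1
    · exact hra h0
    rcases ht.2.eq_or_lt with rfl | h2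
    · exact hrb h0
    exact h t ⟨h1, h2⟩ (by rw [hp₁, hr, eval_mul, eval_mul, h0, mul_zero, mul_zero])
  let s : R[X] := C ((m + 1 : ℕ) : R) * (X - C b) * r + C ((k + 1 : ℕ) : R) * (X - C a) * r
    + (X - C a) * (X - C b) * r.derivative
  have hs : p.derivative = (X - C a) ^ m * (X - C b) ^ k * s := by
    rw [hp₁, hr]
    simp only [derivative_mul, derivative_X_sub_C_pow, Nat.succ_eq_add_one, Nat.add_sub_cancel, s]
    ring
  obtain ⟨c, hc, hc0⟩ := exists_root_of_eval_mul_neg s hab.le (by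
    have hsa : s.eval a = -((m + 1 : ℕ) * (b - a) * r.eval a) := by simp [s]; ring
    have hsb : s.eval b = (k + 1 : ℕ) * (b - a) * r.eval b := by simp [s]
    have h1 : 0 < ((m + 1 : ℕ) : R) * ((k + 1 : ℕ) : R) * (b - a) ^ 2 * (r.eval a * r.eval b) := by
      have := sub_pos.2 hab
      positivity
    rw [hsa, hsb]
    linarith)
  exact ⟨c, hc, by rw [hs, eval_mul, hc0, mul_zero]⟩

/-- Rolle's theorem for polynomials over a real closed field. -/
theorem exists_derivative_root [IsRealClosed R] {p : R[X]} (hp : p ≠ 0) {a b : R}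
    (hab : a < b) (ha : p.eval a = 0) (hb : p.eval b = 0) :
    ∃ c ∈ Set.Ioo a b, p.derivative.eval c = 0 := by
  classical
  -- The least root above `a` leaves no root strictly in between.
  let F := p.roots.toFinset.filter (a < ·)
  have hmem : ∀ t, t ∈ F ↔ p.eval t = 0 ∧ a < t := fun t => by
    simp [F, hp]
  have hF : F.Nonempty := ⟨b, (hmem b).2 ⟨hb, hab⟩⟩
  obtain ⟨h1, h2⟩ := (hmem _).1 (F.min'_mem hF)
  obtain ⟨c, hc, hc0⟩ := exists_derivative_root_of_forall_ne hp h2 ha h1 fun t ht h0 =>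
    (F.min'_le t ((hmem t).2 ⟨h0, ht.1⟩)).not_gt ht.2
  exact ⟨c, ⟨hc.1, hc.2.trans_le (F.min'_le b ((hmem b).2 ⟨hb, hab⟩))⟩, hc0⟩

/-- Rolle's theorem for `p` minus its chord shows that the slope of the chord is a value of `p'`. -/
theorem eval_lt_eval_of_derivative_pos [IsRealClosed R] {p : R[X]} {a b : R} (hab : a < b)
    (h : ∀ t ∈ Set.Ioo a b, 0 < p.derivative.eval t) : p.eval a < p.eval b := by
  let σ := (p.eval b - p.eval a) / (b - a)
  let q := p - C (p.eval a) - C σ * (X - C a)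
  have hba : b - a ≠ 0 := (sub_pos.2 hab).ne'
  obtain ⟨c, hc, hc0⟩ : ∃ c ∈ Set.Ioo a b, q.derivative.eval c = 0 := by
    by_cases hq : q = 0
    · exact ⟨(a + b) / 2, ⟨by linarith, by linarith⟩, by rw [hq]; simp⟩
    · refine exists_derivative_root hq hab (by simp [q]) ?_
      simp only [q, eval_sub, eval_mul, eval_C, eval_X, σ]
      field_simp
      ring
  have h1 : p.derivative.eval c = σ := by
    simp only [q, derivative_sub, derivative_C, derivative_mul, derivative_X, eval_sub,
      eval_C, zero_mul, sub_zero, mul_one, zero_add] at hc0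
    linarith
  have h2 : 0 < σ := h1 ▸ h c hc
  have h3 : p.eval b - p.eval a = σ * (b - a) := by simp only [σ]; field_simp
  have := mul_pos h2 (sub_pos.2 hab)
  linarith

/-- Write `p = X * p.divX + p(0)`. If `p.divX ≥ ε` far out, then `p(t) ≥ εt - |p(0)| ≥ ε` once also
`t ≥ 1 + |p(0)|/ε`, so the same `ε` survives the induction. -/
theorem exists_forall_gt_eval_ge {p : R[X]} (hp : 0 < p.leadingCoeff) :
    ∃ ε M : R, 0 < ε ∧ ∀ t, M < t → ε ≤ p.eval t := by
  induction h : p.natDegree generalizing p with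
  | zero =>
    obtain ⟨c, rfl⟩ := Polynomial.natDegree_eq_zero.1 h
    rw [leadingCoeff_C] at hp
    exact ⟨c, 0, hp, fun t _ => by simp⟩
  | succ n ih =>
    have hn : p.divX.natDegree = n := by rw [Polynomial.natDegree_divX_eq_natDegree_tsub_one, h]; rfl
    have hl : p.divX.leadingCoeff = p.leadingCoeff := by
      rw [leadingCoeff, leadingCoeff, hn, h, coeff_divX]
    obtain ⟨ε, M, hε, hM⟩ := ih (hl ▸ hp) hn
    refine ⟨ε, max M (max 1 (1 + (|p.coeff 0|) / ε)), hε, fun t ht => ?_⟩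
    simp only [max_lt_iff] at ht
    have h1 := hM t ht.1
    rw [← p.divX_mul_X_add, eval_add, eval_mul, eval_X, eval_C]
    have h2 : ε * t ≤ p.divX.eval t * t := by
      apply mul_le_mul_of_nonneg_right h1; linarith [ht.2.1]
    have h3 : |p.coeff 0| ≤ ε * (t - 1) := by
      have : |p.coeff 0| / ε ≤ t - 1 := by linarith [ht.2.2]
      rw [div_le_iff₀ hε] at this
      linarith
    have h4 := neg_abs_le (p.coeff 0)
    linarith

/-- The leading coefficient of `p` must be positive, since otherwise `-p'` would be eventually
positive. -/
theorem exists_gt_eval_pos_of_derivative_pos {p : R[X]} {a : R}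
    (h : ∀ t, a < t → 0 < p.derivative.eval t) : ∃ t, a < t ∧ 0 < p.eval t := by
  have hdeg : p.natDegree ≠ 0 := by
    intro h0
    obtain ⟨c, rfl⟩ := Polynomial.natDegree_eq_zero.1 h0
    have := h (a + 1) (by linarith)
    simp at this
  have hl : p.derivative.leadingCoeff = p.leadingCoeff * p.natDegree := by
    rw [leadingCoeff, Polynomial.natDegree_derivative, coeff_derivative, leadingCoeff]
    have : p.natDegree - 1 + 1 = p.natDegree := by omega
    rw [this]
    congr 1
    exact_mod_cast this
  have hl0 : 0 < p.leadingCoeff := by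
    by_contra hcon
    have hp0 : p.leadingCoeff ≠ 0 := by
      intro h0
      rw [Polynomial.leadingCoeff_eq_zero] at h0
      rw [h0] at hdeg
      simp at hdeg
    have h1 : p.leadingCoeff < 0 := lt_of_le_of_ne (not_lt.1 hcon) hp0
    have h2 : 0 < (-p.derivative).leadingCoeff := by
      rw [leadingCoeff_neg, hl]
      have : (0 : R) < p.natDegree := by exact_mod_cast Nat.pos_of_ne_zero hdeg
      nlinarith
    obtain ⟨ε, M, hε, hM⟩ := exists_forall_gt_eval_ge h2
    have h3 := hM (max M a + 1) (by linarith [le_max_left M a])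
    have h4 := h (max M a + 1) (by linarith [le_max_right M a])
    rw [eval_neg] at h3
    linarith
  obtain ⟨ε, M, hε, hM⟩ := exists_forall_gt_eval_ge hl0
  exact ⟨max M a + 1, by linarith [le_max_right M a],
    hε.trans_le (hM _ (by linarith [le_max_left M a]))⟩

theorem exists_lt_eval_neg_of_derivative_pos {p : R[X]} {b : R}
    (h : ∀ t, t < b → 0 < p.derivative.eval t) : ∃ t, t < b ∧ p.eval t < 0 := by
  obtain ⟨t, ht, hpos⟩ := exists_gt_eval_pos_of_derivative_pos (p := -(p.comp (-X))) (a := -b)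
    fun t ht => by
      simpa [derivative_comp] using h (-t) (by linarith)
  exact ⟨-t, by linarith, by simpa using hpos⟩

end UnivariatePolynomials

end RealAlg

namespace RealAlg

/-! ### Polynomial functions. -/

section PolynomialFunctions

variable {R : Type*} [Field R] {m n k : ℕ}

/-- The polynomial functions `Rⁿ → R`. -/
def IsPolyFun (f : (Fin n → R) → R) : Prop :=
  ∃ p : MvPolynomial (Fin n) R, ∀ x, f x = MvPolynomial.eval x p

namespace IsPolyFun

theorem eval (p : MvPolynomial (Fin n) R) : IsPolyFun fun x => MvPolynomial.eval x p :=
  ⟨p, fun _ => rfl⟩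

theorem const (c : R) : IsPolyFun fun _ : Fin n → R => c :=
  ⟨MvPolynomial.C c, fun x => by simp⟩

theorem coord (i : Fin n) : IsPolyFun fun x : Fin n → R => x i :=
  ⟨MvPolynomial.X i, fun x => by simp⟩

theorem add {f g : (Fin n → R) → R} (hf : IsPolyFun f) (hg : IsPolyFun g) :
    IsPolyFun fun x => f x + g x := by
  obtain ⟨p, hp⟩ := hf
  obtain ⟨q, hq⟩ := hg
  exact ⟨p + q, fun x => by simp only [hp, hq, map_add]⟩

theorem mul {f g : (Fin n → R) → R} (hf : IsPolyFun f) (hg : IsPolyFun g) :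
    IsPolyFun fun x => f x * g x := by
  obtain ⟨p, hp⟩ := hf
  obtain ⟨q, hq⟩ := hg
  exact ⟨p * q, fun x => by simp only [hp, hq, map_mul]⟩

theorem neg {f : (Fin n → R) → R} (hf : IsPolyFun f) : IsPolyFun fun x => -f x := by
  simpa using (const (-1)).mul hf

theorem sub {f g : (Fin n → R) → R} (hf : IsPolyFun f) (hg : IsPolyFun g) :
    IsPolyFun fun x => f x - g x := by
  simpa [sub_eq_add_neg] using hf.add hg.neg

theorem pow {f : (Fin n → R) → R} (hf : IsPolyFun f) (e : ℕ) : IsPolyFun fun x => f x ^ e := by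
  obtain ⟨p, hp⟩ := hf
  exact ⟨p ^ e, fun x => by simp only [hp, map_pow]⟩

theorem sum {ι : Type*} (s : Finset ι) {f : ι → (Fin n → R) → R} (hf : ∀ i, IsPolyFun (f i)) :
    IsPolyFun fun x => ∑ i ∈ s, f i x := by
  choose p hp using hf
  exact ⟨∑ i ∈ s, p i, fun x => by simp [hp]⟩

theorem comp {f : (Fin n → R) → R} (hf : IsPolyFun f) {F : (Fin m → R) → Fin n → R}
    (hF : ∀ i, IsPolyFun fun y => F y i) : IsPolyFun fun y => f (F y) := by
  obtain ⟨p, hp⟩ := hf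
  choose q hq using hF
  refine ⟨MvPolynomial.bind₁ q p, fun y => ?_⟩
  have hF : F y = fun i => MvPolynomial.aeval y (q i) := by
    funext i
    exact (hq i y).trans (by rw [← MvPolynomial.coe_aeval_eq_eval]; rfl)
  change f (F y) = _
  rw [hp, ← MvPolynomial.coe_aeval_eq_eval, ← MvPolynomial.coe_aeval_eq_eval, RingHom.coe_coe,
    RingHom.coe_coe, MvPolynomial.aeval_bind₁, hF]

theorem tail_apply (i : Fin n) : IsPolyFun fun y : Fin (n + 1) → R => Fin.tail y i :=
  coord i.succ

end IsPolyFun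

end PolynomialFunctions

/-! ### Closure properties and sign descriptions of semi-algebraic sets. -/

section Semialgebraic

variable {R : Type*} [Field R] [LinearOrder R] {m n : ℕ}

namespace IsSemialgebraic

theorem univ : IsSemialgebraic (Set.univ : Set (Fin n → R)) := by
  simpa using IsSemialgebraic.eq_zero (0 : MvPolynomial (Fin n) R)

theorem empty : IsSemialgebraic (∅ : Set (Fin n → R)) := by
  simpa using (univ (R := R) (n := n)).compl

theorem setOf_const (p : Prop) : IsSemialgebraic {_x : Fin n → R | p} := by
  by_cases h : p
  · simpa [h] using! univ (R := R) (n := n)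
  · simpa [h] using! empty (R := R) (n := n)

theorem and {p q : (Fin n → R) → Prop} (hp : IsSemialgebraic {x | p x})
    (hq : IsSemialgebraic {x | q x}) : IsSemialgebraic {x | p x ∧ q x} :=
  hp.inter hq

theorem or {p q : (Fin n → R) → Prop} (hp : IsSemialgebraic {x | p x})
    (hq : IsSemialgebraic {x | q x}) : IsSemialgebraic {x | p x ∨ q x} :=
  hp.union hq

theorem not {p : (Fin n → R) → Prop} (hp : IsSemialgebraic {x | p x}) :
    IsSemialgebraic {x | ¬p x} :=
  hp.compl

theorem imp {p q : (Fin n → R) → Prop} (hp : IsSemialgebraic {x | p x})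
    (hq : IsSemialgebraic {x | q x}) : IsSemialgebraic {x | p x → q x} := by
  simpa only [imp_iff_not_or] using hp.not.or hq

theorem finite_exists {ι : Type*} [Finite ι] {p : ι → (Fin n → R) → Prop}
    (hp : ∀ i, IsSemialgebraic {x | p i x}) : IsSemialgebraic {x | ∃ i, p i x} := by
  have key : ∀ s : Set ι, s.Finite → IsSemialgebraic {x | ∃ i ∈ s, p i x} := by
    intro s hs
    induction s, hs using Set.Finite.induction_on with
    | empty => simpa using! empty (R := R) (n := n)
    | insert _ _ ih => simpa [Set.mem_insert_iff, or_and_right, exists_or] using! (hp _).or ih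
  simpa using key Set.univ Set.finite_univ

theorem finite_forall {ι : Type*} [Finite ι] {p : ι → (Fin n → R) → Prop}
    (hp : ∀ i, IsSemialgebraic {x | p i x}) : IsSemialgebraic {x | ∀ i, p i x} := by
  simpa using (finite_exists fun i => (hp i).not).not

theorem setOf_eq_zero {f : (Fin n → R) → R} (hf : IsPolyFun f) : IsSemialgebraic {x | f x = 0} := by
  obtain ⟨p, hp⟩ := hf
  simpa only [hp] using IsSemialgebraic.eq_zero p

theorem setOf_pos {f : (Fin n → R) → R} (hf : IsPolyFun f) : IsSemialgebraic {x | 0 < f x} := by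
  obtain ⟨p, hp⟩ := hf
  simpa only [hp] using IsSemialgebraic.pos p

theorem setOf_lt [IsStrictOrderedRing R] {f g : (Fin n → R) → R} (hf : IsPolyFun f)
    (hg : IsPolyFun g) : IsSemialgebraic {x | f x < g x} := by
  simpa only [sub_pos] using setOf_pos (hg.sub hf)

theorem setOf_le [IsStrictOrderedRing R] {f g : (Fin n → R) → R} (hf : IsPolyFun f)
    (hg : IsPolyFun g) : IsSemialgebraic {x | f x ≤ g x} := by
  simpa only [not_lt] using (setOf_lt hg hf).not

theorem setOf_eq {f g : (Fin n → R) → R} (hf : IsPolyFun f)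
    (hg : IsPolyFun g) : IsSemialgebraic {x | f x = g x} := by
  simpa only [sub_eq_zero] using setOf_eq_zero (hf.sub hg)

theorem preimage {S : Set (Fin n → R)} (hS : IsSemialgebraic S) {F : (Fin m → R) → Fin n → R}
    (hF : ∀ i, IsPolyFun fun y => F y i) : IsSemialgebraic {y | F y ∈ S} := by
  induction hS with
  | eq_zero f => exact setOf_eq_zero ((IsPolyFun.eval f).comp hF)
  | pos f => exact setOf_pos ((IsPolyFun.eval f).comp hF)
  | compl _ ih => exact IsSemialgebraic.not ih
  | union _ _ ih₁ ih₂ => exact IsSemialgebraic.or ih₁ ih₂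
  | inter _ _ ih₁ ih₂ => exact IsSemialgebraic.and ih₁ ih₂

/-- A semi-algebraic set is determined by the signs of finitely many polynomials. -/
theorem exists_sign {S : Set (Fin n → R)} (hS : IsSemialgebraic S) :
    ∃ (ι : Type) (_ : Fintype ι) (q : ι → MvPolynomial (Fin n) R) (T : Set (ι → SignType)),
      ∀ z, z ∈ S ↔ (fun i => SignType.sign (MvPolynomial.eval z (q i))) ∈ T := by
  induction hS with
  | eq_zero f => exact ⟨Unit, inferInstance, fun _ => f, {σ | σ () = 0}, fun z => by simp⟩
  | pos f => exact ⟨Unit, inferInstance, fun _ => f, {σ | σ () = 1}, fun z => by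
    simp [sign_eq_one_iff]⟩
  | compl _ ih =>
    obtain ⟨ι, hι, q, T, h⟩ := ih
    exact ⟨ι, hι, q, Tᶜ, fun z => by rw [Set.mem_compl_iff, h, Set.mem_compl_iff]⟩
  | union _ _ ih₁ ih₂ =>
    obtain ⟨ι, hι, q, T, h⟩ := ih₁
    obtain ⟨ι', hι', q', T', h'⟩ := ih₂
    exact ⟨ι ⊕ ι', inferInstance, Sum.elim q q', {σ | σ ∘ Sum.inl ∈ T ∨ σ ∘ Sum.inr ∈ T'},
      fun z => by rw [Set.mem_union, h, h']; rfl⟩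
  | inter _ _ ih₁ ih₂ =>
    obtain ⟨ι, hι, q, T, h⟩ := ih₁
    obtain ⟨ι', hι', q', T', h'⟩ := ih₂
    exact ⟨ι ⊕ ι', inferInstance, Sum.elim q q', {σ | σ ∘ Sum.inl ∈ T ∧ σ ∘ Sum.inr ∈ T'},
      fun z => by rw [Set.mem_inter_iff, h, h']; rfl⟩

end IsSemialgebraic

end Semialgebraic

/-! ### Univariate polynomials with polynomial parameters. -/

section PolynomialFamilies

open Polynomial

variable {R : Type*} [Field R] {m n d e : ℕ}

/-- A family of univariate polynomials of degree at most `d`, with coefficients depending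
polynomially on the parameter. -/
structure IsPolyFamily (d : ℕ) (g : (Fin n → R) → R[X]) : Prop where
  coeff : ∀ i, IsPolyFun fun x => (g x).coeff i
  natDegree_le : ∀ x, (g x).natDegree ≤ d

namespace IsPolyFamily

theorem mono {g : (Fin n → R) → R[X]} (hg : IsPolyFamily d g) (h : d ≤ e) : IsPolyFamily e g :=
  ⟨hg.coeff, fun x => (hg.natDegree_le x).trans h⟩

theorem comp {g : (Fin n → R) → R[X]} (hg : IsPolyFamily d g) {F : (Fin m → R) → Fin n → R}
    (hF : ∀ i, IsPolyFun fun y => F y i) : IsPolyFamily d fun y => g (F y) :=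
  ⟨fun i => (hg.coeff i).comp hF, fun _ => hg.natDegree_le _⟩

theorem tail {g : (Fin n → R) → R[X]} (hg : IsPolyFamily d g) :
    IsPolyFamily d fun y : Fin (n + 1) → R => g (Fin.tail y) :=
  hg.comp IsPolyFun.tail_apply

theorem eval {g : (Fin n → R) → R[X]} (hg : IsPolyFamily d g) {t : (Fin n → R) → R}
    (ht : IsPolyFun t) : IsPolyFun fun x => (g x).eval (t x) := by
  have : (fun x => (g x).eval (t x)) =
      fun x => ∑ i ∈ Finset.range (d + 1), (g x).coeff i * t x ^ i := by
    funext x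
    exact Polynomial.eval_eq_sum_range' (Nat.lt_succ_of_le (hg.natDegree_le x)) _
  rw [this]
  exact IsPolyFun.sum _ fun i => (hg.coeff i).mul (ht.pow i)

theorem neg {g : (Fin n → R) → R[X]} (hg : IsPolyFamily d g) : IsPolyFamily d fun x => -g x :=
  ⟨fun i => by simpa using (hg.coeff i).neg, fun x => by simpa using hg.natDegree_le x⟩

theorem C_mul {g : (Fin n → R) → R[X]} (hg : IsPolyFamily d g) (c : R) :
    IsPolyFamily d fun x => C c * g x :=
  ⟨fun i => by simpa using (IsPolyFun.const c).mul (hg.coeff i),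
    fun x => (natDegree_C_mul_le _ _).trans (hg.natDegree_le x)⟩

theorem derivative {g : (Fin n → R) → R[X]} (hg : IsPolyFamily (d + 1) g) :
    IsPolyFamily d fun x => Polynomial.derivative (g x) where
  coeff i := by
    simp only [coeff_derivative]
    exact (hg.coeff _).mul (IsPolyFun.const _)
  natDegree_le x := by
    have := natDegree_derivative_le (g x)
    have := hg.natDegree_le x
    omega

theorem natDegree_le_of_coeff {p : R[X]} (h : p.natDegree ≤ d + 1) (h0 : p.coeff (d + 1) = 0) :
    p.natDegree ≤ d :=
  natDegree_le_iff_coeff_eq_zero.2 fun N hN => by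
    rcases (Nat.succ_le_of_lt hN).eq_or_lt with rfl | h1
    · exact h0
    · exact coeff_eq_zero_of_natDegree_lt (h.trans_lt h1)

/-- Serves the parameters at which the coefficient of degree `d + 1` vanishes: there the truncation
is `g x` itself. -/
theorem truncate {g : (Fin n → R) → R[X]} (hg : IsPolyFamily (d + 1) g) :
    IsPolyFamily d fun x => g x - C ((g x).coeff (d + 1)) * X ^ (d + 1) where
  coeff i := by
    simp only [coeff_sub, coeff_C_mul, coeff_X_pow]
    exact (hg.coeff i).sub ((hg.coeff _).mul (IsPolyFun.const _))
  natDegree_le x := natDegree_le_of_coeff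
    ((natDegree_sub_le _ _).trans (max_le (hg.natDegree_le x) (natDegree_C_mul_X_pow_le _ _)))
    (by simp)

theorem exists_of_mvPolynomial (p : MvPolynomial (Fin (n + 1)) R) :
    ∃ (d : ℕ) (g : (Fin n → R) → R[X]), IsPolyFamily d g ∧
      ∀ y, MvPolynomial.eval y p = (g (Fin.tail y)).eval (y 0) := by
  refine ⟨(MvPolynomial.finSuccEquiv R n p).natDegree,
    fun x => (MvPolynomial.finSuccEquiv R n p).map (MvPolynomial.eval x),
    ⟨fun i => ?_, fun x => natDegree_map_le⟩, fun y => ?_⟩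
  · simp only [coeff_map]
    exact IsPolyFun.eval _
  · conv_lhs => rw [← Fin.cons_self_tail y]
    exact MvPolynomial.eval_eq_eval_mv_eval' _ _ _

/-- Reduction modulo a family of polynomials, without changing the signs at its roots. -/
theorem exists_reduce [LinearOrder R] [IsStrictOrderedRing R] {f g : (Fin n → R) → R[X]}
    (hf : IsPolyFamily e f) (hg : IsPolyFamily (d + 1) g) :
    ∃ f', IsPolyFamily d f' ∧ ∀ x, (g x).coeff (d + 1) ≠ 0 → ∀ t, (g x).eval t = 0 →
      SignType.sign ((f' x).eval t) = SignType.sign ((f x).eval t) := by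
  induction e generalizing f with
  | zero => exact ⟨f, hf.mono (Nat.zero_le _), fun _ _ _ _ => rfl⟩
  | succ e ih =>
    by_cases hed : e + 1 ≤ d
    · exact ⟨f, hf.mono hed, fun _ _ _ _ => rfl⟩
    -- One step of pseudo-division, cancelling the coefficient of degree `e + 1`. Scaling `f` by the
    -- square of the leading coefficient of `g` keeps the signs at the roots of `g`.
    obtain ⟨f', hf', h⟩ := ih (f := fun x => C ((g x).coeff (d + 1) ^ 2) * f x
      - C ((g x).coeff (d + 1) * (f x).coeff (e + 1)) * (g x * X ^ (e - d))) (by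
      constructor
      · intro i
        simp only [coeff_sub, coeff_C_mul, coeff_mul_X_pow']
        refine (((hg.coeff _).pow 2).mul (hf.coeff i)).sub
          (((hg.coeff _).mul (hf.coeff _)).mul ?_)
        split_ifs
        · exact hg.coeff _
        · exact IsPolyFun.const 0
      · intro x
        refine natDegree_le_of_coeff ?_ ?_
        · refine (natDegree_sub_le _ _).trans (max_le ?_ ?_)
          · exact (natDegree_C_mul_le _ _).trans (hf.natDegree_le x)
          · refine (natDegree_C_mul_le _ _).trans (natDegree_mul_le.trans ?_)
            rw [natDegree_X_pow]
            have := hg.natDegree_le x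
            omega
        · simp only [coeff_sub, coeff_C_mul, coeff_mul_X_pow']
          rw [if_pos (by omega), show e + 1 - (e - d) = d + 1 by omega]
          ring)
    refine ⟨f', hf', fun x hx t ht => ?_⟩
    rw [h x hx t ht, eval_sub, eval_mul, eval_mul, eval_mul, ht, zero_mul, mul_zero, sub_zero,
      eval_C, sign_mul, sign_pos (by positivity), one_mul]

end IsPolyFamily

end PolynomialFamilies

end RealAlg

namespace RealAlg

open Polynomial

/-! ### Solvability of sign conditions, tested at roots and sample points. -/

section IntervalDecomposition

variable {R : Type*} [Field R] [LinearOrder R]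

/-- Membership in the open interval with endpoints `a` and `b`, where the first (second) endpoint
counts only if `i` (`l`) is true. -/
def InInterval {R : Type*} [LinearOrder R] (i l : Bool) (a b t : R) : Prop :=
  (i = true → a < t) ∧ (l = true → t < b)

/-- A point of the interval of `InInterval i l a b`. -/
def samplePoint : Bool → Bool → R → R → R
  | true, true, a, b => (a + b) / 2
  | true, false, a, _ => a + 1
  | false, true, _, b => b - 1
  | false, false, _, _ => 0

/-- `a` is a root of the selected polynomial, if there is one. -/
def IsEndpoint {κ : Type*} (q : κ → R[X]) (i : Option κ) (a : R) : Prop :=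
  match i with
  | none => a = 0
  | some j => q j ≠ 0 ∧ (q j).eval a = 0

variable [IsStrictOrderedRing R]

theorem InInterval.samplePoint {i l : Bool} {a b t : R} (h : InInterval i l a b t) :
    InInterval i l a b (samplePoint i l a b) := by
  obtain ⟨h1, h2⟩ := h
  cases i <;> cases l <;> simp only [InInterval, RealAlg.samplePoint, forall_const, true_and,
    and_true, IsEmpty.forall_iff, Bool.false_eq_true] at h1 h2 ⊢
  · linarith
  · linarith
  · constructor <;> linarith

theorem InInterval.of_mem_Icc {R : Type*} [LinearOrder R] {i l : Bool} {a b s t u : R} (hs : InInterval i l a b s)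
    (ht : InInterval i l a b t) (hu : u ∈ Set.Icc s t) : InInterval i l a b u :=
  ⟨fun hi => (hs.1 hi).trans_le hu.1, fun hl => hu.2.trans_lt (ht.2 hl)⟩

theorem InInterval.eval_pos [IsRealClosed R] {i l : Bool} {a b s t : R} {q : R[X]}
    (hs : InInterval i l a b s) (ht : InInterval i l a b t)
    (h : ∀ u, InInterval i l a b u → q.eval u ≠ 0) (hpos : 0 < q.eval s) : 0 < q.eval t := by
  rcases le_total s t with hst | hst
  · exact pos_of_mul_pos_right
      (eval_mul_eval_pos q hst fun u hu => h u (hs.of_mem_Icc ht hu)) hpos.le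
  · exact pos_of_mul_pos_left
      (eval_mul_eval_pos q hst fun u hu => h u (ht.of_mem_Icc hs hu)) hpos.le

variable [IsRealClosed R] {κ : Type*} [Fintype κ]

/-- The interval is the component of `t` in the complement of all roots: its endpoints are the
nearest roots on either side, `none` standing for an infinite end. No `q j` changes sign on it. -/
theorem exists_interval_of_forall_pos {q : κ → R[X]} {t : R} (ht : ∀ j, 0 < (q j).eval t) :
    ∃ (i l : Option κ) (a b : R), IsEndpoint q i a ∧ IsEndpoint q l b ∧
      InInterval i.isSome l.isSome a b t ∧
      ∀ j s, InInterval i.isSome l.isSome a b s → 0 < (q j).eval s := by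
  classical
  have hq : ∀ j, q j ≠ 0 := fun j h0 => by have := ht j; simp [h0] at this
  let F : Finset R := Finset.univ.biUnion fun j => (q j).roots.toFinset
  have hF : ∀ s, s ∈ F ↔ ∃ j, (q j).eval s = 0 := fun s => by simp [F, hq]
  obtain ⟨i, a, hi, hat, ha⟩ : ∃ (i : Option κ) (a : R), IsEndpoint q i a ∧
      (i.isSome = true → a < t) ∧ ∀ s ∈ F, (i.isSome = true → a < s) → t ≤ s := by
    by_cases h : (F.filter (· < t)).Nonempty
    · obtain ⟨h1, h2⟩ := Finset.mem_filter.1 (Finset.max'_mem _ h)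
      obtain ⟨j, hj⟩ := (hF _).1 h1
      refine ⟨some j, _, ⟨hq j, hj⟩, fun _ => h2, fun s hs hlt => ?_⟩
      by_contra! hst
      exact (Finset.le_max' _ s (Finset.mem_filter.2 ⟨hs, hst⟩)).not_gt (hlt rfl)
    -- The value 0 is the dummy that `IsEndpoint` prescribes for an absent endpoint.
    · refine ⟨none, 0, rfl, by simp, fun s hs _ => ?_⟩
      by_contra! hst
      exact h ⟨s, Finset.mem_filter.2 ⟨hs, hst⟩⟩
  obtain ⟨l, b, hl, hbt, hb⟩ : ∃ (l : Option κ) (b : R), IsEndpoint q l b ∧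
      (l.isSome = true → t < b) ∧ ∀ s ∈ F, (l.isSome = true → s < b) → s ≤ t := by
    by_cases h : (F.filter (t < ·)).Nonempty
    · obtain ⟨h1, h2⟩ := Finset.mem_filter.1 (Finset.min'_mem _ h)
      obtain ⟨j, hj⟩ := (hF _).1 h1
      refine ⟨some j, _, ⟨hq j, hj⟩, fun _ => h2, fun s hs hlt => ?_⟩
      by_contra! hst
      exact (Finset.min'_le _ s (Finset.mem_filter.2 ⟨hs, hst⟩)).not_gt (hlt rfl)
    · refine ⟨none, 0, rfl, by simp, fun s hs _ => ?_⟩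
      by_contra! hst
      exact h ⟨s, Finset.mem_filter.2 ⟨hs, hst⟩⟩
  have htI : InInterval i.isSome l.isSome a b t := ⟨hat, hbt⟩
  refine ⟨i, l, a, b, hi, hl, htI, fun j s hs => htI.eval_pos hs (fun u hu h0 => ?_) (ht j)⟩
  have huF : u ∈ F := (hF u).2 ⟨j, h0⟩
  have : u = t := le_antisymm (hb u huF hu.2) (ha u huF hu.1)
  exact (ht j).ne' (this ▸ h0)

/-- A solution can be moved to the sample point of its interval, so the quantifier over the line
becomes quantifiers over roots of the `q j`. -/
theorem exists_pos_iff (q : κ → R[X]) :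
    (∃ t, ∀ j, 0 < (q j).eval t) ↔ ∃ (i l : Option κ) (a : R), IsEndpoint q i a ∧
      ∃ b, IsEndpoint q l b ∧ ∀ j, 0 < (q j).eval (samplePoint i.isSome l.isSome a b) := by
  constructor
  · rintro ⟨t, ht⟩
    obtain ⟨i, l, a, b, hi, hl, htI, h⟩ := exists_interval_of_forall_pos ht
    exact ⟨i, l, a, hi, b, hl, fun j => h j _ htI.samplePoint⟩
  · rintro ⟨i, l, a, -, b, -, h⟩
    exact ⟨_, h⟩

/-- As `p'` is among the positive polynomials, `p` increases strictly on the interval; it has a root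
there exactly when it is negative at the left end and positive at the right end, infinite ends
imposing nothing. The right-hand side quantifies only over roots of the `q j`, which will have
smaller degree than `p`. -/
theorem exists_root_and_pos_iff (p : R[X]) (q : κ → R[X]) (j₀ : κ) (h₀ : q j₀ = derivative p) :
    (∃ t, p.eval t = 0 ∧ ∀ j, 0 < (q j).eval t) ↔
      ∃ (i l : Option κ) (a : R), IsEndpoint q i a ∧ ∃ b, IsEndpoint q l b ∧
        InInterval i.isSome l.isSome a b (samplePoint i.isSome l.isSome a b) ∧
        (∀ j, 0 < (q j).eval (samplePoint i.isSome l.isSome a b) ∧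
          ¬(q j ≠ 0 ∧ ∃ s, (q j).eval s = 0 ∧ InInterval i.isSome l.isSome a b s)) ∧
        (i.isSome = true → p.eval a < 0) ∧ (l.isSome = true → 0 < p.eval b) := by
  constructor
  · rintro ⟨t, hpt, ht⟩
    obtain ⟨i, l, a, b, hi, hl, htI, h⟩ := exists_interval_of_forall_pos ht
    refine ⟨i, l, a, hi, b, hl, htI.samplePoint, fun j => ⟨h j _ htI.samplePoint, ?_⟩,
      fun his => ?_, fun hls => ?_⟩
    · rintro ⟨-, s, hs0, hs⟩
      exact (h j s hs).ne' hs0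
    · rw [← hpt]
      exact eval_lt_eval_of_derivative_pos (htI.1 his) fun s hs =>
        h₀ ▸ h j₀ s ⟨fun _ => hs.1, fun hls => hs.2.trans (htI.2 hls)⟩
    · rw [← hpt]
      exact eval_lt_eval_of_derivative_pos (htI.2 hls) fun s hs =>
        h₀ ▸ h j₀ s ⟨fun his => (htI.1 his).trans hs.1, fun _ => hs.2⟩
  · rintro ⟨i, l, a, hi, b, hl, hI, h, hpa, hpb⟩
    have hpos : ∀ j s, InInterval i.isSome l.isSome a b s → 0 < (q j).eval s := fun j s hs =>
      hI.eval_pos hs (fun u hu h0 => (h j).2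
        ⟨fun hq => by have := (h j).1; simp [hq] at this, u, h0, hu⟩) (h j).1
    have hder : ∀ s, InInterval i.isSome l.isSome a b s → 0 < (derivative p).eval s :=
      fun s hs => h₀ ▸ hpos j₀ s hs
    -- A point where `p` is negative: the left endpoint, or a point far to the left when there is
    -- none. It need not lie in the interval, but everything to its right satisfies the left bound.
    have hlow : ∃ u, p.eval u < 0 ∧ (l.isSome = true → u < b) ∧
        ∀ s, u < s → (i.isSome = true → a < s) := by
      cases his : i.isSome with
      | true =>
        exact ⟨a, hpa his, fun hls => (hI.1 his).trans (hI.2 hls), fun s hs _ => hs⟩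
      | false =>
        rw [his] at hder
        cases hls : l.isSome with
        | true =>
          rw [hls] at hder
          obtain ⟨u, hu, hu0⟩ := exists_lt_eval_neg_of_derivative_pos (p := p) (b := b)
            fun s hs => hder s ⟨by simp, fun _ => hs⟩
          exact ⟨u, hu0, fun _ => hu, by simp⟩
        | false =>
          rw [hls] at hder
          obtain ⟨u, hu, hu0⟩ := exists_lt_eval_neg_of_derivative_pos (p := p) (b := 0)
            fun s _ => hder s ⟨by simp, by simp⟩
          exact ⟨u, hu0, by simp, by simp⟩
    obtain ⟨u, hu0, hub, hu⟩ := hlow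
    have hhigh : ∃ v, u < v ∧ 0 < p.eval v ∧ ∀ s, s < v → (l.isSome = true → s < b) := by
      cases hls : l.isSome with
      | true => exact ⟨b, hub hls, hpb hls, fun s hs _ => hs⟩
      | false =>
        rw [hls] at hder
        obtain ⟨v, hv, hv0⟩ := exists_gt_eval_pos_of_derivative_pos (p := p) (a := u)
          fun s hs => hder s ⟨hu s hs, by simp⟩
        exact ⟨v, hv, hv0, by simp⟩
    obtain ⟨v, huv, hv0, hv⟩ := hhigh
    obtain ⟨t, ht, ht0⟩ := exists_root_of_eval_mul_neg p huv.le (mul_neg_of_neg_of_pos hu0 hv0)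
    exact ⟨t, ht0, fun j => hpos j t ⟨hu t ht.1, hv t ht.2⟩⟩

end IntervalDecomposition

end RealAlg

namespace RealAlg

open Polynomial

/-! ### Elimination of quantifiers. -/

section QuantifierElimination

variable {R : Type*} [Field R] [LinearOrder R] [IsStrictOrderedRing R] {n d e : ℕ}

omit [IsStrictOrderedRing R] in
theorem IsPolyFamily.isSemialgebraic_eq_zero {g : (Fin n → R) → R[X]} (hg : IsPolyFamily d g) :
    IsSemialgebraic {x | g x = 0} := by
  have : {x | g x = 0} = {x | ∀ i : Fin (d + 1), (g x).coeff i = 0} := by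
    ext x
    refine ⟨fun h i => by rw [show g x = 0 from h, coeff_zero], fun h => ?_⟩
    refine Polynomial.ext fun i => ?_
    rw [coeff_zero]
    rcases lt_or_ge i (d + 1) with hi | hi
    · exact h ⟨i, hi⟩
    · exact coeff_eq_zero_of_natDegree_lt ((hg.natDegree_le x).trans_lt hi)
  rw [this]
  exact IsSemialgebraic.finite_forall fun i => IsSemialgebraic.setOf_eq_zero (hg.coeff i)

theorem isSemialgebraic_inInterval {i l : Bool} {a b t : (Fin n → R) → R} (ha : IsPolyFun a)
    (hb : IsPolyFun b) (ht : IsPolyFun t) :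
    IsSemialgebraic {x | InInterval i l (a x) (b x) (t x)} :=
  ((IsSemialgebraic.setOf_const _).imp (IsSemialgebraic.setOf_lt ha ht)).and
    ((IsSemialgebraic.setOf_const _).imp (IsSemialgebraic.setOf_lt ht hb))

omit [LinearOrder R] [IsStrictOrderedRing R] in
theorem isPolyFun_samplePoint {i l : Bool} {a b : (Fin n → R) → R} (ha : IsPolyFun a)
    (hb : IsPolyFun b) : IsPolyFun fun x => samplePoint i l (a x) (b x) := by
  cases i <;> cases l
  · exact IsPolyFun.const 0
  · exact hb.sub (IsPolyFun.const 1)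
  · exact ha.add (IsPolyFun.const 1)
  · simp only [samplePoint, div_eq_mul_inv]
    exact (ha.add hb).mul (IsPolyFun.const _)

/-- Every semi-algebraic subset of `Rⁿ⁺¹` is a finite union of sets defined by finitely many
equations and strict inequalities between families of univariate polynomials. -/
theorem IsSemialgebraic.induction_basic {motive : Set (Fin (n + 1) → R) → Prop}
    (iUnion : ∀ {A : Type} [Finite A] (S : A → Set (Fin (n + 1) → R)), (∀ a, motive (S a)) →
      motive {y | ∃ a, y ∈ S a})
    (basic : ∀ {ι κ : Type} [Fintype ι] [Fintype κ] {e : ℕ} (f : ι → (Fin n → R) → R[X])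
      (q : κ → (Fin n → R) → R[X]), (∀ i, IsPolyFamily e (f i)) → (∀ j, IsPolyFamily e (q j)) →
      motive {y | (∀ i, (f i (Fin.tail y)).eval (y 0) = 0) ∧
        ∀ j, 0 < (q j (Fin.tail y)).eval (y 0)})
    {S : Set (Fin (n + 1) → R)} (hS : IsSemialgebraic S) : motive S := by
  classical
  obtain ⟨ι, _, p, T, hT⟩ := hS.exists_sign
  choose d g hg hgp using fun i => IsPolyFamily.exists_of_mvPolynomial (p i)
  have hle : ∀ i, d i ≤ ∑ i, d i := fun i => Finset.single_le_sum (fun _ _ => Nat.zero_le _)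
    (Finset.mem_univ i)
  -- One basic set for each admissible sign vector `σ`; a nonzero sign is imposed by requiring `σ i
  -- * g i` to be positive.
  have : S = {y | ∃ σ : T, y ∈ {y | (∀ i : {i // σ.1 i = 0}, (g i (Fin.tail y)).eval (y 0) = 0) ∧
        ∀ i : {i // σ.1 i ≠ 0}, 0 < (C ((σ.1 i : SignType) : R) * g i (Fin.tail y)).eval (y 0)}} := by
    ext y
    rw [hT]
    simp only [hgp, eval_mul, eval_C, Set.mem_ofPred_eq, Subtype.forall, Subtype.exists]
    have key : ∀ (σ : SignType) (x : R), SignType.sign x = σ ↔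
        (σ = 0 → x = 0) ∧ (σ ≠ 0 → 0 < (σ : R) * x) := by
      intro σ x
      rcases σ with _ | _ | _ <;> simp [sign_eq_one_iff, sign_eq_neg_one_iff]
    constructor
    · intro h
      exact ⟨_, h, fun i hi => ((key _ _).1 rfl).1 hi, fun i hi => ((key _ _).1 rfl).2 hi⟩
    · rintro ⟨σ, hσ, h1, h2⟩
      have : (fun i => SignType.sign ((g i (Fin.tail y)).eval (y 0))) = σ :=
        funext fun i => (key _ _).2 ⟨h1 i, h2 i⟩
      rwa [this]
  rw [this]
  exact iUnion _ fun σ => basic (e := ∑ i, d i)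
    (fun (i : {i // σ.1 i = 0}) => g i)
    (fun (i : {i // σ.1 i ≠ 0}) x => C ((σ.1 i : SignType) : R) * g i x)
    (fun i => (hg i).mono (hle i))
    (fun i => ((hg i).mono (hle i)).C_mul _)

/-- Elimination of a variable that is a root of a polynomial of degree at most `d`. -/
def EliminatesRoots (R : Type*) [Field R] [LinearOrder R] (d : ℕ) : Prop :=
  ∀ (n : ℕ) (g : (Fin n → R) → R[X]) (S : Set (Fin (n + 1) → R)), IsPolyFamily d g →
    IsSemialgebraic S →
      IsSemialgebraic {x | g x ≠ 0 ∧ ∃ t, (g x).eval t = 0 ∧ (Fin.cons t x : Fin (n + 1) → R) ∈ S}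

namespace EliminatesRoots

omit [IsStrictOrderedRing R] in
theorem zero : EliminatesRoots R 0 := by
  intro n g S hg _
  convert! IsSemialgebraic.empty (R := R) (n := n)
  ext x
  simp only [Set.mem_ofPred_eq, Set.mem_empty_iff_false, iff_false, not_and, not_exists]
  intro h t h0
  obtain ⟨c, hc⟩ := natDegree_eq_zero.1 (Nat.le_zero.1 (hg.natDegree_le x))
  rw [← hc, eval_C] at h0
  rw [← hc, h0, C_0] at h
  exact absurd rfl h

omit [IsStrictOrderedRing R] in
theorem exists_endpoint (hd : EliminatesRoots R d) {κ : Type} {q : κ → (Fin n → R) → R[X]}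
    (hq : ∀ j, IsPolyFamily d (q j)) {S : Set (Fin (n + 1) → R)} (hS : IsSemialgebraic S)
    (i : Option κ) :
    IsSemialgebraic {x | ∃ a, IsEndpoint (fun j => q j x) i a ∧
      (Fin.cons a x : Fin (n + 1) → R) ∈ S} := by
  cases i with
  | none =>
    simp only [IsEndpoint, exists_eq_left]
    refine hS.preimage fun i => ?_
    refine Fin.cases ?_ (fun i => ?_) i
    · exact IsPolyFun.const 0
    · exact IsPolyFun.coord i
  | some j =>
    simp only [IsEndpoint, and_assoc, exists_and_left]
    exact hd n _ S (hq j) hS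

-- Two eliminations in a row. The variable `b` is adjoined after `a`, so `b` is coordinate 0 and `a`
-- is coordinate 1.
omit [IsStrictOrderedRing R] in
theorem exists_endpoints (hd : EliminatesRoots R d) {κ : Type} {q : κ → (Fin n → R) → R[X]}
    (hq : ∀ j, IsPolyFamily d (q j)) {p : R → R → (Fin n → R) → Prop}
    (hp : IsSemialgebraic {y : Fin (n + 2) → R | p (y 1) (y 0) (Fin.tail (Fin.tail y))})
    (i l : Option κ) :
    IsSemialgebraic {x | ∃ a, IsEndpoint (fun j => q j x) i a ∧
      ∃ b, IsEndpoint (fun j => q j x) l b ∧ p a b x} := by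
  have h := hd.exists_endpoint hq (hd.exists_endpoint (fun j => (hq j).tail) hp l) i
  simpa using! h

/-- The criterion `exists_root_and_pos_iff` mentions only roots of polynomials of degree at most
`d`, which `hd` eliminates. -/
theorem exists_simple_root [IsRealClosed R] (hd : EliminatesRoots R d) {g : (Fin n → R) → R[X]}
    (hg : IsPolyFamily (d + 1) g) {κ : Type} [Fintype κ] {q : κ → (Fin n → R) → R[X]}
    (hq : ∀ j, IsPolyFamily d (q j)) (j₀ : κ) (h₀ : ∀ x, q j₀ x = derivative (g x)) :
    IsSemialgebraic {x | ∃ t, (g x).eval t = 0 ∧ ∀ j, 0 < (q j x).eval t} := by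
  simp only [fun x => exists_root_and_pos_iff (g x) (fun j => q j x) j₀ (h₀ x)]
  refine IsSemialgebraic.finite_exists fun i => IsSemialgebraic.finite_exists fun l =>
    hd.exists_endpoints hq ?_ i l
  have htail : ∀ {k : ℕ} (i : Fin n), IsPolyFun fun y : Fin (n + 2) → R =>
      Fin.tail (Fin.tail y) i := fun i => IsPolyFun.coord i.succ.succ
  have h0 : IsPolyFun fun y : Fin (n + 2) → R => y 0 := IsPolyFun.coord 0
  have h1 : IsPolyFun fun y : Fin (n + 2) → R => y 1 := IsPolyFun.coord 1
  have hs := isPolyFun_samplePoint (i := i.isSome) (l := l.isSome) h1 h0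
  refine (isSemialgebraic_inInterval h1 h0 hs).and (IsSemialgebraic.and ?_ (IsSemialgebraic.and ?_ ?_))
  · refine IsSemialgebraic.finite_forall fun j => IsSemialgebraic.and ?_ (IsSemialgebraic.not ?_)
    · exact IsSemialgebraic.setOf_pos ((hq j).tail.tail.eval hs)
    -- Here `a` and `b` are parameters too, and the eliminated root is a new coordinate 0, which
    -- shifts `b` to 1 and `a` to 2.
    · have := hd (n + 2) _ {y | InInterval i.isSome l.isSome (y 2) (y 1) (y 0)} (hq j).tail.tail
        (isSemialgebraic_inInterval (IsPolyFun.coord 2) (IsPolyFun.coord 1) (IsPolyFun.coord 0))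
      simpa using! this
  · exact (IsSemialgebraic.setOf_const _).imp
      (IsSemialgebraic.setOf_lt (hg.tail.tail.eval h1) (IsPolyFun.const 0))
  · exact (IsSemialgebraic.setOf_const _).imp
      (IsSemialgebraic.setOf_pos (hg.tail.tail.eval h0))

/-- Where the leading coefficient of `g` is nonzero, all other polynomials may be reduced modulo `g`
to degree at most `d`. Then `t` is a root of a nonzero reduced equation, or of `g'`, both covered by
`hd`; or all reduced equations vanish identically and `t` is a simple root, where `g` or `-g` is
increasing. -/
theorem exists_root_basic [IsRealClosed R] (hd : EliminatesRoots R d) {g : (Fin n → R) → R[X]}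
    (hg : IsPolyFamily (d + 1) g) {ι κ : Type} [Fintype ι] [Fintype κ]
    {f : ι → (Fin n → R) → R[X]} {q : κ → (Fin n → R) → R[X]} (hf : ∀ i, IsPolyFamily e (f i))
    (hq : ∀ j, IsPolyFamily e (q j)) :
    IsSemialgebraic {x | (g x).coeff (d + 1) ≠ 0 ∧ ∃ t, (g x).eval t = 0 ∧
      (∀ i, (f i x).eval t = 0) ∧ ∀ j, 0 < (q j x).eval t} := by
  choose f' hf' hff' using fun i => (hf i).exists_reduce hg
  choose q' hq' hqq' using fun j => (hq j).exists_reduce hg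
  let T : Set (Fin (n + 1) → R) := {y | (g (Fin.tail y)).eval (y 0) = 0 ∧
    (∀ i, (f i (Fin.tail y)).eval (y 0) = 0) ∧ ∀ j, 0 < (q j (Fin.tail y)).eval (y 0)}
  have h0 : IsPolyFun fun y : Fin (n + 1) → R => y 0 := IsPolyFun.coord 0
  have hT : IsSemialgebraic T :=
    (IsSemialgebraic.setOf_eq_zero (hg.tail.eval h0)).and
      ((IsSemialgebraic.finite_forall fun i =>
        IsSemialgebraic.setOf_eq_zero ((hf i).tail.eval h0)).and
      (IsSemialgebraic.finite_forall fun j => IsSemialgebraic.setOf_pos ((hq j).tail.eval h0)))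
  have hsimple : ∀ (g₁ : (Fin n → R) → R[X]), IsPolyFamily (d + 1) g₁ →
      IsSemialgebraic {x | ∃ t, (g₁ x).eval t = 0 ∧ ∀ j : Option κ,
        0 < ((j.elim (fun x => derivative (g₁ x)) q' : (Fin n → R) → R[X]) x).eval t} := by
    intro g₁ hg₁
    refine hd.exists_simple_root hg₁ (fun j => ?_) none fun x => rfl
    cases j with
    | none => exact hg₁.derivative
    | some j => exact hq' j
  have hmain : IsSemialgebraic {x | (g x).coeff (d + 1) ≠ 0 ∧
      ((∃ i, f' i x ≠ 0 ∧ ∃ t, (f' i x).eval t = 0 ∧ (Fin.cons t x : Fin (n + 1) → R) ∈ T) ∨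
      (derivative (g x) ≠ 0 ∧ ∃ t, (derivative (g x)).eval t = 0 ∧
        (Fin.cons t x : Fin (n + 1) → R) ∈ T) ∨
      ((∀ i, f' i x = 0) ∧ ((∃ t, (g x).eval t = 0 ∧ ∀ j : Option κ,
        0 < ((j.elim (fun x => derivative (g x)) q' : (Fin n → R) → R[X]) x).eval t) ∨
        (∃ t, (-g x).eval t = 0 ∧ ∀ j : Option κ,
        0 < ((j.elim (fun x => derivative (-g x)) q' : (Fin n → R) → R[X]) x).eval t))))} :=
    (IsSemialgebraic.setOf_eq_zero (hg.coeff _)).not.and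
      ((IsSemialgebraic.finite_exists fun i => hd n _ T (hf' i) hT).or
        ((hd n _ T hg.derivative hT).or
          ((IsSemialgebraic.finite_forall fun i => (hf' i).isSemialgebraic_eq_zero).and
            ((hsimple g hg).or (hsimple _ hg.neg)))))
  convert hmain using 1
  ext x
  refine and_congr_right fun hx => ?_
  have hTx : ∀ t, (Fin.cons t x : Fin (n + 1) → R) ∈ T ↔ (g x).eval t = 0 ∧
      (∀ i, (f i x).eval t = 0) ∧ ∀ j, 0 < (q j x).eval t := fun t => by
    simp [T]
  simp only [hTx]
  have hsq : ∀ t, (g x).eval t = 0 → ∀ j, 0 < (q' j x).eval t ↔ 0 < (q j x).eval t :=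
    fun t ht j => by rw [← sign_eq_one_iff, hqq' j x hx t ht, sign_eq_one_iff]
  have hsf : ∀ t, (g x).eval t = 0 → ∀ i, (f' i x).eval t = 0 ↔ (f i x).eval t = 0 :=
    fun t ht i => by rw [← sign_eq_zero_iff, hff' i x hx t ht, sign_eq_zero_iff]
  constructor
  · rintro ⟨t, ht, hft, hqt⟩
    by_cases h1 : ∃ i, f' i x ≠ 0
    · obtain ⟨i, hi⟩ := h1
      exact Or.inl ⟨i, hi, t, (hsf t ht i).2 (hft i), ht, hft, hqt⟩
    push Not at h1
    refine Or.inr ?_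
    rcases lt_trichotomy ((derivative (g x)).eval t) 0 with h2 | h2 | h2
    · refine Or.inr ⟨h1, Or.inr ⟨t, by rw [eval_neg, ht, neg_zero], fun j => ?_⟩⟩
      cases j with
      | none => simpa using h2
      | some j => exact (hsq t ht j).2 (hqt j)
    · refine Or.inl ⟨fun h3 => hx ?_, t, h2, ht, hft, hqt⟩
      have := congrArg (fun p => p.coeff d) h3
      simp only [coeff_derivative, coeff_zero, mul_eq_zero] at this
      exact this.resolve_right (by positivity)
    · refine Or.inr ⟨h1, Or.inl ⟨t, ht, fun j => ?_⟩⟩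
      cases j with
      | none => exact h2
      | some j => exact (hsq t ht j).2 (hqt j)
  · rintro (⟨i, -, t, -, h⟩ | ⟨-, t, -, h⟩ | ⟨h1, ⟨t, ht, h⟩ | ⟨t, ht, h⟩⟩)
    · exact ⟨t, h⟩
    · exact ⟨t, h⟩
    · exact ⟨t, ht, fun i => (hsf t ht i).1 (by rw [h1, eval_zero]),
        fun j => (hsq t ht j).1 (h (some j))⟩
    · rw [eval_neg, neg_eq_zero] at ht
      exact ⟨t, ht, fun i => (hsf t ht i).1 (by rw [h1, eval_zero]),
        fun j => (hsq t ht j).1 (h (some j))⟩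

/-- The set is split according to whether the coefficient of degree `d + 1` vanishes; if it does,
`g` may be truncated. -/
theorem succ [IsRealClosed R] (hd : EliminatesRoots R d) : EliminatesRoots R (d + 1) := by
  intro n g S hg hS
  have h1 : IsSemialgebraic {x | (g x).coeff (d + 1) ≠ 0 ∧ ∃ t, (g x).eval t = 0 ∧
      (Fin.cons t x : Fin (n + 1) → R) ∈ S} := by
    refine IsSemialgebraic.induction_basic (motive := fun S => IsSemialgebraic
      {x | (g x).coeff (d + 1) ≠ 0 ∧ ∃ t, (g x).eval t = 0 ∧
        (Fin.cons t x : Fin (n + 1) → R) ∈ S}) ?_ ?_ hS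
    · intro A _ S hS
      convert IsSemialgebraic.finite_exists hS using 1
      ext x
      simp only [Set.mem_ofPred_eq]
      grind
    · intro ι κ _ _ e f q hf hq
      simpa using! hd.exists_root_basic hg hf hq
  have h2 := hd n _ S hg.truncate hS
  convert h1.or ((IsSemialgebraic.setOf_eq_zero (hg.coeff (d + 1))).and h2) using 1
  ext x
  simp only [Set.mem_ofPred_eq]
  by_cases h : (g x).coeff (d + 1) = 0
  · simp [h]
  · simp only [h, not_false_eq_true, true_and, ne_eq, false_and, or_false, and_iff_right_iff_imp]
    intro _ h0
    rw [h0, coeff_zero] at h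
    exact h rfl

theorem all [IsRealClosed R] (d : ℕ) : EliminatesRoots R d := by
  induction d with
  | zero => exact zero
  | succ d ih => exact ih.succ

end EliminatesRoots

/-- The Tarski-Seidenberg theorem. -/
theorem IsSemialgebraic.exists_cons [IsRealClosed R] {S : Set (Fin (n + 1) → R)}
    (hS : IsSemialgebraic S) :
    IsSemialgebraic {x | ∃ t, (Fin.cons t x : Fin (n + 1) → R) ∈ S} := by
  refine IsSemialgebraic.induction_basic (motive := fun S => IsSemialgebraic
    {x | ∃ t, (Fin.cons t x : Fin (n + 1) → R) ∈ S}) ?_ ?_ hS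
  · intro A _ S hS
    convert IsSemialgebraic.finite_exists hS using 1
    ext x
    simp only [Set.mem_ofPred_eq]
    grind
  · intro ι κ _ _ e f q hf hq
    have h0 : IsPolyFun fun y : Fin (n + 1) → R => y 0 := IsPolyFun.coord 0
    have hT : IsSemialgebraic {y : Fin (n + 1) → R | (∀ i, (f i (Fin.tail y)).eval (y 0) = 0) ∧
        ∀ j, 0 < (q j (Fin.tail y)).eval (y 0)} :=
      (IsSemialgebraic.finite_forall fun i =>
        IsSemialgebraic.setOf_eq_zero ((hf i).tail.eval h0)).and
      (IsSemialgebraic.finite_forall fun j => IsSemialgebraic.setOf_pos ((hq j).tail.eval h0))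
    have hpos : IsSemialgebraic {x | ∃ t, ∀ j, 0 < (q j x).eval t} := by
      simp only [fun x => exists_pos_iff (fun j => q j x)]
      refine IsSemialgebraic.finite_exists fun i => IsSemialgebraic.finite_exists fun l =>
        (EliminatesRoots.all e).exists_endpoints hq ?_ i l
      exact IsSemialgebraic.finite_forall fun j => IsSemialgebraic.setOf_pos
        ((hq j).tail.tail.eval (isPolyFun_samplePoint (IsPolyFun.coord 1) (IsPolyFun.coord 0)))
    -- Either some equation is not identically zero and `t` is one of its roots, or only the strict
    -- inequalities remain.
    convert (IsSemialgebraic.finite_exists fun i => EliminatesRoots.all e n _ _ (hf i) hT).or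
      ((IsSemialgebraic.finite_forall fun i => (hf i).isSemialgebraic_eq_zero).and hpos) using 1
    ext x
    simp only [Set.mem_ofPred_eq, Fin.tail_cons, Fin.cons_zero]
    constructor
    · rintro ⟨t, hft, hqt⟩
      by_cases h1 : ∃ i, f i x ≠ 0
      · obtain ⟨i, hi⟩ := h1
        exact Or.inl ⟨i, hi, t, hft i, hft, hqt⟩
      · push Not at h1
        exact Or.inr ⟨h1, t, hqt⟩
    · rintro (⟨i, -, t, -, h⟩ | ⟨h1, t, ht⟩)
      · exact ⟨t, h⟩
      · exact ⟨t, fun i => by rw [h1, eval_zero], ht⟩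

end QuantifierElimination

end RealAlg

namespace RealAlg

open Polynomial Topology

/-! ### Suprema of semi-algebraic subsets of the line. -/

section Completeness

variable {R : Type*} [Field R] [LinearOrder R] [IsStrictOrderedRing R] [IsRealClosed R]

/-- A semi-algebraic subset of the line has finitely many switching points. -/
theorem IsSemialgebraic.exists_finset {S : Set (Fin 1 → R)} (hS : IsSemialgebraic S) :
    ∃ F : Finset R, ∀ s t : R, s ≤ t → (∀ u ∈ Set.Icc s t, u ∉ F) →
      ((fun _ => s) ∈ S ↔ (fun _ => t) ∈ S) := by
  classical
  obtain ⟨ι, _, q, T, hT⟩ := hS.exists_sign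
  let p : ι → R[X] := fun i => MvPolynomial.aeval (fun _ => X) (q i)
  have hp : ∀ i s, MvPolynomial.eval (fun _ => s) (q i) = (p i).eval s := fun i s => by
    simp only [p]
    rw [← Polynomial.coe_evalRingHom, MvPolynomial.aeval_def, ← MvPolynomial.coe_eval₂Hom,
      ← RingHom.comp_apply]
    congr 1
    ext <;> simp
  refine ⟨Finset.univ.biUnion fun i => (p i).roots.toFinset, fun s t hst hF => ?_⟩
  rw [hT, hT]
  refine iff_of_eq (congrArg (· ∈ T) (funext fun i => ?_))
  rw [hp, hp]
  by_cases h0 : p i = 0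
  · simp [h0]
  have h1 := eval_mul_eval_pos (p i) hst fun u hu hu0 => hF u hu (Finset.mem_biUnion.2
    ⟨i, Finset.mem_univ i, by simpa [h0] using hu0⟩)
  rcases pos_and_pos_or_neg_and_neg_of_mul_pos h1 with h | h
  · rw [sign_pos h.1, sign_pos h.2]
  · rw [sign_neg h.1, sign_neg h.2]

/-- The supremum is the least switching point that is an upper bound. To find switching points, let
`w` exceed some upper bound and pick `s ∈ S` beyond all switching points that are not upper bounds:
`S` contains `s` but not `w`, so a switching point lies in `[s, w]`, and it is an upper bound. -/
theorem IsSemialgebraic.exists_isLUB {S : Set R} (hS : IsSemialgebraic {y : Fin 1 → R | y 0 ∈ S})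
    (hne : S.Nonempty) (hb : BddAbove S) : ∃ s, IsLUB S s := by
  classical
  obtain ⟨F, hF⟩ := hS.exists_finset
  simp only [Set.mem_ofPred_eq] at hF
  obtain ⟨M, hM⟩ := hb
  have hdir : ∀ G : Finset R, (∀ f ∈ G, f ∉ upperBounds S) → ∃ s ∈ S, ∀ f ∈ G, f < s := by
    intro G hG
    induction G using Finset.induction_on with
    | empty => exact ⟨_, hne.some_mem, by simp⟩
    | insert f G _ ih =>
      obtain ⟨s, hs, hsG⟩ := ih fun f hf => hG f (Finset.mem_insert_of_mem hf)
      have := hG f (Finset.mem_insert_self f G)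
      simp only [mem_upperBounds, not_forall, not_le] at this
      obtain ⟨s', hs', hfs'⟩ := this
      rcases le_total s s' with h | h
      · refine ⟨s', hs', fun f' hf' => ?_⟩
        rcases Finset.mem_insert.1 hf' with rfl | hf'
        · exact hfs'
        · exact (hsG f' hf').trans_le h
      · refine ⟨s, hs, fun f' hf' => ?_⟩
        rcases Finset.mem_insert.1 hf' with rfl | hf'
        · exact hfs'.trans_le h
        · exact hsG f' hf'
  have key : ∀ v ∈ upperBounds S, ∀ w, v < w → ∀ G : Finset R, (∀ f ∈ G, f ∉ upperBounds S) →
      ∃ f ∈ F, f ∉ G ∧ f ≤ w := by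
    intro v hv w hvw G hG
    by_contra! hcon
    obtain ⟨s, hs, hsG⟩ := hdir G hG
    have hsv : s ≤ v := hv hs
    have hw := (hF s w (hsv.trans hvw.le) fun u hu huF => by
      by_cases huG : u ∈ G
      · exact (hsG u huG).not_ge hu.1
      · exact (hcon u huF huG).not_ge hu.2).1 hs
    exact (hv hw).not_gt hvw
  have hU : (F.filter (· ∈ upperBounds S)).Nonempty := by
    obtain ⟨f, hf, hfG, -⟩ := key M hM (M + 1) (by linarith) (F.filter (· ∉ upperBounds S))
      fun f hf => (Finset.mem_filter.1 hf).2
    exact ⟨f, Finset.mem_filter.2 ⟨hf, by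
      by_contra h
      exact hfG (Finset.mem_filter.2 ⟨hf, h⟩)⟩⟩
  have hmem := Finset.mem_filter.1 (Finset.min'_mem _ hU)
  refine ⟨_, hmem.2, fun v hv => ?_⟩
  by_contra! hlt
  obtain ⟨w, hvw, hw⟩ := exists_between hlt
  obtain ⟨f, hf, hfG, hfw⟩ := key v hv w hvw (F.filter (· ∉ upperBounds S))
    fun f hf => (Finset.mem_filter.1 hf).2
  refine (Finset.min'_le _ f (Finset.mem_filter.2 ⟨hf, ?_⟩)).not_gt (hfw.trans_lt hw)
  by_contra h
  exact hfG (Finset.mem_filter.2 ⟨hf, h⟩)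

end Completeness

/-! ### Projections of semi-algebraic sets, and of closed ones along bounded coordinates. -/

section Projections

variable {R : Type*} [Field R] [LinearOrder R] {m n k : ℕ}

/-- Move the coordinate of index `m` to the front. -/
def moveToFront (m k : ℕ) (w : Fin (m + (k + 1)) → R) : Fin (m + 1 + k) → R :=
  Fin.append (Fin.cons (w (Fin.natAdd m 0)) fun i => w (Fin.castAdd (k + 1) i))
    fun j => w (Fin.natAdd m j.succ)

omit [Field R] [LinearOrder R] in
theorem moveToFront_append (z : Fin m → R) (t : R) (x : Fin k → R) :
    moveToFront m k (Fin.append z (Fin.cons t x)) = Fin.append (Fin.cons t z) x := by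
  simp [moveToFront]

omit [Field R] [LinearOrder R] in
theorem exists_moveToFront_eq (i : Fin (m + 1 + k)) :
    ∃ j, ∀ w : Fin (m + (k + 1)) → R, moveToFront m k w i = w j := by
  induction i using Fin.addCases with
  | left i =>
    induction i using Fin.cases with
    | zero => exact ⟨Fin.natAdd m 0, fun w => by simp [moveToFront]⟩
    | succ i => exact ⟨Fin.castAdd (k + 1) i, fun w => by simp [moveToFront]⟩
  | right i => exact ⟨Fin.natAdd m i.succ, fun w => by simp [moveToFront]⟩

omit [Field R] [LinearOrder R] in
theorem exists_append_succ (S : Set (Fin (m + 1 + k) → R)) :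
    {x : Fin k → R | ∃ z : Fin (m + 1) → R, Fin.append z x ∈ S} =
      {x | ∃ t, (Fin.cons t x : Fin (k + 1) → R) ∈
        {y | ∃ z : Fin m → R, Fin.append z y ∈ moveToFront m k ⁻¹' S}} := by
  ext x
  simp only [Set.mem_ofPred_eq, Set.mem_preimage, moveToFront_append]
  constructor
  · rintro ⟨z, hz⟩
    exact ⟨z 0, Fin.tail z, by rwa [Fin.cons_self_tail]⟩
  · rintro ⟨t, z, hz⟩
    exact ⟨_, hz⟩

theorem IsSemialgebraic.moveToFront {S : Set (Fin (m + 1 + k) → R)} (hS : IsSemialgebraic S) :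
    IsSemialgebraic (moveToFront m k ⁻¹' S) :=
  hS.preimage fun i => by
    obtain ⟨j, hj⟩ := exists_moveToFront_eq (R := R) i
    simp only [hj]
    exact IsPolyFun.coord j

variable [IsStrictOrderedRing R] [IsRealClosed R]

theorem IsSemialgebraic.exists_append {S : Set (Fin (m + k) → R)} (hS : IsSemialgebraic S) :
    IsSemialgebraic {x : Fin k → R | ∃ z : Fin m → R, Fin.append z x ∈ S} := by
  induction m generalizing k with
  | zero =>
    have : {x : Fin k → R | ∃ z : Fin 0 → R, Fin.append z x ∈ S} =
        {x | (fun i => x (Fin.cast (Nat.zero_add k) i)) ∈ S} := by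
      ext x
      refine ⟨fun ⟨z, hz⟩ => ?_, fun h => ⟨Fin.elim0, ?_⟩⟩
      · rw [Subsingleton.elim z Fin.elim0, Fin.elim0_append] at hz
        exact hz
      · rw [Fin.elim0_append]
        exact h
    rw [this]
    exact hS.preimage fun i => IsPolyFun.coord _
  | succ m ih =>
    rw [exists_append_succ]
    exact (ih hS.moveToFront).exists_cons

variable [TopologicalSpace R] [OrderTopology R]

omit [IsRealClosed R] in
theorem exists_box_subset {x : Fin n → R} {U : Set (Fin n → R)} (hU : U ∈ 𝓝 x) :
    ∃ ε, 0 < ε ∧ ∀ y, (∀ i, |y i - x i| < ε) → y ∈ U := by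
  rw [nhds_pi, Filter.mem_pi'] at hU
  obtain ⟨I, V, hV, hVU⟩ := hU
  choose ε hε hεV using fun i => (nhds_basis_abs_sub_lt (x i)).mem_iff.1 (hV i)
  have h1 : ∀ᶠ δ in 𝓝[>] (0 : R), ∀ i, δ < ε i :=
    Filter.eventually_all.2 fun i => (eventually_lt_nhds (hε i)).filter_mono nhdsWithin_le_nhds
  obtain ⟨δ, hδ, hδ0⟩ := (h1.and self_mem_nhdsWithin).exists
  exact ⟨δ, hδ0, fun y hy => hVU fun i _ => hεV i ((hy i).trans (hδ i))⟩

omit [IsRealClosed R] in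
theorem box_mem_nhds (x : Fin n → R) {ε : R} (hε : 0 < ε) :
    {y : Fin n → R | ∀ i, |y i - x i| < ε} ∈ 𝓝 x :=
  Filter.eventually_all.2 fun i =>
    (continuous_apply i).continuousAt.eventually (eventually_abs_sub_lt (x i) hε)

/-- The projection along a bounded coordinate of a closed semi-algebraic set is closed. -/
theorem isClosed_exists_cons {K : Set (Fin (n + 1) → R)} (hK : IsSemialgebraic K)
    (hc : IsClosed K) {r : R} (hr : ∀ y ∈ K, |y 0| ≤ r) :
    IsClosed {x | ∃ t, (Fin.cons t x : Fin (n + 1) → R) ∈ K} := by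
  rw [← isOpen_compl_iff, isOpen_iff_mem_nhds]
  intro a ha
  have hloc : ∀ t, ∃ ε, 0 < ε ∧ ∀ y : Fin (n + 1) → R, |y 0 - t| < ε →
      (∀ i : Fin n, |y i.succ - a i| < ε) → y ∉ K := by
    intro t
    obtain ⟨ε, hε, h⟩ := exists_box_subset (x := (Fin.cons t a : Fin (n + 1) → R))
      (hc.isOpen_compl.mem_nhds fun h => ha ⟨t, h⟩)
    exact ⟨ε, hε, fun y h0 hy => h y (Fin.cases h0 hy)⟩
  -- `T` consists of the heights up to which `K` avoids the preimage of some box around `a`. If `T`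
  -- stayed below `r`, a box around the point of height `sup T` over `a` would push `T` past its
  -- supremum; and a height at least `r` leaves no point of `K` over the box.
  let T : Set R := {t | ∃ ε, 0 < ε ∧ ¬∃ y : Fin (n + 1) → R, y 0 ≤ t ∧
    (∀ i : Fin n, |y i.succ - a i| < ε) ∧ y ∈ K}
  have hTS : IsSemialgebraic {y : Fin 1 → R | y 0 ∈ T} := by
    have h1 : IsSemialgebraic {w : Fin (n + 1 + 2) → R |
        w (Fin.castAdd 2 0) ≤ w (Fin.natAdd (n + 1) 1) ∧
        (∀ i : Fin n, |w (Fin.castAdd 2 i.succ) - a i| < w (Fin.natAdd (n + 1) 0)) ∧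
        (fun i => w (Fin.castAdd 2 i)) ∈ K} := by
      refine (IsSemialgebraic.setOf_le (IsPolyFun.coord _) (IsPolyFun.coord _)).and
        ((IsSemialgebraic.finite_forall fun i => ?_).and
          (hK.preimage fun i => IsPolyFun.coord _))
      simp only [abs_lt]
      exact (IsSemialgebraic.setOf_lt (IsPolyFun.coord _).neg
        ((IsPolyFun.coord _).sub (IsPolyFun.const _))).and
        (IsSemialgebraic.setOf_lt ((IsPolyFun.coord _).sub (IsPolyFun.const _))
          (IsPolyFun.coord _))
    have h2 := ((IsSemialgebraic.setOf_pos (IsPolyFun.coord 0)).and h1.exists_append.not).exists_cons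
    simpa [T, Fin.append_left, Fin.append_right] using! h2
  have hTne : T.Nonempty := ⟨-r - 1, 1, one_pos, by
    rintro ⟨y, hy, -, hyK⟩
    have := neg_abs_le (y 0)
    have := hr y hyK
    linarith⟩
  obtain ⟨t, htT, hrt⟩ : ∃ t ∈ T, r ≤ t := by
    by_contra! hcon
    obtain ⟨s, hs⟩ := hTS.exists_isLUB hTne ⟨r, fun t ht => (hcon t ht).le⟩
    obtain ⟨ε, hε, h⟩ := hloc s
    obtain ⟨t, ⟨ε', hε', h'⟩, ht, -⟩ := hs.exists_between (sub_lt_self s hε)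
    have hmem : s + ε / 2 ∈ T := by
      refine ⟨min ε ε', lt_min hε hε', ?_⟩
      rintro ⟨y, hy, hya, hyK⟩
      by_cases hyt : y 0 ≤ t
      · exact h' ⟨y, hyt, fun i => (hya i).trans_le (min_le_right _ _), hyK⟩
      · refine h y (abs_lt.2 ⟨by linarith, by linarith⟩)
          (fun i => (hya i).trans_le (min_le_left _ _)) hyK
    have := hs.1 hmem
    linarith
  obtain ⟨ε, hε, h⟩ := htT
  refine Filter.mem_of_superset (box_mem_nhds a hε) fun x hx hxK => ?_
  obtain ⟨u, hu⟩ := hxK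
  refine h ⟨_, ?_, fun i => ?_, hu⟩
  · exact (le_abs_self _).trans ((hr _ hu).trans hrt)
  · simpa using hx i

theorem isClosed_exists_append {S : Set (Fin (m + k) → R)} (hS : IsSemialgebraic S)
    (hc : IsClosed S) {r : R} (hr : ∀ w ∈ S, ∀ i : Fin m, |w (Fin.castAdd k i)| ≤ r) :
    IsClosed {x : Fin k → R | ∃ z : Fin m → R, Fin.append z x ∈ S} := by
  induction m generalizing k with
  | zero =>
    have : {x : Fin k → R | ∃ z : Fin 0 → R, Fin.append z x ∈ S} =
        {x | (fun i => x (Fin.cast (Nat.zero_add k) i)) ∈ S} := by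
      ext x
      refine ⟨fun ⟨z, hz⟩ => ?_, fun h => ⟨Fin.elim0, ?_⟩⟩
      · rw [Subsingleton.elim z Fin.elim0, Fin.elim0_append] at hz
        exact hz
      · rw [Fin.elim0_append]
        exact h
    rw [this]
    exact hc.preimage (continuous_pi fun i => continuous_apply _)
  | succ m ih =>
    rw [exists_append_succ]
    refine isClosed_exists_cons hS.moveToFront.exists_append
      (ih hS.moveToFront (hc.preimage (continuous_pi fun i => ?_)) fun w hw i => ?_) (r := r) ?_
    · obtain ⟨j, hj⟩ := exists_moveToFront_eq (R := R) i
      simp only [hj]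
      exact continuous_apply j
    · simpa [moveToFront] using hr _ hw i.succ
    · rintro y ⟨z, hz⟩
      simpa [moveToFront] using hr _ hz 0

end Projections

/-! ### The extreme value theorem. -/

section ExtremeValue

variable {R : Type*} [Field R] [LinearOrder R] [IsStrictOrderedRing R] {n : ℕ}

theorem IsPolyFun.exists_abs_le {f : (Fin n → R) → R} (hf : IsPolyFun f) {K : Set (Fin n → R)}
    {r : R} (hr : ∀ x ∈ K, ∀ i, |x i| ≤ r) : ∃ M, ∀ x ∈ K, |f x| ≤ M := by
  obtain ⟨p, hp⟩ := hf
  simp only [hp]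
  clear hp
  induction p using MvPolynomial.induction_on with
  | C a => exact ⟨|a|, fun x _ => by simp⟩
  | add p q hp hq =>
    obtain ⟨M, hM⟩ := hp
    obtain ⟨N, hN⟩ := hq
    exact ⟨M + N, fun x hx => by
      rw [map_add]
      exact (abs_add_le _ _).trans (add_le_add (hM x hx) (hN x hx))⟩
  | mul_X p i hp =>
    obtain ⟨M, hM⟩ := hp
    refine ⟨M * r, fun x hx => ?_⟩
    rw [map_mul, MvPolynomial.eval_X, abs_mul]
    exact mul_le_mul (hM x hx) (hr x hx i) (abs_nonneg _) ((abs_nonneg _).trans (hM x hx))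

theorem IsBoundedSet.exists_abs_le {K : Set (Fin n → R)} (hK : IsBoundedSet K) :
    ∃ r, ∀ x ∈ K, ∀ i, |x i| ≤ r := by
  obtain ⟨r, hr⟩ := hK
  refine ⟨max r 1, fun x hx i => ?_⟩
  have h1 : x i ^ 2 ≤ r :=
    (Finset.single_le_sum (f := fun i => x i ^ 2) (fun _ _ => sq_nonneg _) (Finset.mem_univ i)).trans
      (hr x hx)
  rcases le_total |x i| 1 with h | h
  · exact h.trans (le_max_right _ _)
  · refine le_trans ?_ (h1.trans (le_max_left _ _))
    rw [← sq_abs]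
    nlinarith

variable [TopologicalSpace R] [OrderTopology R]

theorem IsPolyFun.continuous {f : (Fin n → R) → R} (hf : IsPolyFun f) : Continuous f := by
  obtain ⟨p, hp⟩ := hf
  rw [funext hp]
  exact MvPolynomial.continuous_eval p

/-- The extreme value theorem for polynomial functions on closed and bounded semi-algebraic sets. -/
theorem exists_forall_le [IsRealClosed R] {K : Set (Fin n → R)} (hK : IsSemialgebraic K)
    (hc : IsClosed K) (hb : IsBoundedSet K) (hne : K.Nonempty) {f : (Fin n → R) → R}
    (hf : IsPolyFun f) : ∃ x ∈ K, ∀ y ∈ K, f x ≤ f y := by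
  obtain ⟨r, hr⟩ := hb.exists_abs_le
  obtain ⟨M, hM⟩ := hf.exists_abs_le hr
  let S : Set (Fin (n + 1) → R) := {w | (fun i => w (Fin.castAdd 1 i)) ∈ K ∧
    f (fun i => w (Fin.castAdd 1 i)) = -w (Fin.natAdd n 0)}
  have hS : IsSemialgebraic S := (hK.preimage fun i => IsPolyFun.coord _).and
    (IsSemialgebraic.setOf_eq (hf.comp fun i => IsPolyFun.coord _) (IsPolyFun.coord _).neg)
  have hSc : IsClosed S := (hc.preimage (continuous_pi fun i => continuous_apply _)).inter
    (isClosed_eq (hf.continuous.comp (continuous_pi fun i => continuous_apply _))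
      (continuous_apply _).neg)
  have hmem : ∀ (z : Fin n → R) (v : Fin 1 → R), Fin.append z v ∈ S ↔ z ∈ K ∧ f z = -v 0 :=
    fun z v => by
      simp only [S, Set.mem_ofPred_eq, Fin.append_left, Fin.append_right]
  -- The values of `-f`, so that a supremum yields a minimum of `f`. As a projection of a graph over
  -- `K`, `V` is semi-algebraic and closed, and contains its supremum.
  let V : Set R := {c | ∃ z ∈ K, f z = -c}
  have hVS : IsSemialgebraic {y : Fin 1 → R | y 0 ∈ V} := by
    have := hS.exists_append
    simpa only [hmem] using! this
  have hVc : IsClosed V := by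
    have := (isClosed_exists_append hS hSc (r := r) fun w hw i => hr _ hw.1 i).preimage
      (continuous_pi fun _ => continuous_id : Continuous fun c : R => (fun _ => c : Fin 1 → R))
    simpa only [hmem] using! this
  obtain ⟨x₀, hx₀⟩ := hne
  have hVne : V.Nonempty := ⟨-f x₀, x₀, hx₀, (neg_neg _).symm⟩
  obtain ⟨s, hs⟩ := hVS.exists_isLUB hVne ⟨M, by
    rintro c ⟨z, hz, hzc⟩
    have := (abs_le.1 (hM z hz)).1
    linarith⟩
  obtain ⟨x, hx, hxs⟩ := hs.mem_of_isClosed hVne hVc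
  refine ⟨x, hx, fun y hy => ?_⟩
  have := hs.1 (⟨y, hy, (neg_neg _).symm⟩ : -f y ∈ V)
  linarith

end ExtremeValue

end RealAlg

namespace RealAlg

open Topology

/-! ### Taylor expansion. -/

section Taylor

variable {K : Type*} [CommRing K] {n : ℕ}

theorem exists_eq_add_sum (p : MvPolynomial (Fin n) K) (x : Fin n → K) :
    ∃ m : Fin n → MvPolynomial (Fin n) K,
      p = MvPolynomial.C (MvPolynomial.eval x p) +
        ∑ j, (MvPolynomial.X j - MvPolynomial.C (x j)) * m j := by
  classical
  induction p using MvPolynomial.induction_on with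
  | C a => exact ⟨0, by simp⟩
  | add p q hp hq =>
    obtain ⟨a, ha⟩ := hp
    obtain ⟨b, hb⟩ := hq
    refine ⟨a + b, ?_⟩
    simp only [Pi.add_apply, mul_add, Finset.sum_add_distrib, map_add]
    linear_combination ha + hb
  | mul_X p i hp =>
    obtain ⟨a, ha⟩ := hp
    refine ⟨fun j => a j * MvPolynomial.X i +
      Pi.single (M := fun _ => MvPolynomial (Fin n) K) i (MvPolynomial.C (MvPolynomial.eval x p)) j,
      ?_⟩
    have h1 : ∑ j, (MvPolynomial.X j - MvPolynomial.C (x j)) *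
        Pi.single (M := fun _ => MvPolynomial (Fin n) K) i (MvPolynomial.C (MvPolynomial.eval x p)) j
        = (MvPolynomial.X i - MvPolynomial.C (x i)) * MvPolynomial.C (MvPolynomial.eval x p) := by
      rw [Finset.sum_eq_single i (fun j _ hj => by rw [Pi.single_eq_of_ne hj, mul_zero])
        (by simp), Pi.single_eq_same]
    simp only [mul_add, Finset.sum_add_distrib, ← mul_assoc, ← Finset.sum_mul, map_mul,
      MvPolynomial.eval_X]
    rw [h1]
    linear_combination ha * MvPolynomial.X i

/-- First order Taylor expansion of a polynomial. -/
theorem exists_taylor (p : MvPolynomial (Fin n) K) (x : Fin n → K) :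
    ∃ m : Fin n → MvPolynomial (Fin n) K,
      p = MvPolynomial.C (MvPolynomial.eval x p) +
        ∑ j, (MvPolynomial.X j - MvPolynomial.C (x j)) * m j ∧
      ∀ j, MvPolynomial.eval x (m j) = MvPolynomial.eval x (MvPolynomial.pderiv j p) := by
  classical
  obtain ⟨m, hm⟩ := exists_eq_add_sum p x
  refine ⟨m, hm, fun j => ?_⟩
  conv_rhs => rw [hm]
  simp only [map_add, map_sum, MvPolynomial.pderiv_C, MvPolynomial.pderiv_mul, map_sub,
    MvPolynomial.pderiv_X, map_mul, MvPolynomial.eval_X, MvPolynomial.eval_C, sub_self, zero_mul,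
    sub_zero, add_zero, zero_add]
  rw [Finset.sum_eq_single j]
  · simp
  · intro i _ hij
    rw [Pi.single_eq_of_ne hij, map_zero, zero_mul]
  · simp

end Taylor

/-! ### Fermat's theorem and local openness of square systems. -/

section OpenMapping

variable {R : Type*} [Field R] [LinearOrder R] [IsStrictOrderedRing R]
  [TopologicalSpace R] [OrderTopology R] {n : ℕ}

/-- Fermat's theorem for polynomials over an ordered field. -/
theorem eval_pderiv_eq_zero_of_isLocalMin {p : MvPolynomial (Fin n) R} {y : Fin n → R}
    (h : ∀ᶠ z in 𝓝 y, MvPolynomial.eval y p ≤ MvPolynomial.eval z p) (j : Fin n) :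
    MvPolynomial.eval y (MvPolynomial.pderiv j p) = 0 := by
  obtain ⟨m, hm, hmj⟩ := exists_taylor p y
  rw [← hmj]
  -- Along this line `p` equals `p(y) + t c(t)` with `c(0)` the partial derivative; if `c(0) ≠ 0`, a
  -- small `t` of the opposite sign lowers `p`.
  let γ : R → Fin n → R := fun t => Function.update y j (y j + t)
  have hγ : Continuous γ := continuous_const.update j (continuous_const.add continuous_id)
  have hγ0 : γ 0 = y := by simp [γ]
  have hval : ∀ t, MvPolynomial.eval (γ t) p =
      MvPolynomial.eval y p + t * MvPolynomial.eval (γ t) (m j) := by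
    intro t
    conv_lhs => rw [hm]
    simp only [map_add, map_sum, map_mul, map_sub, MvPolynomial.eval_X, MvPolynomial.eval_C]
    rw [Finset.sum_eq_single j]
    · simp [γ]
    · intro i _ hij
      simp [γ, Function.update_of_ne hij]
    · simp
  by_contra hne
  let c : R → R := fun t => MvPolynomial.eval (γ t) (m j)
  have hc : Continuous c := (MvPolynomial.continuous_eval (m j)).comp hγ
  have hc0 : 0 < c 0 * c 0 := by
    simp only [c, hγ0]
    exact mul_self_pos.2 hne
  have h1 : ∀ᶠ t in 𝓝 (0 : R), MvPolynomial.eval y p ≤ MvPolynomial.eval (γ t) p :=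
    (hγ.tendsto' 0 y hγ0).eventually h
  have h2 : ∀ᶠ t in 𝓝 (0 : R), 0 < c t * c 0 :=
    (hc.mul continuous_const).continuousAt.eventually (lt_mem_nhds hc0)
  obtain ⟨ε, hε, hε'⟩ := (nhds_basis_abs_sub_lt (0 : R)).mem_iff.1 (h1.and h2)
  have key : ∀ t, |t| < ε → 0 ≤ t * c t ∧ 0 < c t * c 0 := fun t ht => by
    obtain ⟨h3, h4⟩ := hε' (by simpa using ht : |t - 0| < ε)
    have h5 := hval t
    exact ⟨by simp only [c]; linarith, h4⟩
  have hc00 : c 0 ≠ 0 := fun h0 => by simp [h0] at hc0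
  rcases lt_or_gt_of_ne hc00 with h0 | h0
  · obtain ⟨h3, h4⟩ := key (ε / 2) (by rw [abs_of_pos (by positivity)]; linarith)
    nlinarith [neg_of_mul_pos_left h4 h0.le]
  · obtain ⟨h3, h4⟩ := key (-(ε / 2)) (by rw [abs_neg, abs_of_pos (by positivity)]; linarith)
    nlinarith [pos_of_mul_pos_left h4 h0.le]

theorem exists_ball_subset {x : Fin n → R} {U : Set (Fin n → R)} (hU : U ∈ 𝓝 x) :
    ∃ ρ, 0 < ρ ∧ ∀ y, ∑ i, (y i - x i) ^ 2 ≤ ρ → y ∈ U := by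
  obtain ⟨ε, hε, h⟩ := exists_box_subset hU
  refine ⟨(ε / 2) ^ 2, by positivity, fun y hy => h y fun i => ?_⟩
  have h1 : (y i - x i) ^ 2 ≤ (ε / 2) ^ 2 :=
    (Finset.single_le_sum (f := fun i => (y i - x i) ^ 2) (fun _ _ => sq_nonneg _)
      (Finset.mem_univ i)).trans hy
  have h2 : |y i - x i| ≤ ε / 2 := abs_le_of_sq_le_sq h1 (by positivity)
  linarith

omit [LinearOrder R] [IsStrictOrderedRing R] [TopologicalSpace R] [OrderTopology R] in
theorem isPolyFun_dist_sq (x : Fin n → R) :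
    IsPolyFun fun y : Fin n → R => ∑ i, (y i - x i) ^ 2 :=
  IsPolyFun.sum _ fun i => ((IsPolyFun.coord i).sub (IsPolyFun.const _)).pow 2

omit [TopologicalSpace R] [OrderTopology R] in
theorem isBoundedSet_ball (x : Fin n → R) (ρ : R) :
    IsBoundedSet {y : Fin n → R | ∑ i, (y i - x i) ^ 2 ≤ ρ} := by
  refine ⟨2 * ρ + 2 * ∑ i, x i ^ 2, fun y hy => ?_⟩
  have h1 : ∑ i, y i ^ 2 ≤ ∑ i, (2 * (y i - x i) ^ 2 + 2 * x i ^ 2) :=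
    Finset.sum_le_sum fun i _ => by nlinarith [sq_nonneg (y i - 2 * x i)]
  rw [Finset.sum_add_distrib, ← Finset.mul_sum, ← Finset.mul_sum] at h1
  have h2 : ∑ i, (y i - x i) ^ 2 ≤ ρ := hy
  linarith

/-- A square polynomial system with invertible Jacobian matrix at `x` is open at `x`. -/
theorem exists_eval_eq_of_det_ne_zero [IsRealClosed R] (G : Fin n → MvPolynomial (Fin n) R)
    {x : Fin n → R} (hJ : (jacobianAt G x).det ≠ 0) {U : Set (Fin n → R)} (hU : U ∈ 𝓝 x) :
    ∃ δ, 0 < δ ∧ ∀ w : Fin n → R, ∑ i, (MvPolynomial.eval x (G i) - w i) ^ 2 < δ →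
      ∃ y ∈ U, ∀ i, MvPolynomial.eval y (G i) = w i := by
  choose m hm hmx using fun i => exists_taylor (G i) x
  have hdet : ∀ (A : Fin n → Fin n → MvPolynomial (Fin n) R) (y : Fin n → R),
      MvPolynomial.eval y (Matrix.of A).det =
        (Matrix.of fun i j => MvPolynomial.eval y (A i j)).det := fun A y => by
    rw [RingHom.map_det]; rfl
  have hJc : Continuous fun y => (jacobianAt G y).det := by
    have := MvPolynomial.continuous_eval
      (Matrix.of fun i j => MvPolynomial.pderiv j (G i)).det
    simp only [hdet] at this
    exact this
  have hMc : Continuous fun y => (Matrix.of fun i j => MvPolynomial.eval y (m i j)).det := by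
    have := MvPolynomial.continuous_eval (Matrix.of m).det
    simp only [hdet] at this
    exact this
  have hMx : (Matrix.of fun i j => MvPolynomial.eval x (m i j)).det ≠ 0 := by
    simp only [hmx]
    exact hJ
  -- On this ball the Jacobian is invertible, and so is the Taylor matrix, which makes `G y ≠ G x`
  -- for `y ≠ x`.
  obtain ⟨ρ, hρ, hball⟩ := exists_ball_subset (Filter.inter_mem hU (Filter.inter_mem
    (hJc.continuousAt.eventually_ne hJ) (hMc.continuousAt.eventually_ne hMx)))
  have hdiff : ∀ y i, MvPolynomial.eval y (G i) - MvPolynomial.eval x (G i) =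
      ((Matrix.of fun i j => MvPolynomial.eval y (m i j)).mulVec fun j => y j - x j) i := by
    intro y i
    conv_lhs => enter [1]; rw [hm i]
    simp [Matrix.mulVec, dotProduct, mul_comm]
  have hPF : ∀ w : Fin n → R, IsPolyFun fun y => ∑ i, (MvPolynomial.eval y (G i) - w i) ^ 2 :=
    fun w => IsPolyFun.sum _ fun i => ((IsPolyFun.eval _).sub (IsPolyFun.const _)).pow 2
  have hdc := (isPolyFun_dist_sq x).continuous
  have hsphere : ∃ γ, 0 < γ ∧ ∀ y, ∑ i, (y i - x i) ^ 2 = ρ →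
      γ ≤ ∑ i, (MvPolynomial.eval y (G i) - MvPolynomial.eval x (G i)) ^ 2 := by
    by_cases hne : {y : Fin n → R | ∑ i, (y i - x i) ^ 2 = ρ}.Nonempty
    · obtain ⟨y, hy, hmin⟩ := exists_forall_le
        (IsSemialgebraic.setOf_eq (isPolyFun_dist_sq x) (IsPolyFun.const ρ))
        (isClosed_eq hdc continuous_const)
        (by
          obtain ⟨r, hr⟩ := isBoundedSet_ball x ρ
          exact ⟨r, fun z hz => hr z (le_of_eq hz)⟩)
        hne (hPF fun i => MvPolynomial.eval x (G i))
      refine ⟨_, lt_of_le_of_ne (Finset.sum_nonneg fun i _ => sq_nonneg _) (fun h0 => ?_), hmin⟩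
      have h1 := (Finset.sum_eq_zero_iff_of_nonneg fun i _ => sq_nonneg _).1 h0.symm
      have h2 := Matrix.eq_zero_of_mulVec_eq_zero (hball y (le_of_eq hy)).2.2 (funext fun i => by
        rw [← hdiff, Pi.zero_apply]
        exact pow_eq_zero_iff two_ne_zero |>.1 (h1 i (Finset.mem_univ i)))
      have h3 : ∑ i, (y i - x i) ^ 2 = 0 := Finset.sum_eq_zero fun i _ => by
        have : y i - x i = 0 := congrFun h2 i
        rw [this, zero_pow two_ne_zero]
      rw [Set.mem_ofPred_eq, h3] at hy
      exact hρ.ne hy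
    · exact ⟨1, one_pos, fun y hy => absurd ⟨y, hy⟩ hne⟩
  obtain ⟨γ, hγ, hγ'⟩ := hsphere
  -- A minimiser of `|G - w|²` on the sphere would give `γ ≤ 2|G(y) - w|² + 2|G(x) - w|² ≤ 4|G(x) -
  -- w|² < γ`, so the minimiser is interior.
  refine ⟨γ / 4, by positivity, fun w hw => ?_⟩
  have hxball : x ∈ {y : Fin n → R | ∑ i, (y i - x i) ^ 2 ≤ ρ} := by
    simpa using! hρ.le
  obtain ⟨y, hy, hmin⟩ := exists_forall_le
    (IsSemialgebraic.setOf_le (isPolyFun_dist_sq x) (IsPolyFun.const ρ))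
    (isClosed_le hdc continuous_const) (isBoundedSet_ball x ρ) ⟨x, hxball⟩ (hPF w)
  have hyx := hmin x hxball
  have hlt : ∑ i, (y i - x i) ^ 2 < ρ := by
    refine lt_of_le_of_ne hy fun heq => ?_
    have h1 := hγ' y heq
    have h2 : ∑ i, (MvPolynomial.eval y (G i) - MvPolynomial.eval x (G i)) ^ 2 ≤
        ∑ i, (2 * (MvPolynomial.eval y (G i) - w i) ^ 2 +
          2 * (MvPolynomial.eval x (G i) - w i) ^ 2) :=
      Finset.sum_le_sum fun i _ => by
        nlinarith [sq_nonneg ((MvPolynomial.eval y (G i) - w i) + (MvPolynomial.eval x (G i) - w i))]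
    rw [Finset.sum_add_distrib, ← Finset.mul_sum, ← Finset.mul_sum] at h2
    linarith
  refine ⟨y, (hball y hy).1, ?_⟩
  have hgrad := eval_pderiv_eq_zero_of_isLocalMin (p := ∑ i, (G i - MvPolynomial.C (w i)) ^ 2)
    (y := y) (by
      filter_upwards [hdc.continuousAt.eventually (gt_mem_nhds hlt)] with z hz
      simpa using hmin z (le_of_lt hz))
  -- Vanishing of the gradient of `|G - w|²`, up to the factor 2; the Jacobian being invertible, the
  -- residual `G - w` is zero.
  have hv : (jacobianAt G y).transpose.mulVec (fun i => MvPolynomial.eval y (G i) - w i) = 0 := by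
    funext j
    have := hgrad j
    simp only [map_sum, MvPolynomial.pderiv_pow, map_sub, MvPolynomial.pderiv_C, sub_zero, map_mul,
      MvPolynomial.eval_C, Nat.cast_ofNat, map_ofNat,
      Nat.add_one_sub_one, pow_one, mul_assoc, ← Finset.mul_sum] at this
    rw [mul_eq_zero, or_iff_right (two_ne_zero)] at this
    simpa [Matrix.mulVec, dotProduct, jacobianAt, mul_comm] using! this
  have h0 := Matrix.eq_zero_of_mulVec_eq_zero
    (by rw [Matrix.det_transpose]; exact (hball y hy).2.1) hv
  exact fun i => sub_eq_zero.1 (congrFun h0 i)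

end OpenMapping

end RealAlg

namespace RealAlg

/-! ### Formal coordinates at a point and additivity of the order of vanishing. -/

section LocalIrreducibility

variable {K : Type*} [Field K] {n : ℕ}

/-- The maximal ideal of a point. -/
noncomputable def pointIdeal (x : Fin n → K) : Ideal (MvPolynomial (Fin n) K) :=
  RingHom.ker (MvPolynomial.eval x)

theorem mem_pointIdeal {x : Fin n → K} {p : MvPolynomial (Fin n) K} :
    p ∈ pointIdeal x ↔ MvPolynomial.eval x p = 0 :=
  Iff.rfl

theorem X_sub_C_mem_pointIdeal (x : Fin n → K) (i : Fin n) :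
    MvPolynomial.X i - MvPolynomial.C (x i) ∈ pointIdeal x := by
  simp [mem_pointIdeal]

theorem sub_C_eval_mem_pointIdeal (x : Fin n → K) (p : MvPolynomial (Fin n) K) :
    p - MvPolynomial.C (MvPolynomial.eval x p) ∈ pointIdeal x := by
  simp [mem_pointIdeal]

theorem pointIdeal_eq_span (x : Fin n → K) : pointIdeal x =
    Ideal.span (Set.range fun i => MvPolynomial.X i - MvPolynomial.C (x i)) := by
  refine le_antisymm (fun p hp => ?_) (Ideal.span_le.2 ?_)
  · obtain ⟨m, hm⟩ := exists_eq_add_sum p x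
    rw [hm, mem_pointIdeal.1 hp, map_zero, zero_add]
    exact Ideal.sum_mem _ fun i _ => Ideal.mul_mem_right _ _ (Ideal.subset_span ⟨i, rfl⟩)
  · rintro _ ⟨i, rfl⟩
    exact X_sub_C_mem_pointIdeal x i

/-- The kernels of the iterates stabilise; an element of the kernel of `f` is `f^k b`, so `b` lies
in the kernel of `f^(k+1)`, hence in that of `f^k`. -/
theorem injective_of_surjective_ringHom {A : Type*} [CommRing A] [IsNoetherianRing A] (f : A →+* A)
    (hf : Function.Surjective f) : Function.Injective f := by
  rw [injective_iff_map_eq_zero]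
  intro a ha
  let c : ℕ →o Ideal A := ⟨fun k => RingHom.ker (f ^ k), monotone_nat_of_le_succ fun k b hb => by
    rw [RingHom.mem_ker] at hb ⊢
    rw [pow_succ', RingHom.mul_def, RingHom.comp_apply, hb, map_zero]⟩
  obtain ⟨k, hk⟩ := monotone_stabilizes_iff_noetherian.2 ‹_› c
  have hsurj : Function.Surjective (f ^ k) := by
    rw [RingHom.coe_pow]
    exact hf.iterate k
  obtain ⟨b, rfl⟩ := hsurj a
  have hb : b ∈ c (k + 1) := by
    change (f ^ (k + 1)) b = 0
    rw [pow_succ', RingHom.mul_def, RingHom.comp_apply, ha]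
  rw [← hk (k + 1) (Nat.le_succ k)] at hb
  exact hb

variable {x : Fin n → K} {G : Fin n → MvPolynomial (Fin n) K}

/-- The endomorphism of the polynomial ring that maps `Xᵢ - xᵢ` to `Gᵢ`. -/
noncomputable def substitution (x : Fin n → K) (G : Fin n → MvPolynomial (Fin n) K) :
    MvPolynomial (Fin n) K →ₐ[K] MvPolynomial (Fin n) K :=
  MvPolynomial.aeval fun i => MvPolynomial.C (x i) + G i

theorem substitution_C (c : K) :
    substitution x G (MvPolynomial.C c) = MvPolynomial.C c := by
  simp [substitution]

theorem substitution_X_sub_C (i : Fin n) :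
    substitution x G (MvPolynomial.X i - MvPolynomial.C (x i)) = G i := by
  simp [substitution]

theorem map_pow_substitution_le (hG : ∀ i, MvPolynomial.eval x (G i) = 0) (N : ℕ) :
    pointIdeal x ^ N ≤ (pointIdeal x ^ N).comap (substitution x G) := by
  have h1 : pointIdeal x ≤ (pointIdeal x).comap (substitution x G) := by
    conv_lhs => rw [pointIdeal_eq_span]
    rw [Ideal.span_le]
    rintro _ ⟨i, rfl⟩
    change substitution x G _ ∈ pointIdeal x
    rw [substitution_X_sub_C]
    exact hG i
  exact (Ideal.pow_right_mono h1 N).trans (Ideal.le_comap_pow _ N)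

/-- To first order `G` is the Jacobian applied to `X - x`, so the inverse matrix inverts the
substitution modulo the square of the maximal ideal. -/
theorem exists_sub_substitution_mem_sq (hG : ∀ i, MvPolynomial.eval x (G i) = 0)
    (hJ : (jacobianAt G x).det ≠ 0) {a : MvPolynomial (Fin n) K} (ha : a ∈ pointIdeal x) :
    ∃ a' ∈ pointIdeal x, a - substitution x G a' ∈ pointIdeal x ^ 2 := by
  rw [pointIdeal_eq_span] at ha
  induction ha using Submodule.span_induction with
  | mem a ha =>
    obtain ⟨j, rfl⟩ := ha
    choose m hm hmx using fun i => exists_taylor (G i) x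
    refine ⟨∑ i, MvPolynomial.C ((jacobianAt G x)⁻¹ j i) * (MvPolynomial.X i - MvPolynomial.C (x i)),
      Ideal.sum_mem _ fun i _ => Ideal.mul_mem_left _ _ (X_sub_C_mem_pointIdeal x i), ?_⟩
    have h1 : ∀ i, G i - ∑ k, MvPolynomial.C (jacobianAt G x i k) *
        (MvPolynomial.X k - MvPolynomial.C (x k)) ∈ pointIdeal x ^ 2 := by
      intro i
      have h2 : G i - ∑ k, MvPolynomial.C (jacobianAt G x i k) *
          (MvPolynomial.X k - MvPolynomial.C (x k)) =
          ∑ k, (MvPolynomial.X k - MvPolynomial.C (x k)) *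
            (m i k - MvPolynomial.C (MvPolynomial.eval x (m i k))) := by
        conv_lhs => rw [hm i, hG i, map_zero, zero_add]
        rw [← Finset.sum_sub_distrib]
        refine Finset.sum_congr rfl fun k _ => ?_
        rw [hmx]
        simp only [jacobianAt, Matrix.of_apply]
        ring
      rw [h2, pow_two]
      exact Ideal.sum_mem _ fun k _ => Ideal.mul_mem_mul (X_sub_C_mem_pointIdeal x k)
        (sub_C_eval_mem_pointIdeal x _)
    have h3 : (MvPolynomial.X j - MvPolynomial.C (x j)) - substitution x G
        (∑ i, MvPolynomial.C ((jacobianAt G x)⁻¹ j i) * (MvPolynomial.X i - MvPolynomial.C (x i))) =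
        -∑ i, MvPolynomial.C ((jacobianAt G x)⁻¹ j i) * (G i - ∑ k,
          MvPolynomial.C (jacobianAt G x i k) * (MvPolynomial.X k - MvPolynomial.C (x k))) := by
      have h4 : ∑ i, MvPolynomial.C ((jacobianAt G x)⁻¹ j i) * ∑ k,
          MvPolynomial.C (jacobianAt G x i k) * (MvPolynomial.X k - MvPolynomial.C (x k)) =
          MvPolynomial.X j - MvPolynomial.C (x j) := by
        simp only [Finset.mul_sum]
        rw [Finset.sum_comm]
        have h5 : ∀ k, ∑ i, MvPolynomial.C ((jacobianAt G x)⁻¹ j i) *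
            (MvPolynomial.C (jacobianAt G x i k) * (MvPolynomial.X k - MvPolynomial.C (x k))) =
            MvPolynomial.C ((1 : Matrix (Fin n) (Fin n) K) j k) *
              (MvPolynomial.X k - MvPolynomial.C (x k)) := fun k => by
          rw [← Matrix.nonsing_inv_mul (jacobianAt G x) (isUnit_iff_ne_zero.2 hJ), Matrix.mul_apply,
            map_sum, Finset.sum_mul]
          simp only [map_mul, mul_assoc]
        simp only [h5, Matrix.one_apply]
        simp
      rw [map_sum, ← Finset.sum_neg_distrib, ← h4, ← Finset.sum_sub_distrib]
      refine Finset.sum_congr rfl fun i _ => ?_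
      rw [map_mul, substitution_C, substitution_X_sub_C]
      ring
    rw [h3]
    exact neg_mem (Ideal.sum_mem _ fun i _ => Ideal.mul_mem_left _ _ (h1 i))
  | zero => exact ⟨0, zero_mem _, by simp⟩
  | add a b _ _ ha hb =>
    obtain ⟨a', ha', ha⟩ := ha
    obtain ⟨b', hb', hb⟩ := hb
    exact ⟨a' + b', add_mem ha' hb', by rw [map_add, add_sub_add_comm]; exact add_mem ha hb⟩
  | smul c a hspan ha =>
    obtain ⟨a', ha', ha⟩ := ha
    refine ⟨MvPolynomial.C (MvPolynomial.eval x c) * a', Ideal.mul_mem_left _ _ ha', ?_⟩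
    have h1 : c • a - substitution x G (MvPolynomial.C (MvPolynomial.eval x c) * a') =
        (c - MvPolynomial.C (MvPolynomial.eval x c)) * a +
        MvPolynomial.C (MvPolynomial.eval x c) * (a - substitution x G a') := by
      rw [map_mul, substitution_C, smul_eq_mul]
      ring
    rw [h1]
    refine add_mem ?_ (Ideal.mul_mem_left _ _ ha)
    rw [pow_two]
    exact Ideal.mul_mem_mul (sub_C_eval_mem_pointIdeal x c) (by rwa [pointIdeal_eq_span])

theorem exists_sub_substitution_mem_pow_succ (hG : ∀ i, MvPolynomial.eval x (G i) = 0)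
    (hJ : (jacobianAt G x).det ≠ 0) (k : ℕ) {a : MvPolynomial (Fin n) K}
    (ha : a ∈ pointIdeal x ^ k) :
    ∃ a' ∈ pointIdeal x ^ k, a - substitution x G a' ∈ pointIdeal x ^ (k + 1) := by
  induction k generalizing a with
  | zero =>
    refine ⟨MvPolynomial.C (MvPolynomial.eval x a), by simp, ?_⟩
    rw [substitution_C, zero_add, pow_one]
    exact sub_C_eval_mem_pointIdeal x a
  | succ k ih =>
    rw [pow_succ] at ha
    induction ha using Submodule.mul_induction_on' with
    | mem_mul_mem a ha b hb =>
      obtain ⟨a', ha', haa⟩ := ih ha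
      obtain ⟨b', hb', hbb⟩ := exists_sub_substitution_mem_sq hG hJ hb
      refine ⟨a' * b', by rw [pow_succ]; exact Ideal.mul_mem_mul ha' hb', ?_⟩
      have h1 : a * b - substitution x G (a' * b') =
          (a - substitution x G a') * b + substitution x G a' * (b - substitution x G b') := by
        rw [map_mul]; ring
      rw [h1]
      refine add_mem ?_ ?_
      · rw [pow_succ]
        exact Ideal.mul_mem_mul haa hb
      · rw [add_assoc, pow_add]
        exact Ideal.mul_mem_mul (map_pow_substitution_le hG k ha') hbb
    | add a _ b _ ha hb =>
      obtain ⟨a', ha', ha⟩ := ha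
      obtain ⟨b', hb', hb⟩ := hb
      exact ⟨a' + b', add_mem ha' hb', by rw [map_add, add_sub_add_comm]; exact add_mem ha hb⟩

theorem exists_sub_substitution_mem_pow (hG : ∀ i, MvPolynomial.eval x (G i) = 0)
    (hJ : (jacobianAt G x).det ≠ 0) (N : ℕ) (a : MvPolynomial (Fin n) K) :
    ∃ a', a - substitution x G a' ∈ pointIdeal x ^ N := by
  induction N with
  | zero => exact ⟨0, by simp⟩
  | succ N ih =>
    obtain ⟨a', ha'⟩ := ih
    obtain ⟨b, -, hb⟩ := exists_sub_substitution_mem_pow_succ hG hJ N ha'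
    exact ⟨a' + b, by rwa [map_add, ← sub_sub]⟩

/-- Modulo the `N`-th power of the maximal ideal the substitution is surjective by successive
approximation, hence injective: a formal inverse function theorem. -/
theorem mem_pow_of_substitution_mem_pow (hG : ∀ i, MvPolynomial.eval x (G i) = 0)
    (hJ : (jacobianAt G x).det ≠ 0) (N : ℕ) {a : MvPolynomial (Fin n) K}
    (ha : substitution x G a ∈ pointIdeal x ^ N) : a ∈ pointIdeal x ^ N := by
  let θ : MvPolynomial (Fin n) K ⧸ pointIdeal x ^ N →+* MvPolynomial (Fin n) K ⧸ pointIdeal x ^ N :=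
    Ideal.quotientMap _ (substitution x G : MvPolynomial (Fin n) K →+* MvPolynomial (Fin n) K)
      (map_pow_substitution_le hG N)
  have hθ : Function.Surjective θ := by
    intro b
    obtain ⟨b, rfl⟩ := Ideal.Quotient.mk_surjective b
    obtain ⟨b', hb'⟩ := exists_sub_substitution_mem_pow hG hJ N b
    refine ⟨Ideal.Quotient.mk _ b', ?_⟩
    simp only [θ]
    exact (Ideal.Quotient.eq.2 hb').symm
  have hinj := injective_of_surjective_ringHom θ hθ
  rw [← Ideal.Quotient.eq_zero_iff_mem]
  apply hinj
  rw [map_zero]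
  simp only [θ]
  exact Ideal.Quotient.eq_zero_iff_mem.2 ha

/-- Substitution of `0` for `Xᵢ - xᵢ` if `i ∈ I`, and of `T (Xᵢ - xᵢ)` otherwise. -/
noncomputable def scaling (x : Fin n → K) (I : Set (Fin n)) :
    MvPolynomial (Fin n) K →ₐ[K] Polynomial (MvPolynomial (Fin n) K) :=
  open Classical in
  MvPolynomial.aeval fun i => Polynomial.C (MvPolynomial.C (x i)) +
    if i ∈ I then 0 else Polynomial.C (MvPolynomial.X i - MvPolynomial.C (x i)) * Polynomial.X

theorem scaling_C (I : Set (Fin n)) (c : K) :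
    scaling x I (MvPolynomial.C c) = Polynomial.C (MvPolynomial.C c) := by
  rw [← MvPolynomial.algebraMap_eq, AlgHom.commutes]
  rfl

theorem scaling_X_sub_C (I : Set (Fin n)) (i : Fin n) [Decidable (i ∈ I)] :
    scaling x I (MvPolynomial.X i - MvPolynomial.C (x i)) =
      if i ∈ I then 0 else
        Polynomial.C (MvPolynomial.X i - MvPolynomial.C (x i)) * Polynomial.X := by
  rw [map_sub, scaling_C, scaling, MvPolynomial.aeval_X, add_sub_cancel_left]
  congr

/-- The ideal generated by the `Xᵢ - xᵢ` with `i ∈ I`. -/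
noncomputable def coordinateIdeal (x : Fin n → K) (I : Set (Fin n)) : Ideal (MvPolynomial (Fin n) K) :=
  Ideal.span ((fun i => MvPolynomial.X i - MvPolynomial.C (x i)) '' I)

/-- Membership in the Rees algebra says that the coefficient of `T^i` lies in the `i`-th power of
the maximal ideal. -/
theorem scaling_mem_reesAlgebra (I : Set (Fin n)) (a : MvPolynomial (Fin n) K) :
    scaling x I a ∈ reesAlgebra (pointIdeal x) := by
  classical
  induction a using MvPolynomial.induction_on with
  | C c =>
    rw [scaling_C]
    exact (reesAlgebra (pointIdeal x)).algebraMap_mem _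
  | add a b ha hb => rw [map_add]; exact add_mem ha hb
  | mul_X a i ha =>
    rw [map_mul]
    refine mul_mem ha ?_
    rw [← sub_add_cancel (MvPolynomial.X i) (MvPolynomial.C (x i)), map_add, scaling_C,
      scaling_X_sub_C]
    refine add_mem ?_ ((reesAlgebra (pointIdeal x)).algebraMap_mem _)
    split_ifs
    · exact zero_mem _
    · rw [← pow_one Polynomial.X, Polynomial.C_mul_X_pow_eq_monomial]
      exact reesAlgebra.monomial_mem.2 (by rw [pow_one]; exact X_sub_C_mem_pointIdeal x i)

theorem sub_eval_one_scaling_mem (I : Set (Fin n)) (a : MvPolynomial (Fin n) K) :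
    a - (scaling x I a).eval 1 ∈ coordinateIdeal x I := by
  classical
  rw [← Ideal.Quotient.eq_zero_iff_mem, map_sub, sub_eq_zero]
  let f : MvPolynomial (Fin n) K →+* MvPolynomial (Fin n) K ⧸ coordinateIdeal x I :=
    (Ideal.Quotient.mk _).comp ((Polynomial.evalRingHom 1).comp (scaling x I))
  have : Ideal.Quotient.mk (coordinateIdeal x I) = f := by
    refine MvPolynomial.ringHom_ext (fun c => ?_) fun i => ?_
    · simp [f]
    · rw [← sub_add_cancel (MvPolynomial.X i) (MvPolynomial.C (x i)), map_add, map_add]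
      congr 1
      · simp only [f, RingHom.comp_apply, RingHom.coe_coe]
        rw [scaling_X_sub_C]
        split_ifs with hi
        · rw [map_zero, map_zero, Ideal.Quotient.eq_zero_iff_mem]
          exact Ideal.subset_span ⟨i, hi, rfl⟩
        · simp
      · simp [f]
  exact congrArg (fun g => g a) this

/-- Order of vanishing at `x` modulo the coordinate ideal becomes divisibility by powers of a prime
element in a domain, where orders add up under multiplication. -/
theorem X_pow_dvd_scaling_iff (I : Set (Fin n)) (N : ℕ) (a : MvPolynomial (Fin n) K) :
    Polynomial.X ^ N ∣ scaling x I a ↔ a ∈ coordinateIdeal x I ⊔ pointIdeal x ^ N := by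
  classical
  constructor
  · intro h
    rw [← sub_add_cancel a ((scaling x I a).eval 1)]
    refine Ideal.add_mem _ (Ideal.mem_sup_left (sub_eval_one_scaling_mem I a))
      (Ideal.mem_sup_right ?_)
    rw [Polynomial.X_pow_dvd_iff] at h
    rw [Polynomial.eval_eq_sum_range]
    refine Ideal.sum_mem _ fun i _ => ?_
    rw [one_pow, mul_one]
    by_cases hi : i < N
    · rw [h i hi]; exact zero_mem _
    · exact Ideal.pow_le_pow_right (not_lt.1 hi)
        ((mem_reesAlgebra_iff _ _).1 (scaling_mem_reesAlgebra I a) i)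
  · intro h
    have h1 : coordinateIdeal x I ⊔ pointIdeal x ^ N ≤
        (Ideal.span {Polynomial.X ^ N}).comap (scaling x I) := by
      refine sup_le ?_ ?_
      · refine Ideal.span_le.2 ?_
        rintro _ ⟨i, hi, rfl⟩
        change scaling x I _ ∈ Ideal.span {Polynomial.X ^ N}
        rw [scaling_X_sub_C, if_pos hi]
        exact zero_mem _
      · have h2 : pointIdeal x ≤ (Ideal.span {Polynomial.X}).comap (scaling x I) := by
          rw [pointIdeal_eq_span, Ideal.span_le]
          rintro _ ⟨i, rfl⟩
          change scaling x I _ ∈ Ideal.span {Polynomial.X}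
          rw [scaling_X_sub_C]
          split_ifs
          · exact zero_mem _
          · exact Ideal.mem_span_singleton.2 (dvd_mul_left _ _)
        refine (Ideal.pow_right_mono h2 N).trans ((Ideal.le_comap_pow _ N).trans ?_)
        rw [Ideal.span_singleton_pow]
    exact Ideal.mem_span_singleton.1 (h1 h)

theorem pow_dvd_or_pow_dvd_of_mul_pow {A : Type*} [CommRing A] [IsDomain A] {p u v : A}
    (hp : Prime p) {k M N : ℕ} (h : p ^ (k * M + N) ∣ u * v ^ k) : p ^ N ∣ u ∨ p ^ M ∣ v := by
  by_contra! hcon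
  rw [pow_dvd_iff_le_emultiplicity, emultiplicity_mul hp, emultiplicity_pow hp] at h
  simp only [pow_dvd_iff_le_emultiplicity, not_le] at hcon
  obtain ⟨h1, h2⟩ := hcon
  obtain ⟨a, ha⟩ := ENat.ne_top_iff_exists.1 h1.ne_top
  obtain ⟨b, hb⟩ := ENat.ne_top_iff_exists.1 h2.ne_top
  rw [← ha] at h h1
  rw [← hb] at h h2
  norm_cast at h h1 h2
  have : k * b ≤ k * M := Nat.mul_le_mul_left k h2.le
  omega

/-- To any finite precision the substitution carries the coordinate ideal to `(G_I)`. In coordinates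
orders are additive, so `H` and `F` cannot both have finite order modulo `(G_I)`. -/
theorem mem_sup_pow_of_mul_pow_mem (hG : ∀ i, MvPolynomial.eval x (G i) = 0)
    (hJ : (jacobianAt G x).det ≠ 0) (I : Set (Fin n)) {H F : MvPolynomial (Fin n) K} {k : ℕ}
    (h : H * F ^ k ∈ Ideal.span (G '' I)) :
    (∀ N, H ∈ Ideal.span (G '' I) ⊔ pointIdeal x ^ N) ∨
      ∀ N, F ∈ Ideal.span (G '' I) ⊔ pointIdeal x ^ N := by
  by_contra! hcon
  obtain ⟨⟨N, hN⟩, ⟨M, hM⟩⟩ := hcon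
  -- Precision `k * M + N` suffices for the product; the further `M` ensures `M ≤ L` when `k = 0`.
  let L := k * M + N + M
  obtain ⟨H', hH'⟩ := exists_sub_substitution_mem_pow hG hJ L H
  obtain ⟨F', hF'⟩ := exists_sub_substitution_mem_pow hG hJ L F
  have hlift : ∀ a ∈ Ideal.span (G '' I), ∃ a' ∈ coordinateIdeal x I,
      a - substitution x G a' ∈ pointIdeal x ^ L := by
    intro a ha
    induction ha using Submodule.span_induction with
    | mem a ha =>
      obtain ⟨i, hi, rfl⟩ := ha
      exact ⟨_, Ideal.subset_span ⟨i, hi, rfl⟩, by simp [substitution_X_sub_C, -map_sub]⟩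
    | zero => exact ⟨0, zero_mem _, by simp⟩
    | add a b _ _ ha hb =>
      obtain ⟨a', ha', ha⟩ := ha
      obtain ⟨b', hb', hb⟩ := hb
      exact ⟨a' + b', add_mem ha' hb', by rw [map_add, add_sub_add_comm]; exact add_mem ha hb⟩
    | smul c a _ ha =>
      obtain ⟨a', ha', ha⟩ := ha
      obtain ⟨c', hc'⟩ := exists_sub_substitution_mem_pow hG hJ L c
      refine ⟨c' * a', Ideal.mul_mem_left _ _ ha', ?_⟩
      have h1 : c • a - substitution x G (c' * a') =
          (c - substitution x G c') * substitution x G a' + c * (a - substitution x G a') := by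
        rw [map_mul, smul_eq_mul]; ring
      rw [h1]
      exact add_mem (Ideal.mul_mem_right _ _ hc') (Ideal.mul_mem_left _ _ ha)
  obtain ⟨u, hu, hu'⟩ := hlift _ h
  have h1 : H' * F' ^ k - u ∈ pointIdeal x ^ L := by
    apply mem_pow_of_substitution_mem_pow hG hJ
    rw [← Ideal.Quotient.eq_zero_iff_mem]
    rw [← Ideal.Quotient.eq_zero_iff_mem, map_sub, sub_eq_zero] at hH' hF' hu'
    rw [map_sub, map_mul, map_pow, map_sub, map_mul, map_pow, ← hH', ← hF', ← hu', map_mul, map_pow,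
      sub_self]
  have h2 : H' * F' ^ k ∈ coordinateIdeal x I ⊔ pointIdeal x ^ L := by
    rw [← sub_add_cancel (H' * F' ^ k) u]
    exact add_mem (Ideal.mem_sup_right h1) (Ideal.mem_sup_left hu)
  rw [← X_pow_dvd_scaling_iff, map_mul, map_pow] at h2
  have h3 := pow_dvd_or_pow_dvd_of_mul_pow Polynomial.prime_X
    ((pow_dvd_pow _ (Nat.le_add_right _ M)).trans h2)
  rw [X_pow_dvd_scaling_iff, X_pow_dvd_scaling_iff] at h3
  have hback : ∀ (Q : ℕ) (a a' : MvPolynomial (Fin n) K), Q ≤ L →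
      a - substitution x G a' ∈ pointIdeal x ^ L → a' ∈ coordinateIdeal x I ⊔ pointIdeal x ^ Q →
      a ∈ Ideal.span (G '' I) ⊔ pointIdeal x ^ Q := by
    intro Q a a' hQ ha ha'
    rw [← sub_add_cancel a (substitution x G a')]
    refine add_mem (Ideal.mem_sup_right (Ideal.pow_le_pow_right hQ ha)) ?_
    have h4 : coordinateIdeal x I ⊔ pointIdeal x ^ Q ≤
        (Ideal.span (G '' I) ⊔ pointIdeal x ^ Q).comap (substitution x G) := by
      refine sup_le (Ideal.span_le.2 ?_)
        ((map_pow_substitution_le hG Q).trans (Ideal.comap_mono le_sup_right))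
      rintro _ ⟨i, hi, rfl⟩
      change substitution x G _ ∈ Ideal.span (G '' I) ⊔ pointIdeal x ^ Q
      rw [substitution_X_sub_C]
      exact Ideal.mem_sup_left (Ideal.subset_span ⟨i, hi, rfl⟩)
    exact h4 ha'
  rcases h3 with h3 | h3
  · exact hN (hback N H H' (by omega) hH' h3)
  · exact hM (hback M F F' (by omega) hF' h3)

/-- Krull's intersection theorem at a point. -/
theorem exists_mul_mem_of_forall_mem_sup_pow {J : Ideal (MvPolynomial (Fin n) K)}
    {F : MvPolynomial (Fin n) K} (h : ∀ N, F ∈ J ⊔ pointIdeal x ^ N) :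
    ∃ a, MvPolynomial.eval x a = 1 ∧ a * F ∈ J := by
  have h1 : Ideal.Quotient.mk J F ∈ (⨅ i : ℕ, pointIdeal x ^ i • ⊤ :
      Submodule (MvPolynomial (Fin n) K) (MvPolynomial (Fin n) K ⧸ J)) := by
    rw [Submodule.mem_iInf]
    intro N
    obtain ⟨j, hj, a, ha, hF⟩ := Submodule.mem_sup.1 (h N)
    have h2 : Ideal.Quotient.mk J F = a • (1 : MvPolynomial (Fin n) K ⧸ J) := by
      rw [← hF, map_add, Ideal.Quotient.eq_zero_iff_mem.2 hj, zero_add]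
      change Ideal.Quotient.mk J a = Ideal.Quotient.mk J (a • 1)
      rw [smul_eq_mul, mul_one]
    rw [h2]
    exact Submodule.smul_mem_smul ha trivial
  rw [Ideal.mem_iInf_smul_pow_eq_bot_iff] at h1
  obtain ⟨⟨r, hr⟩, hrF⟩ := h1
  refine ⟨1 - r, by rw [map_sub, map_one, mem_pointIdeal.1 hr, sub_zero], ?_⟩
  rw [← Ideal.Quotient.eq_zero_iff_mem, sub_mul, one_mul, map_sub, sub_eq_zero]
  exact hrF.symm

/-- Near a point `x` at which the differentials of the `Gᵢ` are independent, the zero set of the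
`Gᵢ` with `i ∈ I` is irreducible. -/
theorem exists_mul_mem_of_mul_pow_mem (hG : ∀ i, MvPolynomial.eval x (G i) = 0)
    (hJ : (jacobianAt G x).det ≠ 0) (I : Set (Fin n)) {P : Ideal (MvPolynomial (Fin n) K)}
    [P.IsPrime] (hP : Ideal.span (G '' I) ≤ P) (hPx : P ≤ pointIdeal x)
    {H F : MvPolynomial (Fin n) K} (hH : H ∉ P) {k : ℕ}
    (h : H * F ^ k ∈ Ideal.span (G '' I)) :
    ∃ a, MvPolynomial.eval x a = 1 ∧ a * F ∈ Ideal.span (G '' I) := by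
  rcases mem_sup_pow_of_mul_pow_mem hG hJ I h with h1 | h1
  · exfalso
    obtain ⟨a, ha, haH⟩ := exists_mul_mem_of_forall_mem_sup_pow h1
    have h2 := hPx ((Ideal.IsPrime.mem_or_mem ‹_› (hP haH)).resolve_right hH)
    rw [mem_pointIdeal, ha] at h2
    exact one_ne_zero h2
  · exact exists_mul_mem_of_forall_mem_sup_pow h1

end LocalIrreducibility

end RealAlg

namespace RealAlg

/-! ### Dimension bounds from differentials. -/

section Dimension

variable {K : Type*} [Field K] {n : ℕ}

theorem derivation_aeval {S L : Type*} [CommRing S] [Algebra K S] [AddCommGroup L] [Module K L]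
    [Module S L] [IsScalarTower K S L]
    (D : Derivation K S L) (ξ : Fin n → S) (p : MvPolynomial (Fin n) K) :
    D (MvPolynomial.aeval ξ p) =
      ∑ j, MvPolynomial.aeval ξ (MvPolynomial.pderiv j p) • D (ξ j) := by
  induction p using MvPolynomial.induction_on with
  | C a => simp [MvPolynomial.algHom_C]
  | add p q hp hq => simp [hp, hq, add_smul, Finset.sum_add_distrib]
  | mul_X p i hp =>
    simp only [map_mul, MvPolynomial.aeval_X, Derivation.leibniz, hp, MvPolynomial.pderiv_X,
      smul_eq_mul, map_add, add_smul, Finset.sum_add_distrib, Finset.smul_sum, smul_smul]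
    congr 1
    rw [Finset.sum_eq_single i]
    · simp
    · intro j _ hj
      simp [Pi.single_eq_of_ne' hj]
    · simp

/-- The Krull dimension of a finitely generated domain is at most the transcendence degree of its
field of fractions. -/
theorem ringKrullDim_le_of_trdeg_le {D L : Type*} [CommRing D] [IsDomain D] [Algebra K D]
    [Algebra.FiniteType K D] [Field L] [Algebra D L] [Algebra K L] [IsScalarTower K D L]
    [IsFractionRing D L] {d : ℕ} (h : Algebra.trdeg K L ≤ d) : ringKrullDim D ≤ d := by
  -- Noether normalisation: the `s` variables stay independent in `L`, and primes of an integral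
  -- extension contract strictly.
  obtain ⟨s, g, hg, hfin⟩ := exists_finite_inj_algHom_of_fg K D
  have h1 : s ≤ d := by
    have hinj : Function.Injective ((IsScalarTower.toAlgHom K D L).comp g) :=
      (FaithfulSMul.algebraMap_injective D L).comp hg
    have hind : AlgebraicIndependent K
        fun i => (IsScalarTower.toAlgHom K D L).comp g (MvPolynomial.X i) := by
      have := (MvPolynomial.algebraicIndependent_X (Fin s) K).map' hinj
      exact this
    have := hind.lift_cardinalMk_le_trdeg.trans (Cardinal.lift_le.2 h)
    simpa using this
  have h2 : ringKrullDim D ≤ ringKrullDim (MvPolynomial (Fin s) K) := by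
    algebraize [g.toRingHom]
    refine Order.krullDim_le_of_strictMono
      (PrimeSpectrum.comap (algebraMap (MvPolynomial (Fin s) K) D)) fun p q hpq => ?_
    have : Algebra.IsIntegral (MvPolynomial (Fin s) K) D :=
      Algebra.isIntegral_def.2 hfin.to_isIntegral
    exact Ideal.IsIntegral.comap_lt_comap (I := p.asIdeal) (J := q.asIdeal) hpq
  refine h2.trans ?_
  rw [MvPolynomial.ringKrullDim_of_isNoetherianRing, ringKrullDim_eq_zero_of_field]
  simpa using h1

open scoped IntermediateField.algebraAdjoinAdjoin in
/-- A field generated by elements whose differentials satisfy a nonsingular square system of linear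
equations is algebraic over the subfield generated by the values of the system. -/
theorem trdeg_le_of_det_ne_zero [CharZero K] {L : Type*} [Field L] [Algebra K L]
    [Algebra.EssFiniteType K L] (ξ : Fin n → L)
    (hξ : ∀ z : L, ∃ p q : MvPolynomial (Fin n) K,
      z = MvPolynomial.aeval ξ p / MvPolynomial.aeval ξ q)
    (G : Fin n → MvPolynomial (Fin n) K) (I : Set (Fin n))
    (hI : ∀ i ∈ I, MvPolynomial.aeval ξ (G i) = 0)
    (hJ : (Matrix.of fun i j => MvPolynomial.aeval ξ (MvPolynomial.pderiv j (G i))).det ≠ 0) :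
    Algebra.trdeg K L ≤ (Iᶜ.ncard : ℕ) := by
  classical
  set S : Set L := (fun i => MvPolynomial.aeval ξ (G i)) '' Iᶜ with hS
  let M := IntermediateField.adjoin K S
  -- The differentials of all `G i` vanish over `M`: for `i ∈ I` the value is 0, otherwise it lies
  -- in `M`. The nonsingular system kills every `dξ j`, so `L` is unramified, hence algebraic, over
  -- `M`.
  have hD : ∀ z : L, KaehlerDifferential.D M L z = 0 := by
    let D : Derivation K L (Ω[L⁄M]) := (KaehlerDifferential.D M L).restrictScalars K
    have hDM : ∀ m : M, D (m : L) = 0 := fun m => (KaehlerDifferential.D M L).map_algebraMap m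
    have hG : ∀ i, D (MvPolynomial.aeval ξ (G i)) = 0 := by
      intro i
      by_cases hi : i ∈ I
      · rw [hI i hi, map_zero]
      · exact hDM ⟨_, IntermediateField.subset_adjoin K S ⟨i, hi, rfl⟩⟩
    have hD0 : ∀ j, D (ξ j) = 0 := by
      set J : Matrix (Fin n) (Fin n) L :=
        Matrix.of fun i j => MvPolynomial.aeval ξ (MvPolynomial.pderiv j (G i)) with hJdef
      have hsys : ∀ i, ∑ j, J i j • D (ξ j) = 0 := fun i => by
        rw [← hG i, derivation_aeval]
        rfl
      intro k
      have h1 : ∑ i, J⁻¹ k i • ∑ j, J i j • D (ξ j) = D (ξ k) := by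
        simp only [Finset.smul_sum, smul_smul]
        rw [Finset.sum_comm]
        simp only [← Finset.sum_smul, ← Matrix.mul_apply]
        rw [Matrix.nonsing_inv_mul J (isUnit_iff_ne_zero.2 hJ)]
        rw [Finset.sum_eq_single k]
        · simp
        · intro j _ hj
          simp [Matrix.one_apply_ne' hj]
        · simp
      rw [← h1]
      exact Finset.sum_eq_zero fun i _ => by rw [hsys, smul_zero]
    have hDp : ∀ p : MvPolynomial (Fin n) K, D (MvPolynomial.aeval ξ p) = 0 := fun p => by
      rw [derivation_aeval]
      exact Finset.sum_eq_zero fun j _ => by rw [hD0, smul_zero]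
    intro z
    obtain ⟨p, q, rfl⟩ := hξ z
    change D _ = 0
    rw [Derivation.leibniz_div, hDp, hDp]
    simp
  have hun : Algebra.FormallyUnramified M L := by
    refine ⟨?_⟩
    rw [← Submodule.subsingleton_iff L, ← subsingleton_iff_bot_eq_top, ←
      KaehlerDifferential.span_range_derivation, eq_comm, Submodule.span_eq_bot]
    rintro _ ⟨z, rfl⟩
    exact hD z
  have : Algebra.EssFiniteType M L := Algebra.EssFiniteType.of_comp K M L
  have hsep : Algebra.IsSeparable M L := Algebra.FormallyUnramified.isSeparable M L
  have halg : Algebra.IsAlgebraic (Algebra.adjoin K S) L :=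
    Algebra.IsAlgebraic.trans (Algebra.adjoin K S) M L
  refine (Algebra.IsAlgebraic.trdeg_le_cardinalMk K S).trans ?_
  rw [← Set.cast_ncard (((Set.toFinite Iᶜ).image _ : S.Finite)), Nat.cast_le]
  exact Set.ncard_image_le

/-- Near a point where a square system has nonzero Jacobian, the irreducible zero sets of some of
the equations have at most the expected dimension. -/
theorem ringKrullDim_quotient_le_ncard_compl [CharZero K] {x : Fin n → K}
    {G : Fin n → MvPolynomial (Fin n) K} (hJ : (jacobianAt G x).det ≠ 0) {I : Set (Fin n)}
    {q : Ideal (MvPolynomial (Fin n) K)} [q.IsPrime] (hq : ∀ i ∈ I, G i ∈ q)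
    (hqx : q ≤ pointIdeal x) :
    ringKrullDim (MvPolynomial (Fin n) K ⧸ q) ≤ (Iᶜ.ncard : ℕ) := by
  let D := MvPolynomial (Fin n) K ⧸ q
  let L := FractionRing D
  let ξ : Fin n → L := fun i => algebraMap D L (Ideal.Quotient.mk q (MvPolynomial.X i))
  have hξ : ∀ p, MvPolynomial.aeval ξ p = algebraMap D L (Ideal.Quotient.mk q p) := by
    intro p
    have : MvPolynomial.aeval ξ =
        (IsScalarTower.toAlgHom K D L).comp (Ideal.Quotient.mkₐ K q) := by
      ext i
      simp only [MvPolynomial.aeval_X]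
      rfl
    rw [this]
    rfl
  have hξ0 : ∀ p, MvPolynomial.aeval ξ p = 0 ↔ p ∈ q := fun p => by
    rw [hξ, FaithfulSMul.algebraMap_eq_zero_iff, Ideal.Quotient.eq_zero_iff_mem]
  refine ringKrullDim_le_of_trdeg_le (K := K) (L := L)
    (trdeg_le_of_det_ne_zero ξ (fun z => ?_) G I (fun i hi => (hξ0 _).2 (hq i hi)) ?_)
  · obtain ⟨a, b, _, rfl⟩ := IsFractionRing.div_surjective (A := D) z
    obtain ⟨a, rfl⟩ := Ideal.Quotient.mk_surjective a
    obtain ⟨b, rfl⟩ := Ideal.Quotient.mk_surjective b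
    exact ⟨a, b, by rw [hξ, hξ]⟩
  -- The Jacobian determinant is nonzero at `x`, so as a polynomial it lies outside `q`.
  · intro h
    have h1 : MvPolynomial.aeval ξ
        (Matrix.of fun i j => MvPolynomial.pderiv j (G i) :
          Matrix (Fin n) (Fin n) (MvPolynomial (Fin n) K)).det = 0 := by
      rw [AlgHom.map_det, ← h]
      rfl
    have h2 := hqx ((hξ0 _).1 h1)
    rw [mem_pointIdeal, RingHom.map_det] at h2
    exact hJ h2

/-- If `q < P`, then `A ⧸ P` is a quotient of `A ⧸ q` by a nonzero element at least, which lowers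
the dimension of a domain. -/
theorem eq_of_le_of_ringKrullDim_eq {A : Type*} [CommRing A] {P q : Ideal A} [P.IsPrime] [q.IsPrime]
    (hqP : q ≤ P) {d : ℕ} (hP : ringKrullDim (A ⧸ P) = d) (hq : ringKrullDim (A ⧸ q) ≤ d) :
    q = P := by
  by_contra hne
  obtain ⟨r, hrP, hrq⟩ := SetLike.exists_of_lt (lt_of_le_of_ne hqP hne)
  have h1 := ringKrullDim_quotient_succ_le_of_nonZeroDivisor (R := A ⧸ q)
    (r := Ideal.Quotient.mk q r)
    (mem_nonZeroDivisors_of_ne_zero (by rwa [Ne, Ideal.Quotient.eq_zero_iff_mem]))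
  have h2 : ringKrullDim (A ⧸ P) ≤
      ringKrullDim ((A ⧸ q) ⧸ Ideal.span {Ideal.Quotient.mk q r}) := by
    refine ringKrullDim_le_of_surjective (Ideal.Quotient.lift _ (Ideal.Quotient.factor hqP) ?_)
      (Ideal.Quotient.lift_surjective_of_surjective _ _ (Ideal.Quotient.factor_surjective hqP))
    intro a ha
    rw [← RingHom.mem_ker]
    refine (Ideal.span_le.2 ?_) ha
    rintro _ rfl
    simpa [RingHom.mem_ker, Ideal.Quotient.eq_zero_iff_mem] using hrP
  have h3 := ((add_le_add_left h2 1).trans h1).trans hq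
  rw [hP] at h3
  norm_cast at h3
  omega

/-- `P` gives the only prime of `A_P / J`, so `F` is nilpotent there. -/
theorem exists_mul_pow_mem_of_forall_prime_eq {A : Type*} [CommRing A] {J P : Ideal A} [P.IsPrime]
    (h : ∀ q : Ideal A, q.IsPrime → J ≤ q → q ≤ P → q = P) {F : A} (hF : F ∈ P) :
    ∃ H ∉ P, ∃ k : ℕ, H * F ^ k ∈ J := by
  by_contra hcon
  push Not at hcon
  obtain ⟨q, hq, hJq, hdisj⟩ := Ideal.exists_le_prime_disjoint J
    (P.primeCompl ⊔ Submonoid.powers F) (by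
      rw [Set.disjoint_left]
      intro a ha hmem
      obtain ⟨H, hH, _, ⟨k, rfl⟩, rfl⟩ := Submonoid.mem_sup.1 hmem
      exact hcon H hH k ha)
  have hqP : q ≤ P := fun a ha => by
    by_contra haP
    exact Set.disjoint_left.1 hdisj ha (Submonoid.mem_sup_left haP)
  have := h q hq hJq hqP
  exact Set.disjoint_left.1 hdisj (this ▸ hF)
    (Submonoid.mem_sup_right (Submonoid.mem_powers F))

end Dimension

/-! ### Irreducible components and local equations. -/

section Components

variable {K : Type*} [Field K] {n : ℕ}

theorem isAlgebraicSet_zeroLocus (I : Ideal (MvPolynomial (Fin n) K)) :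
    IsAlgebraicSet K (MvPolynomial.zeroLocus K I) := by
  obtain ⟨s, rfl⟩ := (isNoetherianRing_iff_ideal_fg _).1 inferInstance I
  exact ⟨s, s.finite_toSet, MvPolynomial.zeroLocus_span _⟩

theorem IsAlgebraicSet.zeroLocus_vanishingIdeal {X : Set (Fin n → K)} {k : Type*} [Field k]
    [Algebra k K] (hX : IsAlgebraicSet k X) :
    MvPolynomial.zeroLocus K (MvPolynomial.vanishingIdeal K X) = X := by
  refine Set.Subset.antisymm (fun z hz => ?_) (MvPolynomial.zeroLocus_vanishingIdeal_le X)
  obtain ⟨s, _, rfl⟩ := hX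
  intro f hf
  have := hz (MvPolynomial.map (algebraMap k K) f) fun y hy => by
    rw [MvPolynomial.aeval_map_algebraMap]
    exact hy f hf
  rwa [MvPolynomial.aeval_map_algebraMap] at this

theorem vanishingIdeal_le_pointIdeal {X : Set (Fin n → K)} {x : Fin n → K} (hx : x ∈ X) :
    MvPolynomial.vanishingIdeal K X ≤ pointIdeal x := fun p hp => by
  rw [mem_pointIdeal, ← MvPolynomial.aeval_eq_eval]
  exact hp x hx

theorem IsIrreducibleAlgebraicSet.isPrime_vanishingIdeal {X : Set (Fin n → K)}
    (hX : IsIrreducibleAlgebraicSet X) : (MvPolynomial.vanishingIdeal K X).IsPrime := by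
  obtain ⟨hX, ⟨x, hx⟩, hirr⟩ := hX
  refine ⟨fun h => ?_, fun {f g} hfg => ?_⟩
  · have : (1 : MvPolynomial (Fin n) K) ∈ MvPolynomial.vanishingIdeal K X := h ▸ Submodule.mem_top
    simpa using this x hx
  · have key : ∀ h : MvPolynomial (Fin n) K,
        IsAlgebraicSet K (X ∩ {z | MvPolynomial.aeval z h = 0}) := fun h => by
      obtain ⟨s, hs, rfl⟩ := hX
      refine ⟨insert h s, hs.insert h, ?_⟩
      ext z
      simp [and_comm]
    have hX' : X = (X ∩ {z | MvPolynomial.aeval z f = 0}) ∪ (X ∩ {z | MvPolynomial.aeval z g = 0}) := by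
      rw [← Set.inter_union_distrib_left, eq_comm, Set.inter_eq_left]
      intro z hz
      have := hfg z hz
      rwa [map_mul, mul_eq_zero] at this
    rcases hirr _ _ (key f) (key g) hX' with h | h
    · exact Or.inl fun z hz => (h ▸ hz : z ∈ X ∩ _).2
    · exact Or.inr fun z hz => (h ▸ hz : z ∈ X ∩ _).2

theorem isIrreducibleAlgebraicSet_zeroLocus [IsAlgClosed K] (P : Ideal (MvPolynomial (Fin n) K))
    [hP : P.IsPrime] : IsIrreducibleAlgebraicSet (MvPolynomial.zeroLocus K P) := by
  have hV := MvPolynomial.IsPrime.vanishingIdeal_zeroLocus (K := K) P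
  refine ⟨isAlgebraicSet_zeroLocus P, ?_, fun X₁ X₂ h₁ h₂ h => ?_⟩
  · rw [Set.nonempty_iff_ne_empty]
    intro h
    rw [h, MvPolynomial.vanishingIdeal_empty] at hV
    exact hP.ne_top hV.symm
  · have h12 : MvPolynomial.vanishingIdeal K X₁ * MvPolynomial.vanishingIdeal K X₂ ≤ P := by
      rw [Ideal.mul_le]
      intro a ha b hb
      rw [← hV, h]
      rintro z (hz | hz)
      · rw [map_mul, ha z hz, zero_mul]
      · rw [map_mul, hb z hz, mul_zero]
    rcases hP.mul_le.1 h12 with h' | h'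
    · refine Or.inl (Set.Subset.antisymm ?_ (h ▸ Set.subset_union_left))
      rw [← h₁.zeroLocus_vanishingIdeal]
      exact MvPolynomial.zeroLocus_anti_mono h'
    · refine Or.inr (Set.Subset.antisymm ?_ (h ▸ Set.subset_union_right))
      rw [← h₂.zeroLocus_vanishingIdeal]
      exact MvPolynomial.zeroLocus_anti_mono h'

/-- The Nullstellensatz turns minimality of `P` into maximality of its zero set. -/
theorem isIrreducibleComponent_zeroLocus [IsAlgClosed K] {k : Type*} [Field k] [Algebra k K]
    {Z : Set (Fin n → K)} (hZ : IsAlgebraicSet k Z) {P : Ideal (MvPolynomial (Fin n) K)}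
    (hP : P ∈ (MvPolynomial.vanishingIdeal K Z).minimalPrimes) :
    IsIrreducibleComponent (MvPolynomial.zeroLocus K P) Z := by
  have hprime : P.IsPrime := hP.1.1
  refine ⟨⟨isIrreducibleAlgebraicSet_zeroLocus P, ?_⟩, ?_⟩
  · rw [← hZ.zeroLocus_vanishingIdeal]
    exact MvPolynomial.zeroLocus_anti_mono hP.1.2
  · rintro Y ⟨hY, hYZ⟩ hPY
    have h1 : MvPolynomial.vanishingIdeal K Y ≤ P := by
      rw [← MvPolynomial.IsPrime.vanishingIdeal_zeroLocus (K := K) P]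
      exact MvPolynomial.vanishingIdeal_anti_mono hPY
    have h2 := hP.2 ⟨hY.isPrime_vanishingIdeal, MvPolynomial.vanishingIdeal_anti_mono hYZ⟩ h1
    change Y ⊆ _
    rw [← hY.1.zeroLocus_vanishingIdeal]
    exact MvPolynomial.zeroLocus_anti_mono h2

/-- Equations of an equidimensional algebraic set with independent differentials, as many as the
codimension, generate the ideal of the set locally. -/
theorem IsEquidimensional.exists_mul_mem_span [IsAlgClosed K] [CharZero K] {k : Type*} [Field k]
    [Algebra k K] {d : ℕ} {Z : Set (Fin n → K)} (hZ : IsEquidimensional d Z)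
    (hZk : IsAlgebraicSet k Z) {x : Fin n → K} (hx : x ∈ Z) {G : Fin n → MvPolynomial (Fin n) K}
    (hG : ∀ i, MvPolynomial.eval x (G i) = 0) (hJ : (jacobianAt G x).det ≠ 0) {I : Set (Fin n)}
    (hI : ∀ i ∈ I, G i ∈ MvPolynomial.vanishingIdeal K Z) (hd : Iᶜ.ncard = d)
    {F : MvPolynomial (Fin n) K} (hF : F ∈ MvPolynomial.vanishingIdeal K Z) :
    ∃ a, MvPolynomial.eval x a = 1 ∧ a * F ∈ Ideal.span (G '' I) := by
  have hmax : (pointIdeal x).IsPrime := RingHom.ker_isPrime _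
  obtain ⟨P, hP, hPx⟩ := Ideal.exists_minimalPrimes_le (vanishingIdeal_le_pointIdeal hx)
  have hprime : P.IsPrime := hP.1.1
  have hdim : ringKrullDim (MvPolynomial (Fin n) K ⧸ P) = d := by
    have := hZ _ (isIrreducibleComponent_zeroLocus hZk hP)
    rwa [algDim, MvPolynomial.IsPrime.vanishingIdeal_zeroLocus] at this
  have hGP : Ideal.span (G '' I) ≤ P := by
    rw [Ideal.span_le]
    rintro _ ⟨i, hi, rfl⟩
    exact hP.1.2 (hI i hi)
  -- Primes between `(G_I)` and `P` have dimension at most `d = dim P`, so they equal `P` and `F` is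
  -- nilpotent locally at `P`.
  obtain ⟨H, hH, k, hk⟩ := exists_mul_pow_mem_of_forall_prime_eq (J := Ideal.span (G '' I)) (P := P)
    (fun q hq hGq hqP => by
      refine eq_of_le_of_ringKrullDim_eq hqP hdim ?_
      rw [← hd]
      exact ringKrullDim_quotient_le_ncard_compl hJ
        (fun i hi => hGq (Ideal.subset_span ⟨i, hi, rfl⟩)) (hqP.trans hPx)) (hP.1.2 hF)
  exact exists_mul_mem_of_mul_pow_mem hG hJ I hGP hPx hH hk

end Components

end RealAlg

namespace RealAlg

open Topology

/-! ### Gradients and tangent spaces. -/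

section Gradient

variable {K : Type*} [Field K] {n : ℕ}

/-- The gradient of a polynomial at a point. -/
noncomputable def gradientAt (f : MvPolynomial (Fin n) K) (y : Fin n → K) : Fin n → K :=
  fun j => MvPolynomial.eval y (MvPolynomial.pderiv j f)

theorem gradientAt_add (f g : MvPolynomial (Fin n) K) (y : Fin n → K) :
    gradientAt (f + g) y = gradientAt f y + gradientAt g y := by
  ext j
  simp [gradientAt]

theorem gradientAt_C_mul (c : K) (f : MvPolynomial (Fin n) K) (y : Fin n → K) :
    gradientAt (MvPolynomial.C c * f) y = c • gradientAt f y := by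
  ext j
  simp [gradientAt]

theorem gradientAt_mul {f : MvPolynomial (Fin n) K} {y : Fin n → K}
    (hf : MvPolynomial.eval y f = 0) (a : MvPolynomial (Fin n) K) :
    gradientAt (a * f) y = MvPolynomial.eval y a • gradientAt f y := by
  ext j
  simp [gradientAt, Derivation.leibniz, hf]

theorem gradientAt_sub_C (f : MvPolynomial (Fin n) K) (c : K) (y : Fin n → K) :
    gradientAt (f - MvPolynomial.C c) y = gradientAt f y := by
  ext j
  simp [gradientAt]

theorem gradientAt_X (i : Fin n) (y : Fin n → K) :
    gradientAt (MvPolynomial.X i) y = Pi.single i 1 := by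
  ext j
  by_cases h : j = i
  · subst h
    simp [gradientAt]
  · simp [gradientAt, MvPolynomial.pderiv_X_of_ne (Ne.symm h), Pi.single_eq_of_ne h]

theorem differentialAt_apply (f : MvPolynomial (Fin n) K) (y v : Fin n → K) :
    differentialAt f y v = ∑ j, gradientAt f y j * v j := by
  simp [differentialAt, gradientAt, LinearMap.sum_apply]

/-- By the product rule at a common zero, gradients of generators span those of the whole ideal; the
rank thus does not depend on the generators. -/
theorem span_range_row_jacobianAt {Z : Set (Fin n → K)} {y : Fin n → K} (hy : y ∈ Z) {p : ℕ}
    {g : Fin p → MvPolynomial (Fin n) K}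
    (hg : Ideal.span (Set.range g) = MvPolynomial.vanishingIdeal K Z) :
    Submodule.span K (Set.range (jacobianAt g y).row) =
      Submodule.span K ((gradientAt · y) '' (MvPolynomial.vanishingIdeal K Z : Set _)) := by
  refine le_antisymm (Submodule.span_mono ?_) (Submodule.span_le.2 ?_)
  · rintro _ ⟨i, rfl⟩
    exact ⟨g i, hg ▸ Ideal.subset_span ⟨i, rfl⟩, rfl⟩
  · rintro _ ⟨F, hF, rfl⟩
    have h0 : ∀ f ∈ Ideal.span (Set.range g), MvPolynomial.eval y f = 0 := fun f hf =>
      vanishingIdeal_le_pointIdeal hy (hg ▸ hf)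
    rw [SetLike.mem_coe, ← hg] at hF
    change gradientAt F y ∈ Submodule.span K _
    induction hF using Submodule.span_induction with
    | mem f hf =>
      obtain ⟨i, rfl⟩ := hf
      exact Submodule.subset_span ⟨i, rfl⟩
    | zero =>
      have : gradientAt (0 : MvPolynomial (Fin n) K) y = 0 := by
        ext j
        simp [gradientAt]
      rw [this]
      exact Submodule.zero_mem _
    | add f g _ _ hf hg =>
      rw [gradientAt_add]
      exact Submodule.add_mem _ hf hg
    | smul a f hf h =>
      rw [smul_eq_mul, gradientAt_mul (h0 f hf)]
      exact Submodule.smul_mem _ _ h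

/-- The differential at a point of a function that has no critical point there is not a
combination of the differentials of the equations. -/
theorem gradientAt_notMem_span {Z : Set (Fin n → K)} {y : Fin n → K} {φ : MvPolynomial (Fin n) K}
    (h : ¬ (tangentSpaceAt Z y).map (differentialAt φ y) < ⊤) :
    gradientAt φ y ∉
      Submodule.span K ((gradientAt · y) '' (MvPolynomial.vanishingIdeal K Z : Set _)) := by
  intro hmem
  rw [lt_top_iff_ne_top, not_not] at h
  obtain ⟨v, hv, hv1⟩ : (1 : K) ∈ (tangentSpaceAt Z y).map (differentialAt φ y) :=
    h ▸ Submodule.mem_top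
  have key : ∀ w ∈ Submodule.span K
      ((gradientAt · y) '' (MvPolynomial.vanishingIdeal K Z : Set _)), ∑ j, w j * v j = 0 := by
    intro w hw
    induction hw using Submodule.span_induction with
    | mem w hw =>
      obtain ⟨F, hF, rfl⟩ := hw
      have := (Submodule.mem_iInf _).1 ((Submodule.mem_iInf _).1 hv F) hF
      rwa [LinearMap.mem_ker, differentialAt_apply] at this
    | zero => simp
    | add a b _ _ ha hb => simp [add_mul, Finset.sum_add_distrib, ha, hb]
    | smul c a _ ha => simp [mul_assoc, ← Finset.mul_sum, ha]
  rw [differentialAt_apply, key _ hmem] at hv1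
  exact zero_ne_one hv1

end Gradient

/-! ### Conjugation, real coordinates and descent of `φ` at nonsingular points. -/

section RealStructure

variable {R : Type*} [Field R] [LinearOrder R] [IsStrictOrderedRing R]
  {C : Type*} [Field C] [Algebra R C] {n : ℕ}

theorem eq_zero_of_add_mul_eq_zero {i : C} (hi : i ^ 2 = -1) {a b : R}
    (h : algebraMap R C a + algebraMap R C b * i = 0) : a = 0 ∧ b = 0 := by
  have h1 : algebraMap R C (a ^ 2 + b ^ 2) = 0 := by
    have : algebraMap R C a = -(algebraMap R C b * i) := eq_neg_of_add_eq_zero_left h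
    rw [map_add, map_pow, map_pow, this, neg_sq, mul_pow, hi]
    ring
  rw [FaithfulSMul.algebraMap_eq_zero_iff] at h1
  constructor <;> nlinarith [sq_nonneg a, sq_nonneg b, pow_eq_zero_iff (two_ne_zero) (a := a),
    pow_eq_zero_iff (two_ne_zero) (a := b)]

/-- Otherwise `i` would be fixed by the Galois group and lie in the ordered field `R`. -/
theorem exists_conj [IsAlgClosure R C] {i : C} (hi : i ^ 2 = -1) :
    ∃ σ : C ≃ₐ[R] C, σ i = -i := by
  have := IsAlgClosure.normal R C
  by_contra! hne
  have hfix : ∀ σ : C ≃ₐ[R] C, σ i = i := fun σ => by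
    have h : (σ i) ^ 2 = i ^ 2 := by rw [← map_pow, hi, map_neg, map_one]
    exact (sq_eq_sq_iff_eq_or_eq_neg.1 h).resolve_right (hne σ)
  obtain ⟨a, ha⟩ := IntermediateField.mem_bot.1 ((InfiniteGalois.mem_bot_iff_fixed i).2 hfix)
  have := (eq_zero_of_add_mul_eq_zero hi (a := a) (b := -1) (by rw [ha]; simp)).2
  simp at this

theorem exists_eq_map_add_C_mul_map [IsRealClosed R] [IsAlgClosure R C] {i : C} (hi : i ^ 2 = -1)
    (F : MvPolynomial (Fin n) C) : ∃ A B : MvPolynomial (Fin n) R,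
      F = MvPolynomial.map (algebraMap R C) A +
        MvPolynomial.C i * MvPolynomial.map (algebraMap R C) B := by
  induction F using MvPolynomial.induction_on with
  | C z =>
    obtain ⟨a, b, rfl⟩ := exists_re_im (R := R) hi z
    exact ⟨MvPolynomial.C a, MvPolynomial.C b, by simp [mul_comm]⟩
  | add F G hF hG =>
    obtain ⟨A, B, rfl⟩ := hF
    obtain ⟨A', B', rfl⟩ := hG
    exact ⟨A + A', B + B', by simp only [map_add]; ring⟩
  | mul_X F j hF =>
    obtain ⟨A, B, rfl⟩ := hF
    exact ⟨A * MvPolynomial.X j, B * MvPolynomial.X j, by simp only [map_mul, MvPolynomial.map_X]; ring⟩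

/-- The real and imaginary parts of the equations of a set defined over the real field vanish on
the set. -/
theorem map_mem_vanishingIdeal [IsAlgClosure R C] {i : C} (hi : i ^ 2 = -1)
    {Z : Set (Fin n → C)} (hZ : IsAlgebraicSet R Z) {A B : MvPolynomial (Fin n) R}
    (h : MvPolynomial.map (algebraMap R C) A + MvPolynomial.C i *
      MvPolynomial.map (algebraMap R C) B ∈ MvPolynomial.vanishingIdeal C Z) :
    MvPolynomial.map (algebraMap R C) A ∈ MvPolynomial.vanishingIdeal C Z ∧
      MvPolynomial.map (algebraMap R C) B ∈ MvPolynomial.vanishingIdeal C Z := by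
  have : CharZero C := charZero_of_injective_algebraMap (algebraMap R C).injective
  obtain ⟨σ, hσ⟩ := exists_conj (R := R) hi
  have key : ∀ z ∈ Z, MvPolynomial.aeval z A = 0 ∧ MvPolynomial.aeval z B = 0 := by
    intro z hz
    -- `Z` is stable under conjugation. Evaluating at the conjugate point and applying `σ` gives
    -- `A(z) - iB(z) = 0` besides `A(z) + iB(z) = 0`.
    have hz' : (fun j => σ.symm (z j)) ∈ Z := by
      obtain ⟨s, _, rfl⟩ := hZ
      intro f hf
      have := MvPolynomial.comp_aeval_apply z σ.symm.toAlgHom f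
      rw [hz f hf, map_zero] at this
      exact this.symm
    have hσz : ∀ f : MvPolynomial (Fin n) R,
        σ (MvPolynomial.aeval (fun j => σ.symm (z j)) f) = MvPolynomial.aeval z f := fun f => by
      have := MvPolynomial.comp_aeval_apply (fun j => σ.symm (z j)) σ.toAlgHom f
      simpa using this
    have h1 := h z hz
    have h2 := congrArg σ (h _ hz')
    simp only [map_add, map_mul, MvPolynomial.aeval_map_algebraMap, MvPolynomial.aeval_C, hσz, hσ,
      Algebra.algebraMap_self, RingHom.id_apply, map_zero] at h1 h2
    have hi0 : i ≠ 0 := by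
      rintro rfl
      simp at hi
    have hA : 2 * MvPolynomial.aeval z A = 0 := by linear_combination h1 + h2
    have hA' := (mul_eq_zero.1 hA).resolve_left two_ne_zero
    rw [hA', zero_add] at h1
    exact ⟨hA', (mul_eq_zero.1 h1).resolve_left hi0⟩
  exact ⟨fun z hz => by rw [MvPolynomial.aeval_map_algebraMap]; exact (key z hz).1,
    fun z hz => by rw [MvPolynomial.aeval_map_algebraMap]; exact (key z hz).2⟩

omit [LinearOrder R] [IsStrictOrderedRing R] in
theorem eval_realPoint_map (x : Fin n → R) (f : MvPolynomial (Fin n) R) :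
    MvPolynomial.eval (realPoint C x) (MvPolynomial.map (algebraMap R C) f) =
      algebraMap R C (MvPolynomial.eval x f) := by
  rw [MvPolynomial.eval_map]
  exact (MvPolynomial.eval₂_comp _ _ _).symm

omit [LinearOrder R] [IsStrictOrderedRing R] in
theorem aeval_realPoint (x : Fin n → R) (f : MvPolynomial (Fin n) R) :
    MvPolynomial.aeval (realPoint C x) f = algebraMap R C (MvPolynomial.eval x f) := by
  rw [← eval_realPoint_map, MvPolynomial.eval_map, MvPolynomial.aeval_def]

omit [LinearOrder R] [IsStrictOrderedRing R] in
theorem gradientAt_map (x : Fin n → R) (f : MvPolynomial (Fin n) R) :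
    gradientAt (MvPolynomial.map (algebraMap R C) f) (realPoint C x) =
      realPoint C (gradientAt f x) := by
  ext j
  rw [gradientAt, MvPolynomial.pderiv_map, eval_realPoint_map]
  rfl

theorem jacobianAt_map {p : ℕ} (G : Fin p → MvPolynomial (Fin n) R) (x : Fin n → R) :
    jacobianAt (fun k => MvPolynomial.map (algebraMap R C) (G k)) (realPoint C x) =
      (jacobianAt G x).map (algebraMap R C) := by
  ext k j
  exact congrFun (gradientAt_map x (G k)) j

/-- Real and imaginary parts of equations of `Z` are again equations, so real ones suffice to span
the conormal space. -/
theorem span_gradientAt_map [IsRealClosed R] [IsAlgClosure R C] {i : C} (hi : i ^ 2 = -1)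
    {Z : Set (Fin n → C)} (hZ : IsAlgebraicSet R Z) (y : Fin n → C) :
    Submodule.span C {v | ∃ f : MvPolynomial (Fin n) R,
        MvPolynomial.map (algebraMap R C) f ∈ MvPolynomial.vanishingIdeal C Z ∧
        gradientAt (MvPolynomial.map (algebraMap R C) f) y = v} =
      Submodule.span C ((gradientAt · y) '' (MvPolynomial.vanishingIdeal C Z : Set _)) := by
  refine le_antisymm (Submodule.span_mono ?_) (Submodule.span_le.2 ?_)
  · rintro _ ⟨f, hf, rfl⟩
    exact ⟨_, hf, rfl⟩
  · rintro _ ⟨F, hF, rfl⟩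
    obtain ⟨A, B, rfl⟩ := exists_eq_map_add_C_mul_map (R := R) hi F
    obtain ⟨hA, hB⟩ := map_mem_vanishingIdeal hi hZ hF
    simp only [gradientAt_add, gradientAt_C_mul]
    exact Submodule.add_mem _ (Submodule.subset_span ⟨A, hA, rfl⟩)
      (Submodule.smul_mem _ _ (Submodule.subset_span ⟨B, hB, rfl⟩))

/-- At a regular point that is not critical for `φ`, the function `φ` and some real equations of
the set are part of a system of coordinates. -/
theorem exists_coordinates [IsRealClosed R] [IsAlgClosure R C] {i : C} (hi : i ^ 2 = -1) {d : ℕ}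
    {Z : Set (Fin n → C)} (hZ : IsAlgebraicSet R Z) {φ : MvPolynomial (Fin n) R} {x : Fin n → R}
    (hxZ : realPoint C x ∈ Z)
    (hx : realPoint C x ∉ singularPoints d (MvPolynomial.map (algebraMap R C) φ) Z) :
    ∃ (G : Fin n → MvPolynomial (Fin n) R) (I : Set (Fin n)) (k : Fin n),
      (∀ j, MvPolynomial.eval x (G j) = 0) ∧ (jacobianAt G x).det ≠ 0 ∧
      (∀ j ∈ I, MvPolynomial.map (algebraMap R C) (G j) ∈ MvPolynomial.vanishingIdeal C Z) ∧
      Iᶜ.ncard = d ∧ k ∉ I ∧ G k = φ - MvPolynomial.C (MvPolynomial.eval x φ) := by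
  classical
  set y := realPoint C x with hy
  have hreg : y ∈ regularLocus d Z := by
    by_contra h
    exact hx (Or.inr ⟨hxZ, h⟩)
  have hcrit : ¬ (tangentSpaceAt Z y).map
      (differentialAt (MvPolynomial.map (algebraMap R C) φ) y) < ⊤ :=
    fun h => hx (Or.inl ⟨hreg, h⟩)
  have hφ := gradientAt_notMem_span hcrit
  obtain ⟨-, p, g, hg, hrank⟩ := hreg
  rw [Matrix.rank_eq_finrank_span_row, span_range_row_jacobianAt hxZ hg] at hrank
  rw [← span_gradientAt_map hi hZ y] at hφ hrank
  set T : Set (Fin n → C) := {v | ∃ f : MvPolynomial (Fin n) R,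
    MvPolynomial.map (algebraMap R C) f ∈ MvPolynomial.vanishingIdeal C Z ∧
    gradientAt (MvPolynomial.map (algebraMap R C) f) y = v} with hT
  set v₀ := gradientAt (MvPolynomial.map (algebraMap R C) φ) y with hv₀
  obtain ⟨b, hbT, hbspan, hb⟩ := exists_linearIndependent C T
  have hb' : LinearIndepOn C id b := hb
  rw [← hbspan] at hφ hrank
  have hins := hb'.id_insert hφ
  -- `v₀` and the `n - d` vectors of `b` are completed to a basis from vectors that are all
  -- gradients of real polynomials.
  set T' : Set (Fin n → C) := insert v₀ (T ∪ Set.range fun j => Pi.single j 1) with hT'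
  have hsub : insert v₀ b ⊆ T' := Set.insert_subset_insert (hbT.trans Set.subset_union_left)
  set E := hins.extend hsub with hE
  have hEli : LinearIndepOn C id E := hins.linearIndepOn_extend hsub
  have hEsub : insert v₀ b ⊆ E := hins.subset_extend hsub
  have hET : E ⊆ T' := hins.extend_subset hsub
  have hEspan : Submodule.span C E = ⊤ := by
    rw [hins.span_extend_eq_span hsub, eq_top_iff, ← (Pi.basisFun C (Fin n)).span_eq]
    refine Submodule.span_mono ?_
    rintro _ ⟨j, rfl⟩
    exact Or.inr (Or.inr ⟨j, by simp⟩)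
  have hEfin : E.Finite := hEli.setFinite
  have : Fintype E := hEfin.fintype
  have hEcard : Fintype.card E = n := by
    have := finrank_span_set_eq_card hEli
    rw [hEspan, finrank_top, Module.finrank_fin_fun, Set.toFinset_card] at this
    exact this.symm
  let e : Fin n ≃ E := (Fintype.equivFinOfCardEq hEcard).symm
  have hchoice : ∀ v ∈ E, ∃ f : MvPolynomial (Fin n) R, MvPolynomial.eval x f = 0 ∧
      gradientAt (MvPolynomial.map (algebraMap R C) f) y = v ∧
      (v ∈ b → MvPolynomial.map (algebraMap R C) f ∈ MvPolynomial.vanishingIdeal C Z) ∧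
      (v = v₀ → f = φ - MvPolynomial.C (MvPolynomial.eval x φ)) := by
    intro v hv
    by_cases hv0 : v = v₀
    · subst hv0
      exact ⟨φ - MvPolynomial.C (MvPolynomial.eval x φ), by simp,
        by rw [map_sub, MvPolynomial.map_C, gradientAt_sub_C],
        fun h => absurd (Submodule.subset_span h) hφ, fun _ => rfl⟩
    · by_cases hvT : v ∈ T
      · obtain ⟨f, hf, rfl⟩ := hvT
        refine ⟨f, ?_, rfl, fun _ => hf, fun h => absurd h hv0⟩
        have := hf y hxZ
        rwa [MvPolynomial.aeval_map_algebraMap, aeval_realPoint,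
          FaithfulSMul.algebraMap_eq_zero_iff] at this
      · obtain ⟨j, rfl⟩ : v ∈ Set.range fun j => (Pi.single j 1 : Fin n → C) :=
          (((Set.mem_insert_iff.1 (hET hv)).resolve_left hv0).resolve_left hvT)
        exact ⟨MvPolynomial.X j - MvPolynomial.C (x j), by simp,
          by rw [map_sub, MvPolynomial.map_C, gradientAt_sub_C, MvPolynomial.map_X, gradientAt_X],
          fun h => absurd (hbT h) hvT, fun h => absurd h hv0⟩
  choose f hf0 hfgrad hfb hfv₀ using fun k => hchoice (e k) (e k).2
  have hk : (e (e.symm ⟨v₀, hEsub (Set.mem_insert _ _)⟩) : Fin n → C) = v₀ := by simp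
  refine ⟨f, {j | (e j : Fin n → C) ∈ b}, e.symm ⟨v₀, hEsub (Set.mem_insert _ _)⟩, hf0, ?_,
    fun j hj => hfb j hj, ?_, ?_, hfv₀ _ hk⟩
  · have hli : LinearIndependent C
        (jacobianAt (fun k => MvPolynomial.map (algebraMap R C) (f k)) y).row := by
      have : (jacobianAt (fun k => MvPolynomial.map (algebraMap R C) (f k)) y).row =
          fun k => (e k : Fin n → C) := funext hfgrad
      rw [this]
      exact LinearIndependent.comp hEli e e.injective
    rw [Matrix.linearIndependent_rows_iff_isUnit, Matrix.isUnit_iff_isUnit_det, hy, jacobianAt_map,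
      ← RingHom.mapMatrix_apply, ← RingHom.map_det, isUnit_iff_ne_zero] at hli
    intro h
    rw [h, map_zero] at hli
    exact hli rfl
  · have : Fintype b := (hEfin.subset ((Set.subset_insert _ _).trans hEsub)).fintype
    rw [finrank_span_set_eq_card hb', ← Set.ncard_eq_toFinset_card'] at hrank
    have h1 : {j | (e j : Fin n → C) ∈ b}.ncard = b.ncard := by
      refine Set.ncard_congr (fun j _ => (e j : Fin n → C)) (fun j hj => hj)
        (fun j k _ _ h => e.injective (Subtype.ext h)) fun v hv => ?_
      refine ⟨e.symm ⟨v, hEsub (Or.inr hv)⟩, ?_, ?_⟩ <;> simp [hv]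
    have h2 := Set.ncard_add_ncard_compl {j | (e j : Fin n → C) ∈ b}
    rw [Nat.card_eq_fintype_card, Fintype.card_fin] at h2
    omega
  · intro h
    rw [Set.mem_ofPred_eq, hk] at h
    exact hφ (Submodule.subset_span h)

variable [TopologicalSpace R] [OrderTopology R]

/-- At a point of the real locus that is not a singular point of `φ`, the function `φ` has no local
minimum. -/
theorem exists_eval_lt_of_notMem_singularPoints [IsRealClosed R] [IsAlgClosure R C] {d : ℕ}
    {Z : Set (Fin n → C)} (hZR : IsAlgebraicSet R Z) (hZ : IsEquidimensional d Z)
    {φ : MvPolynomial (Fin n) R} {x : Fin n → R} (hxZ : realPoint C x ∈ Z)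
    (hx : realPoint C x ∉ singularPoints d (MvPolynomial.map (algebraMap R C) φ) Z)
    {U : Set (Fin n → R)} (hU : U ∈ 𝓝 x) :
    ∃ y ∈ U, realPoint C y ∈ Z ∧ MvPolynomial.eval y φ < MvPolynomial.eval x φ := by
  have := IsAlgClosure.isAlgClosed R (K := C)
  have : CharZero C := charZero_of_injective_algebraMap (algebraMap R C).injective
  obtain ⟨i, hi⟩ := IsAlgClosed.exists_pow_nat_eq (-1 : C) two_pos
  obtain ⟨G, I, k, hG0, hJ, hGI, hd, hkI, hGk⟩ := exists_coordinates hi hZR hxZ hx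
  obtain ⟨s, hs, hsZ⟩ := id hZR
  -- Some multiple `a * f` with `a(x) = 1` lies in `(G_I)`. The real part `A` of `a` is 1 at `x`,
  -- and where it is nonzero at a real point, so is `a`.
  have hloc : ∀ f ∈ s, ∃ A : MvPolynomial (Fin n) R, MvPolynomial.eval x A ≠ 0 ∧
      ∀ y : Fin n → R, MvPolynomial.eval y A ≠ 0 → (∀ j ∈ I, MvPolynomial.eval y (G j) = 0) →
        MvPolynomial.aeval (realPoint C y) f = 0 := by
    intro f hf
    obtain ⟨a, ha, hmem⟩ := hZ.exists_mul_mem_span hZR hxZ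
      (G := fun j => MvPolynomial.map (algebraMap R C) (G j))
      (fun j => by rw [eval_realPoint_map, hG0, map_zero])
      (by
        rw [jacobianAt_map, ← RingHom.mapMatrix_apply, ← RingHom.map_det]
        simpa using hJ) hGI hd (F := MvPolynomial.map (algebraMap R C) f) (fun z hz => by
        rw [MvPolynomial.aeval_map_algebraMap]
        rw [hsZ] at hz
        exact hz f hf)
    obtain ⟨A, B, rfl⟩ := exists_eq_map_add_C_mul_map (R := R) hi a
    have heval : ∀ y : Fin n → R, MvPolynomial.eval (realPoint C y)
        (MvPolynomial.map (algebraMap R C) A + MvPolynomial.C i *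
          MvPolynomial.map (algebraMap R C) B) = algebraMap R C (MvPolynomial.eval y A) +
            algebraMap R C (MvPolynomial.eval y B) * i := fun y => by
      rw [map_add, map_mul, MvPolynomial.eval_C, eval_realPoint_map, eval_realPoint_map, mul_comm i]
    refine ⟨A, fun hA => ?_, fun y hy hyG => ?_⟩
    · have := (eq_zero_of_add_mul_eq_zero hi (a := MvPolynomial.eval x A - 1)
        (b := MvPolynomial.eval x B) (by
          rw [heval] at ha
          rw [map_sub, map_one]
          linear_combination ha)).1
      rw [hA, zero_sub, neg_eq_zero] at this
      exact one_ne_zero this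
    · have h0 : MvPolynomial.eval (realPoint C y) ((MvPolynomial.map (algebraMap R C) A +
          MvPolynomial.C i * MvPolynomial.map (algebraMap R C) B) *
            MvPolynomial.map (algebraMap R C) f) = 0 := by
        refine (Ideal.span_le.2 ?_ hmem : _ ∈ pointIdeal (realPoint C y))
        rintro _ ⟨j, hj, rfl⟩
        change MvPolynomial.eval _ _ = 0
        rw [eval_realPoint_map, hyG j hj, map_zero]
      rw [map_mul, heval, mul_eq_zero, eval_realPoint_map, ← aeval_realPoint y f] at h0
      exact h0.resolve_left fun h => hy (eq_zero_of_add_mul_eq_zero hi h).1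
  choose! A hAx hA using hloc
  have hV : U ∩ ⋂ f ∈ s, {y | MvPolynomial.eval y (A f) ≠ 0} ∈ 𝓝 x := by
    refine Filter.inter_mem hU ((Filter.biInter_mem hs).2 fun f hf => ?_)
    exact (IsPolyFun.eval (A f)).continuous.continuousAt.eventually_ne (hAx f hf)
  obtain ⟨δ, hδ, hopen⟩ := exists_eval_eq_of_det_ne_zero G hJ hV
  have hε : 0 < min 1 δ / 2 := by positivity
  -- The target lowers the coordinate `φ` and keeps the others at 0; capping by 1 makes the square
  -- of the decrement smaller than `δ`.
  obtain ⟨y, ⟨hyU, hyA⟩, hy⟩ := hopen (Pi.single k (-(min 1 δ / 2))) (by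
    rw [Finset.sum_eq_single k]
    · rw [hG0, Pi.single_eq_same]
      nlinarith [min_le_left 1 δ, min_le_right 1 δ]
    · intro j _ hj
      rw [hG0, Pi.single_eq_of_ne hj]
      ring
    · simp)
  refine ⟨y, hyU, ?_, ?_⟩
  · rw [hsZ]
    intro f hf
    refine hA f hf y (Set.mem_iInter₂.1 hyA f hf) fun j hj => ?_
    rw [hy, Pi.single_eq_of_ne]
    rintro rfl
    exact hkI hj
  · have := hy k
    rw [hGk, Pi.single_eq_same, map_sub, MvPolynomial.eval_C] at this
    linarith

theorem isClosed_setOf_realPoint_mem {Z : Set (Fin n → C)} (hZR : IsAlgebraicSet R Z) :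
    IsClosed {x : Fin n → R | realPoint C x ∈ Z} := by
  obtain ⟨s, -, rfl⟩ := hZR
  have : {x : Fin n → R | realPoint C x ∈ {z | ∀ f ∈ s, MvPolynomial.aeval z f = 0}} =
      ⋂ f ∈ s, {x | MvPolynomial.eval x f = 0} := by
    ext x
    simp [aeval_realPoint]
  rw [this]
  exact isClosed_biInter fun f _ => isClosed_eq (IsPolyFun.eval f).continuous continuous_const

end RealStructure

end RealAlg

/-! ### The minimum on a bounded component. -/

theorem mainTheorem6
    {R : Type*} [Field R] [LinearOrder R] [IsStrictOrderedRing R] [IsRealClosed R]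
    [TopologicalSpace R] [OrderTopology R]
    {C : Type*} [Field C] [Algebra R C] [IsAlgClosure R C]
    {n d : ℕ} (hd : 0 < d)
    (Z : Set (Fin n → C)) (hZR : RealAlg.IsAlgebraicSet R Z) (hZ : RealAlg.IsEquidimensional d Z)
    (φ : MvPolynomial (Fin n) R) (u : R) (B : Set (Fin n → R))
    (hB : RealAlg.IsSemialgConnectedComponent B (RealAlg.realSublevel Z φ u))
    (hbdd : RealAlg.IsBoundedSet B) :
    ∃ x ∈ B, RealAlg.realPoint C x ∈
      RealAlg.singularPoints d (MvPolynomial.map (algebraMap R C) φ) Z := by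
  open RealAlg in
  obtain ⟨b, hb⟩ := hB.nonempty
  have hφ := IsPolyFun.eval φ
  obtain ⟨O, hO, hOB⟩ := isOpen_induced_iff.1 hB.isClopen.isOpen
  obtain ⟨D, hD, hDB⟩ := isClosed_induced_iff.1 hB.isClopen.isClosed
  have hOmem : ∀ y ∈ realSublevel Z φ u, y ∈ O ↔ y ∈ B := fun y hy =>
    Set.ext_iff.1 hOB ⟨y, hy⟩
  have hDmem : ∀ y ∈ realSublevel Z φ u, y ∈ D ↔ y ∈ B := fun y hy =>
    Set.ext_iff.1 hDB ⟨y, hy⟩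
  let K := {y | y ∈ B ∧ MvPolynomial.eval y φ ≤ MvPolynomial.eval b φ}
  -- Since `φ(b) < u`, the condition `φ ≤ φ(b)` implies the strict one, leaving an intersection of
  -- closed sets.
  have hK : K = D ∩ {y | realPoint C y ∈ Z} ∩
      {y | MvPolynomial.eval y φ ≤ MvPolynomial.eval b φ} := by
    ext y
    constructor
    · rintro ⟨hy, hyb⟩
      exact ⟨⟨(hDmem y (hB.subset hy)).2 hy, (hB.subset hy).1⟩, hyb⟩
    · rintro ⟨⟨hyD, hyZ⟩, hyb⟩
      exact ⟨(hDmem y ⟨hyZ, hyb.trans_lt (hB.subset hb).2⟩).1 hyD, hyb⟩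
  have hKc : IsClosed K := by
    rw [hK]
    exact (hD.inter (isClosed_setOf_realPoint_mem hZR)).inter
      (isClosed_le hφ.continuous continuous_const)
  obtain ⟨x, ⟨hxB, hxb⟩, hmin⟩ := exists_forall_le
    (hB.semialgebraic.and (IsSemialgebraic.setOf_le hφ (IsPolyFun.const _))) hKc
    (hbdd.imp fun r hr y hy => hr y hy.1) ⟨b, hb, le_rfl⟩ hφ
  refine ⟨x, hxB, ?_⟩
  by_contra hx
  -- A lower point of `Z` inside the open set `O` stays in `B`, hence in `K`, against minimality.
  obtain ⟨y, hyO, hyZ, hy⟩ := exists_eval_lt_of_notMem_singularPoints hZR hZ (hB.subset hxB).1 hx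
    (hO.mem_nhds ((hOmem x (hB.subset hxB)).2 hxB))
  have hyS : y ∈ realSublevel Z φ u := ⟨hyZ, hy.trans (hB.subset hxB).2⟩
  exact (hmin y ⟨(hOmem y hyS).1 hyO, hy.le.trans hxb⟩).not_gt hy
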